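/- Let $\Lambda$ be a finite-dimensional Frobenius $\mathbb{C}$-algebra (for example, the contraction algebra of a crepant resolution of an isolated cDV singularity, which is finite-dimensional and symmetric). Let $\Lambda[\imath^{\pm1}]=\Lambda\otimes_{\mathbb C}\mathbb{C}[\imath^{\pm1}]$ be the graded algebra with $|\imath|=-2$. Let $HH^{p,q}(\Lambda[\imath^{\pm1}])$ denote its bigraded Hochschild cohomology ($p$ the Hochschild degree, $q$ the internal degree), with the cup product and the Gerstenhaber bracket, with signs such that $$[a,b\cdot c]=[a,b]\cdot c+(-1)^{(|a|-1)|b|}\,b\cdot[a,c],\qquad |a|=p+q .$$ Let $\delta\in HH^{1,0}(\Lambda[\imath^{\pm1}])$ be the class of the derivation $a\mapsto\tfrac{|a|}{2}a$, so that $[\delta,\imath]=-\imath$, and regard classes of $HH^{\bullet}(\Lambda)=HH^\bullet(\Lambda,\Lambda)$ as classes in $HH^{\bullet,0}(\Lambda[\imath^{\pm1}])$ by $\mathbb{C}[\imath^{\pm1}]$-multilinear extension of cochains. Let $u\in HH^4(\Lambda)$ be a class with $[u,u]=0$ that is a unit in the Hochschild--Tate cohomology $\widehat{HH}^\bullet(\Lambda)=\underline{\mathrm{Ext}}^{\bullet}_{\Lambda^e}(\Lambda,\Lambda)$;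 that is, the morphism $\Omega^4_{\Lambda^e}(\Lambda)\to\Lambda$ given by $u$ is an isomorphism in the stable category of $\Lambda$-bimodules. Let $p\ge 2$, $q\in\mathbb{Z}$, $x\in HH^p(\Lambda)$ and $y\in HH^{p-1}(\Lambda)$, and suppose that $$[u\cdot\imath,\ (x+y\cdot\delta)\cdot\imath^q]=0 .$$ Then $$(x+y\cdot\delta)\cdot\imath^q=[u\cdot\imath,\ u^{-1}\cdot\delta\cdot x\cdot\imath^{q-1}].$$ Here the right-hand side is computed in the localization $HH^{\bullet,*}(\Lambda[\imath^{\pm1}])[u^{-1}]$ (a model of $\widehat{HH}^\bullet(\Lambda)[\imath^{\pm1},\delta]$) with the unique Gerstenhaber bracket that extends the one of $HH^{\bullet,*}(\Lambda[\imath^{\pm1}])$, and the equation determines $(x+y\cdot\delta)\cdot\imath^q$ as a class in $HH^{p,-2q}(\Lambda[\imath^{\pm1}])$: if $x'\in HH^p(\Lambda)$, $y'\in HH^{p-1}(\Lambda)$ and $(x'+y'\cdot\delta)\cdot\imath^q$ equals the right-hand side in the localization, then $(x'+y'\cdot\delta)\cdot\imath^q=(x+y\cdot\delta)\cdot\imath^q$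 in $HH^{p,-2q}(\Lambda[\imath^{\pm1}])$. If $p\ge5$, then $u^{-1}x$ is represented by a class $x'\in HH^{p-4}(\Lambda)$ with $u\cdot x'=x$, and $(x+y\cdot\delta)\cdot\imath^q=[u\cdot\imath,\delta\cdot x'\cdot\imath^{q-1}]$ already holds in $HH^{p,-2q}(\Lambda[\imath^{\pm1}])$. In particular, such classes are exact for the differential $[u\cdot\imath,-]$. -/

import Mathlib

open scoped TensorProduct LaurentPolynomial

noncomputable section

universe u

namespace Hoch

/-! ## Hochschild cochains of an evenly graded algebra

Throughout, a cochain on an algebra `A` is a function on finite lists `[a₁, …, aₚ]` of elements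
of `A`.  The gradings `𝒜` that are used below are concentrated in even degrees, so that the parity
of the total degree of a nonzero cochain of bidegree `(p, b)` is the parity of `p`, and elements of
`A` produce no Koszul signs. -/

/-- The Hochschild cochains of bidegree `(p, b)`: functions on lists of length `p` (extended by
zero to all other lists) which are `k`-linear in every entry and homogeneous of degree `b`. -/
def HC (k : Type*) {A : Type*} [CommRing k] [Ring A] [Algebra k A]
    (𝒜 : ℤ → Submodule k A) (p : ℕ) (b : ℤ) : Set (List A → A) :=
  {f | (∀ l r : List A, IsLinearMap k fun a => f (l ++ a :: r)) ∧
    (∀ l : List A, l.length ≠ p → f l = 0) ∧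
    ∀ (l : List A) (ds : List ℤ), List.Forall₂ (fun a d => a ∈ 𝒜 d) l ds →
      f l ∈ 𝒜 (ds.sum + b)}

/-- The brace `f{g} (a₁, …, aₘ) = ∑ ± f(a₁, …, aᵢ, g(aᵢ₊₁, …, aᵢ₊ₙ), aᵢ₊ₙ₊₁, …, aₘ)`, with the
sign `(-1) ^ (i (n - 1))`. -/
def brace {A : Type*} [Ring A] (f g : List A → A) (l : List A) : A :=
  ∑ i ∈ Finset.range (l.length + 1), ∑ n ∈ Finset.range (l.length - i + 1),
    (-1 : ℤ) ^ (i * (n + 1)) • f (l.take i ++ g ((l.drop i).take n) :: l.drop (i + n))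

/-- The bracket `[f, g] = f{g} - (-1) ^ ((p - 1) (r - 1)) g{f}` of cochains of Hochschild
degrees `p` and `r`; its Hochschild degree is `p + r - 1`. -/
def bracket {A : Type*} [Ring A] (p r : ℕ) (f g : List A → A) : List A → A :=
  brace f g - (-1 : ℤ) ^ ((p + 1) * (r + 1)) • brace g f

/-- The cochain `m₂`, which is minus the multiplication of `A`. -/
def mTwo {A : Type*} [Ring A] : List A → A
  | [a, b] => -(a * b)
  | _ => 0

/-- The Hochschild differential `∂ f = [m₂, f]` on cochains of Hochschild degree `p`. -/
def diff {A : Type*} [Ring A] (p : ℕ) (f : List A → A) : List A → A :=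
  bracket 2 p mTwo f

/-- The cup product `f · g = (-1) ^ (p - 1) m₂{f, g}`, that is,
`(f · g)(a₁, …, aₚ₊ᵣ) = (-1) ^ (p r) f(a₁, …, aₚ) g(aₚ₊₁, …, aₚ₊ᵣ)`
for `f`, `g` of Hochschild degrees `p`, `r`. -/
def cup {A : Type*} [Ring A] (f g : List A → A) (l : List A) : A :=
  ∑ i ∈ Finset.range (l.length + 1),
    (-1 : ℤ) ^ (i * (l.length - i)) • (f (l.take i) * g (l.drop i))

/-- The element `a` of `A`, as a cochain of Hochschild degree `0`. -/
def const {A : Type*} [Ring A] (a : A) : List A → A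
  | [] => a
  | _ => 0

/-- Hochschild cocycles of bidegree `(p, b)`. -/
def HZ (k : Type*) {A : Type*} [CommRing k] [Ring A] [Algebra k A]
    (𝒜 : ℤ → Submodule k A) (p : ℕ) (b : ℤ) : Set (List A → A) :=
  {f | f ∈ HC k 𝒜 p b ∧ diff p f = 0}

/-- Hochschild coboundaries of bidegree `(p, b)`. -/
def HB (k : Type*) {A : Type*} [CommRing k] [Ring A] [Algebra k A]
    (𝒜 : ℤ → Submodule k A) : ℕ → ℤ → Set (List A → A)
  | 0, _ => {0}
  | p + 1, b => {f | ∃ w ∈ HC k 𝒜 p b, diff p w = f}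

/-- Two cocycles of bidegree `(p, b)` have the same class in `HH^{p, b}`. -/
def SameClass (k : Type*) {A : Type*} [CommRing k] [Ring A] [Algebra k A]
    (𝒜 : ℤ → Submodule k A) (p : ℕ) (b : ℤ) (f g : List A → A) : Prop :=
  f - g ∈ HB k 𝒜 p b

/-! ## Inverting an even class

For a cocycle `u` of bidegree `(4, 0)`, the localization `HH^{•,*}(A)[u⁻¹]` of the graded
commutative algebra `HH^{•,*}(A)` consists of fractions `u⁻ᵏ · a`. Its Gerstenhaber bracket is
the unique one that extends the bracket of `HH^{•,*}(A)`. -/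

/-- The product `uᵏ · a`. -/
def powCup {A : Type*} [Ring A] (u : List A → A) (k : ℕ) (a : List A → A) : List A → A :=
  (cup u)^[k] a

/-- A representative `u⁻ᵏ · a` of an element of the localization; it has Hochschild degree `n` if
`a` has Hochschild degree `n + 4 k` (and `n` may be negative). -/
structure Frac (A : Type*) where
  num : List A → A
  exp : ℕ

/-- `u⁻ᵏ · a = u⁻ˡ · c` in bidegree `(n, b)` of the localization, that is,
`uᵐ⁺ˡ · a = uᵐ⁺ᵏ · c` in `HH^{n + 4 (m + k + l), b}` for some `m`. -/
def Frac.SameClass (k : Type*) {A : Type*} [CommRing k] [Ring A] [Algebra k A]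
    (𝒜 : ℤ → Submodule k A) (u : List A → A) (n : ℕ) (b : ℤ) (s t : Frac A) : Prop :=
  ∃ m : ℕ, Hoch.SameClass k 𝒜 (n + 4 * (m + s.exp + t.exp)) b
    (powCup u (m + t.exp) s.num) (powCup u (m + s.exp) t.num)

/-- The bracket `[w, u⁻ᵏ · a] = u⁻ᵏ · [w, a] - k u⁻ᵏ⁻¹ · [w, u] · a` of a class `w` of Hochschild
degree `p` with a fraction `u⁻ᵏ · a` whose numerator `a` has Hochschild degree `r`, written with
the common denominator `uᵏ⁺¹`. -/
def Frac.bracket {A : Type*} [Ring A] (u : List A → A) (p r : ℕ) (w : List A → A)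
    (s : Frac A) : Frac A where
  num := cup u (Hoch.bracket p r w s.num) - s.exp • cup (Hoch.bracket p 4 w u) s.num
  exp := s.exp + 1

/-! ## Units of Hochschild–Tate cohomology -/

/-- The enveloping algebra `Λ ⊗ Λᵒᵖ`; left modules over it are `Λ`-bimodules. -/
def Env (Λ : Type*) [Ring Λ] [Algebra ℂ Λ] : Type _ := Λ ⊗[ℂ] Λᵐᵒᵖ

instance (Λ : Type*) [Ring Λ] [Algebra ℂ Λ] : Ring (Env Λ) := inferInstanceAs (Ring (Λ ⊗[ℂ] Λᵐᵒᵖ))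

instance (Λ : Type*) [Ring Λ] [Algebra ℂ Λ] : Algebra ℂ (Env Λ) :=
  inferInstanceAs (Algebra ℂ (Λ ⊗[ℂ] Λᵐᵒᵖ))

/-- The element `a ⊗ b` of the enveloping algebra. -/
def Env.tmul {Λ : Type*} [Ring Λ] [Algebra ℂ Λ] (a b : Λ) : Env Λ :=
  (a ⊗ₜ[ℂ] MulOpposite.op b : Λ ⊗[ℂ] Λᵐᵒᵖ)

/-- The regular bimodule. -/
instance regularBimodule (Λ : Type*) [Ring Λ] [Algebra ℂ Λ] : Module (Env Λ) Λ :=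
  (TensorProduct.Algebra.module : Module (Λ ⊗[ℂ] Λᵐᵒᵖ) Λ)

theorem Env.tmul_smul {Λ : Type*} [Ring Λ] [Algebra ℂ Λ] (a b x : Λ) :
    Env.tmul a b • x = a * x * b := by
  refine (TensorProduct.Algebra.smul_def (R := ℂ) a (MulOpposite.op b) x).trans ?_
  simp [mul_assoc]

/-- The term `Λ ⊗ Λ^{⊗ n} ⊗ Λ` of the bar resolution of the regular bimodule, as the free module
over the enveloping algebra on the vector space `Λ^{⊗ n}`. -/
abbrev Bar (Λ : Type*) [Ring Λ] [Algebra ℂ Λ] (n : ℕ) : Type _ :=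
  Env Λ ⊗[ℂ] (PiTensorProduct ℂ fun _ : Fin n => Λ)

/-- The element `b ⊗ a₁ ⊗ ⋯ ⊗ aₙ ⊗ c` of `Bar Λ n`. -/
def barElem {Λ : Type*} [Ring Λ] [Algebra ℂ Λ] {n : ℕ} (b c : Λ) (a : Fin n → Λ) : Bar Λ n :=
  Env.tmul b c ⊗ₜ[ℂ] PiTensorProduct.tprod ℂ a

/-- The bar differential of the generator `1 ⊗ a₀ ⊗ ⋯ ⊗ aₙ ⊗ 1` of `Bar Λ (n + 1)`. -/
def barBoundary (Λ : Type*) [Ring Λ] [Algebra ℂ Λ] (n : ℕ) (a : Fin (n + 1) → Λ) : Bar Λ n :=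
  barElem (a 0) 1 (Fin.tail a)
    + ∑ j : Fin n, (-1 : ℤ) ^ ((j : ℕ) + 1) •
        barElem 1 1 (Fin.contractNth j.castSucc (· * ·) a)
    + (-1 : ℤ) ^ (n + 1) • barElem 1 (a (Fin.last n)) (Fin.init a)

/-- The syzygy `Ωⁿ(Λ)` of the regular bimodule, as the cokernel of `Bar Λ (n + 1) → Bar Λ n`. -/
abbrev Syzygy (Λ : Type*) [Ring Λ] [Algebra ℂ Λ] (n : ℕ) : Type _ :=
  Bar Λ n ⧸ Submodule.span (Env Λ) (Set.range (barBoundary Λ n))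

/-- A module homomorphism that vanishes in the stable category. -/
def FactorsThroughProjective {R M N : Type u} [Ring R] [AddCommGroup M] [AddCommGroup N]
    [Module R M] [Module R N] (f : M →ₗ[R] N) : Prop :=
  ∃ (P : Type u) (_ : AddCommGroup P) (_ : Module R P), Module.Projective R P ∧
    ∃ (g : M →ₗ[R] P) (h : P →ₗ[R] N), f = h ∘ₗ g

/-- A module homomorphism that is invertible in the stable category. -/
def IsStableIso {R M N : Type u} [Ring R] [AddCommGroup M] [AddCommGroup N]
    [Module R M] [Module R N] (f : M →ₗ[R] N) : Prop :=
  ∃ g : N →ₗ[R] M, FactorsThroughProjective (f ∘ₗ g - LinearMap.id) ∧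
    FactorsThroughProjective (g ∘ₗ f - LinearMap.id)

/-- The class of an `n`-cocycle `u` in `HH-hat^n(Λ, Λ)`, the space of stable morphisms from `Ωⁿ(Λ)`
to `Λ`, is a unit of the Hochschild–Tate cohomology of `Λ` (the graded algebra of
stable self-extensions of the regular bimodule): the bimodule homomorphism `Ωⁿ(Λ) → Λ`,
`1 ⊗ a₁ ⊗ ⋯ ⊗ aₙ ⊗ 1 ↦ u(a₁, …, aₙ)`, is an isomorphism in the stable category of
`Λ`-bimodules. -/
def IsTateUnit (Λ : Type u) [Ring Λ] [Algebra ℂ Λ] (n : ℕ) (u : List Λ → Λ) : Prop :=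
  ∃ φ : Syzygy Λ n →ₗ[Env Λ] Λ,
    (∀ a : Fin n → Λ, φ (Submodule.Quotient.mk (barElem 1 1 a)) = u (List.ofFn a)) ∧
    IsStableIso φ

/-- A finite-dimensional algebra with this property is a Frobenius algebra: there is a linear form
whose kernel contains no nonzero right ideal. -/
def IsFrobenius (Λ : Type*) [Ring Λ] [Algebra ℂ Λ] : Prop :=
  ∃ ε : Λ →ₗ[ℂ] ℂ, ∀ a : Λ, (∀ b : Λ, ε (a * b) = 0) → a = 0

/-! ## The graded algebra `Λ[ı^{±1}]` with `|ı| = -2`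

The element `ı` is the Laurent variable `T 1`; it commutes with `Λ`. -/

/-- `Λ` as a graded algebra concentrated in degree `0`. -/
def degZero (Λ : Type*) [Ring Λ] [Algebra ℂ Λ] (d : ℤ) : Submodule ℂ Λ :=
  if d = 0 then ⊤ else ⊥

/-- The grading of `Λ[ı^{±1}]`: the degree `d` part is spanned by the `c ıⁿ` with `d = -2 n`. -/
def gr (Λ : Type*) [Ring Λ] [Algebra ℂ Λ] (d : ℤ) : Submodule ℂ Λ[T;T⁻¹] :=
  Submodule.span ℂ
    {a | ∃ (c : Λ) (n : ℤ), d = -2 * n ∧ a = LaurentPolynomial.C c * LaurentPolynomial.T n}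

/-- The `ℂ[ı^{±1}]`-multilinear extension of a cochain `f` of `Λ`, that is, the multilinear cochain
with `(c₁ ı^{n₁}, …, cₚ ı^{nₚ}) ↦ f(c₁, …, cₚ) ı^{n₁ + ⋯ + nₚ}`. -/
def ext {Λ : Type*} [Ring Λ] (f : List Λ → Λ) : List Λ[T;T⁻¹] → Λ[T;T⁻¹]
  | [] => LaurentPolynomial.C (f [])
  | a :: l => a.coeff.sum fun n c => ext (fun t => f (c :: t)) l * LaurentPolynomial.T n

/-- The power `ı^q`, as a cochain of bidegree `(0, -2 q)`. -/
def iota (Λ : Type*) [Ring Λ] (q : ℤ) : List Λ[T;T⁻¹] → Λ[T;T⁻¹] :=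
  const (LaurentPolynomial.T q)

/-- The fractional Euler derivation `a ↦ (|a| / 2) a`, that is, `c ıⁿ ↦ -n c ıⁿ`, as a cochain of
bidegree `(1, 0)`. -/
def euler (Λ : Type*) [Ring Λ] : List Λ[T;T⁻¹] → Λ[T;T⁻¹]
  | [a] => a.coeff.sum fun n c => LaurentPolynomial.C ((-n) • c) * LaurentPolynomial.T n
  | _ => 0

/-- The cochain `(x + y · δ) · ı^q` of `Λ[ı^{±1}]`. -/
def total {Λ : Type*} [Ring Λ] (x y : List Λ → Λ) (q : ℤ) : List Λ[T;T⁻¹] → Λ[T;T⁻¹] :=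
  cup (ext x + cup (ext y) (euler Λ)) (iota Λ q)

/-- The cochain `δ · x · ı^q` of `Λ[ı^{±1}]`. -/
def eulerMul {Λ : Type*} [Ring Λ] (x : List Λ → Λ) (q : ℤ) : List Λ[T;T⁻¹] → Λ[T;T⁻¹] :=
  cup (cup (euler Λ) (ext x)) (iota Λ q)

end Hoch

end

/-!
Hochschild cochains are functions on lists, and all operations on them are sums over decompositions
of a list. The sign-free convolution product `conv` and the insertions `ins`, `dins` (the braces
with one and two arguments) satisfy identities that hold on cochains, and the cup product, the
bracket and the Hochschild differential are combinations of them. Two homotopies carry the calculus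
of classes: `dH_ins` gives the graded commutativity of the cup product, and `dH_dins` gives the
Leibniz rule of the bracket with a class `u` of degree `4`.

*The bracket.* By the Leibniz rule and `[δ, ı] = -ı`, the bracket `[u ı, δ x ı^{q - 1}]` is
`(u x ± δ [u, x]) ı^q` (`bracket_eulerMul_mem_HB`). The hypothesis `[u ı, (x + y δ) ı^q] = 0`,
restricted to `Λ`, where `δ` vanishes, says that `[u, x] = ± u y` (`br_add_conv_mem_HB`). Hence
`[u ı, δ x ı^{q - 1}] = u (x + y δ) ı^q` (`bracket_sub_conv_tot_mem_HB`). Since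
`[u ı, u] = [u, u] ı = 0`, the denominator of `u⁻¹ δ x ı^{q - 1}` does not contribute to the
bracket, which gives the equation in the localization.

*Uniqueness.* A class `(x + y δ) ı^q` vanishes only if both components vanish
(`mem_HB_of_tot_mem_HB`): the restriction to `Λ` recovers `x`, and the insertion of the central
elements `ı` and `1`, which commutes with the differential up to sign, recovers `y`. Multiplication
by `u` acts on the components, so it remains to see that it is injective on Hochschild cohomology in
positive degrees. If `p ≥ 5`, then surjectivity gives `x'` with `u x' = x`, and
`u [u, x'] = [u, u x'] = [u, x] = ± u y` together with injectivity gives `[u, x'] = ± y`, so that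
the same computation with `x'` in place of `x` needs no denominator.

*Bijectivity.* The chain map `Bar (n + 4) → Bar n` defined by `u` lifts the homomorphism `Ω⁴(Λ) → Λ`
from the truncated bar resolution of `Ω⁴(Λ)` to the bar resolution of `Λ`, and precomposition with
it is multiplication by `u`. A chain map of projective resolutions that lifts a stable isomorphism
has a homotopy inverse in positive degrees (`IsResolution.exists_homotopy_inverse`): an endomorphism
that lifts a map factoring through a projective module is null-homotopic there. Therefore `u` acts
bijectively in positive degrees.
-/

open scoped TensorProduct LaurentPolynomial

noncomputable section

set_option linter.unusedSectionVars false

universe u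

namespace Hoch

/-! ### Sums over the deconcatenations of a list -/

/-- The sum of `Φ x y` over all decompositions `l = x ++ y`. -/
def splitSum {A N : Type*} [AddCommGroup N] (Φ : List A → List A → N) : List A → N
  | [] => Φ [] []
  | a :: l => Φ [] (a :: l) + splitSum (fun x y => Φ (a :: x) y) l

section splitSum

variable {A B N M : Type*} [AddCommGroup N] [AddCommGroup M]

theorem splitSum_nil (Φ : List A → List A → N) : splitSum Φ [] = Φ [] [] := rfl

theorem splitSum_cons (Φ : List A → List A → N) (a : A) (l : List A) :
    splitSum Φ (a :: l) = Φ [] (a :: l) + splitSum (fun x y => Φ (a :: x) y) l := rfl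

theorem splitSum_congr {Φ Ψ : List A → List A → N} {l : List A}
    (h : ∀ x y, x ++ y = l → Φ x y = Ψ x y) : splitSum Φ l = splitSum Ψ l := by
  induction l generalizing Φ Ψ with
  | nil => exact h _ _ rfl
  | cons a l ih =>
    rw [splitSum_cons, splitSum_cons, h [] _ rfl, ih fun x y e => h _ _ (by simp [e])]

theorem splitSum_add (Φ Ψ : List A → List A → N) (l : List A) :
    splitSum (fun x y => Φ x y + Ψ x y) l = splitSum Φ l + splitSum Ψ l := by
  induction l generalizing Φ Ψ with
  | nil => rfl
  | cons a l ih => rw [splitSum_cons, ih, splitSum_cons, splitSum_cons]; abel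

theorem map_splitSum {F : Type*} [FunLike F N M] [AddMonoidHomClass F N M] (f : F)
    (Φ : List A → List A → N) (l : List A) :
    f (splitSum Φ l) = splitSum (fun x y => f (Φ x y)) l := by
  induction l generalizing Φ with
  | nil => rfl
  | cons a l ih => rw [splitSum_cons, map_add, ih, splitSum_cons]

theorem splitSum_zero (l : List A) : splitSum (fun _ _ => (0 : N)) l = 0 := by
  induction l with
  | nil => rfl
  | cons a l ih => rw [splitSum_cons, ih, add_zero]

theorem splitSum_neg (Φ : List A → List A → N) (l : List A) :
    splitSum (fun x y => -Φ x y) l = -splitSum Φ l :=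
  (map_splitSum (negAddMonoidHom : N →+ N) Φ l).symm

theorem splitSum_smul {R : Type*} [Monoid R] [DistribMulAction R N] (c : R)
    (Φ : List A → List A → N) (l : List A) :
    splitSum (fun x y => c • Φ x y) l = c • splitSum Φ l :=
  (map_splitSum (DistribSMul.toAddMonoidHom N c) Φ l).symm

theorem splitSum_eq_zero {Φ : List A → List A → N} {l : List A}
    (h : ∀ x y, x ++ y = l → Φ x y = 0) : splitSum Φ l = 0 :=
  (splitSum_congr h).trans (splitSum_zero l)

theorem splitSum_comm (Φ : List A → List A → List B → List B → N) (l : List A) (l' : List B) :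
    splitSum (fun x y => splitSum (fun u v => Φ x y u v) l') l =
      splitSum (fun u v => splitSum (fun x y => Φ x y u v) l) l' := by
  induction l generalizing Φ with
  | nil => rfl
  | cons a l ih => simp only [splitSum_cons, ih, splitSum_add]

/-- Coassociativity of deconcatenation. -/
theorem splitSum_assoc (Φ : List A → List A → List A → N) (l : List A) :
    splitSum (fun x w => splitSum (fun u v => Φ u v w) x) l =
      splitSum (fun u x => splitSum (fun v w => Φ u v w) x) l := by
  induction l generalizing Φ with
  | nil => rfl
  | cons a l ih =>
    simp only [splitSum_cons, splitSum_nil, splitSum_add, ih]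
    abel

theorem splitSum_append_cons (Φ : List A → List A → N) (x : List A) (b : A) (z : List A) :
    splitSum Φ (x ++ b :: z) = splitSum (fun u v => Φ u (v ++ b :: z)) x
      + splitSum (fun u v => Φ (x ++ b :: u) v) z := by
  induction x generalizing Φ with
  | nil => rfl
  | cons a x ih =>
    rw [List.cons_append, splitSum_cons, ih, splitSum_cons]
    simp only [List.cons_append]
    abel

theorem splitSum_map (Φ : List B → List B → N) (f : A → B) (l : List A) :
    splitSum Φ (l.map f) = splitSum (fun x y => Φ (x.map f) (y.map f)) l := by
  induction l generalizing Φ with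
  | nil => rfl
  | cons a l ih => rw [List.map_cons, splitSum_cons, ih, splitSum_cons]; rfl

/-- Only the decomposition with empty left part contributes. -/
theorem splitSum_left {Φ : List A → List A → N} (h : ∀ a x y, Φ (a :: x) y = 0) (l : List A) :
    splitSum Φ l = Φ [] l := by
  cases l with
  | nil => rfl
  | cons a l => rw [splitSum_cons, splitSum_eq_zero fun x y _ => h a x y, add_zero]

/-- Only the decomposition with empty right part contributes. -/
theorem splitSum_right {Φ : List A → List A → N} (h : ∀ x a y, Φ x (a :: y) = 0) (l : List A) :
    splitSum Φ l = Φ l [] := by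
  induction l generalizing Φ with
  | nil => rfl
  | cons a l ih => rw [splitSum_cons, ih fun x b y => h _ b y, h, zero_add]

theorem splitSum_eq_sum_range (Φ : List A → List A → N) (l : List A) :
    splitSum Φ l = ∑ i ∈ Finset.range (l.length + 1), Φ (l.take i) (l.drop i) := by
  induction l generalizing Φ with
  | nil => simp [splitSum_nil]
  | cons a l ih =>
    rw [splitSum_cons, ih, List.length_cons, Finset.sum_range_succ' _ (l.length + 1), add_comm]
    rfl

end splitSum

/-! ### Multilinear functions on lists -/

/-- Linearity in every entry of the list. -/
def Multilinear (k : Type*) {A N : Type*} [CommRing k] [AddCommGroup A] [Module k A]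
    [AddCommGroup N] [Module k N] (F : List A → N) : Prop :=
  ∀ l r : List A, IsLinearMap k fun a => F (l ++ a :: r)

section Multilinear

variable {k A B N M : Type*} [CommRing k] [AddCommGroup A] [Module k A] [AddCommGroup N]
  [Module k N] [AddCommGroup M] [Module k M] {F G : List A → N}

/-- The dependence of a multilinear function on one entry. -/
def Multilinear.hom (hF : Multilinear k F) (l r : List A) : A →ₗ[k] N :=
  (hF l r).mk' _

theorem Multilinear.map_add (hF : Multilinear k F) (l r : List A) (a b : A) :
    F (l ++ (a + b) :: r) = F (l ++ a :: r) + F (l ++ b :: r) :=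
  (hF l r).map_add a b

theorem Multilinear.map_zero (hF : Multilinear k F) (l r : List A) : F (l ++ 0 :: r) = 0 :=
  (hF.hom l r).map_zero

theorem Multilinear.map_zsmul (hF : Multilinear k F) (l r : List A) (n : ℤ) (a : A) :
    F (l ++ (n • a) :: r) = n • F (l ++ a :: r) :=
  _root_.map_zsmul (hF.hom l r) n a

theorem Multilinear.map_splitSum (hF : Multilinear k F) (l r : List A)
    (Φ : List B → List B → A) (w : List B) :
    F (l ++ splitSum Φ w :: r) = splitSum (fun x y => F (l ++ Φ x y :: r)) w :=
  Hoch.map_splitSum (hF.hom l r) Φ w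

theorem Multilinear.append_cons (hF : Multilinear k F) (b : A) (z : List A) :
    Multilinear k fun x => F (x ++ b :: z) := by
  intro l r
  simpa using hF l (r ++ b :: z)

theorem Multilinear.cons_append (hF : Multilinear k F) (x : List A) (b : A) :
    Multilinear k fun z => F (x ++ b :: z) := by
  intro l r
  simpa using hF (x ++ b :: l) r

theorem Multilinear.comp (hF : Multilinear k F) (φ : N →ₗ[k] M) :
    Multilinear k fun l => φ (F l) := fun l r =>
  (φ ∘ₗ hF.hom l r).isLinear

theorem Multilinear.add (hF : Multilinear k F) (hG : Multilinear k G) :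
    Multilinear k (F + G) := fun l r =>
  (hF.hom l r + hG.hom l r).isLinear

theorem Multilinear.zsmul (hF : Multilinear k F) (n : ℤ) : Multilinear k (n • F) := fun l r =>
  (n • hF.hom l r).isLinear

theorem IsLinearMap.splitSum {Φ : A → List B → List B → N} {w : List B}
    (h : ∀ x y, IsLinearMap k fun a => Φ a x y) :
    IsLinearMap k fun a => splitSum (Φ a) w :=
  ⟨fun a b => (splitSum_congr fun x y _ => (h x y).map_add a b).trans (splitSum_add _ _ _),
    fun c a => (splitSum_congr fun x y _ => (h x y).map_smul c a).trans (splitSum_smul _ _ _)⟩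

theorem IsLinearMap.add_apply {f g : A → N} (hf : IsLinearMap k f) (hg : IsLinearMap k g) :
    IsLinearMap k fun a => f a + g a :=
  (hf.mk' _ + hg.mk' _).isLinear

theorem IsLinearMap.zsmul_apply {f : A → N} (hf : IsLinearMap k f) (n : ℤ) :
    IsLinearMap k fun a => n • f a :=
  (n • hf.mk' _).isLinear

theorem Multilinear.splitSum {Ψ : List A → List A → N} (h₁ : ∀ y, Multilinear k fun x => Ψ x y)
    (h₂ : ∀ x, Multilinear k (Ψ x)) : Multilinear k (splitSum Ψ) := by
  intro l r
  simp only [splitSum_append_cons]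
  exact IsLinearMap.add_apply (IsLinearMap.splitSum fun x y => h₂ x y r)
    (IsLinearMap.splitSum fun x y => h₁ y l x)

end Multilinear

/-! ### Insertion of one cochain into another -/

section Insertion

variable {A N M : Type*} [AddCommGroup N] [AddCommGroup M]

/-- The sum of `s ^ |x| F (x, g y, z)` over all decompositions `l = x ++ y ++ z`. With
`s = (-1) ^ (r - 1)`, where `r` is the degree of `g`, this is the brace `F{g}`. -/
def ins (s : ℤ) (g : List A → A) (F : List A → N) (l : List A) : N :=
  splitSum (fun x w => splitSum (fun y z => s ^ x.length • F (x ++ g y :: z)) w) l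

/-- The simultaneous insertion `F{g, h}` of `g` and, further to the right, of `h`. -/
def dins (s t : ℤ) (g h : List A → A) (F : List A → N) (l : List A) : N :=
  splitSum (fun x w => splitSum (fun y z =>
    t ^ x.length • ins s g (fun x' => F (x' ++ h y :: z)) x) w) l

theorem ins_add (s : ℤ) (g : List A → A) (F G : List A → N) :
    ins s g (fun l => F l + G l) = fun l => ins s g F l + ins s g G l := by
  ext l; simp only [ins, smul_add, splitSum_add]

theorem map_ins (φ : N →+ M) (s : ℤ) (g : List A → A) (F : List A → N) (l : List A) :
    φ (ins s g F l) = ins s g (fun l => φ (F l)) l := by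
  simp only [ins, map_splitSum, map_zsmul]

theorem ins_smul (s c : ℤ) (g : List A → A) (F : List A → N) (l : List A) :
    ins s g (fun l => c • F l) l = c • ins s g F l :=
  (map_ins (DistribSMul.toAddMonoidHom N c) s g F l).symm

theorem ins_neg (s : ℤ) (g : List A → A) (F : List A → N) (l : List A) :
    ins s g (fun l => -F l) l = -ins s g F l :=
  (map_ins (negAddMonoidHom : N →+ N) s g F l).symm

theorem ins_splitSum_right {B : Type*} (s : ℤ) (g : List A → A) (Φ : List B → List B → List A → N)
    (w : List B) (l : List A) :
    ins s g (fun l => splitSum (fun y z => Φ y z l) w) l =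
      splitSum (fun y z => ins s g (Φ y z) l) w := by
  simp only [ins, ← splitSum_smul]
  rw [← splitSum_comm]
  exact splitSum_congr fun x y _ => splitSum_comm _ _ _

theorem dins_add (s t : ℤ) (g h : List A → A) (F G : List A → N) :
    dins s t g h (fun l => F l + G l) = fun l => dins s t g h F l + dins s t g h G l := by
  ext l; simp only [dins, ins_add, smul_add, splitSum_add]

theorem map_dins (φ : N →+ M) (s t : ℤ) (g h : List A → A) (F : List A → N) (l : List A) :
    φ (dins s t g h F l) = dins s t g h (fun l => φ (F l)) l := by
  simp only [dins, map_splitSum, map_zsmul, map_ins]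

theorem dins_smul (s t c : ℤ) (g h : List A → A) (F : List A → N) (l : List A) :
    dins s t g h (fun l => c • F l) l = c • dins s t g h F l :=
  (map_dins (DistribSMul.toAddMonoidHom N c) s t g h F l).symm

/-- Insertion is a skew coderivation. -/
theorem ins_splitSum (s : ℤ) (g : List A → A) (Ψ : List A → List A → N) (l : List A) :
    ins s g (splitSum Ψ) l = splitSum (fun x y => ins s g (fun x => Ψ x y) x) l
      + splitSum (fun x y => s ^ x.length • ins s g (Ψ x) y) l := by
  simp only [ins, splitSum_append_cons, smul_add, splitSum_add, ← splitSum_smul, splitSum_assoc]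
  rw [add_comm]
  congr 1
  refine ((splitSum_congr fun x w _ => splitSum_comm _ _ _).trans ((splitSum_congr fun x w _ =>
    splitSum_congr fun u v e => ?_).trans (splitSum_assoc (fun u v w => splitSum (fun y z =>
      s ^ u.length • s ^ v.length • Ψ u (v ++ g y :: z)) w) l)))
  rw [← e]
  simp only [smul_smul, ← pow_add, List.length_append]

/-- The inserted cochain meets the arguments to the left of `b`, an interval that contains `b`, or
the arguments to the right of `b`. -/
theorem ins_append_cons (s : ℤ) (g : List A → A) (F : List A → N) (x : List A) (b : A)
    (z : List A) :
    ins s g F (x ++ b :: z) = ins s g (fun x => F (x ++ b :: z)) x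
      + splitSum (fun u v => splitSum (fun y w =>
          s ^ u.length • F (u ++ g (v ++ b :: y) :: w)) z) x
      + s ^ (x.length + 1) • ins s g (fun z => F (x ++ b :: z)) z := by
  simp only [ins, splitSum_append_cons, splitSum_add, ← splitSum_smul, smul_smul]
  congr 1
  · congr 1
    refine splitSum_congr fun _ _ _ => splitSum_congr fun _ _ _ => ?_
    simp
  · refine splitSum_congr fun _ _ _ => splitSum_congr fun _ _ _ => ?_
    simp [← pow_add, add_comm, add_left_comm]

variable {k : Type*} [CommRing k] [AddCommGroup A] [Module k A] [Module k N]

theorem Multilinear.ins {F : List A → N} (hF : Multilinear k F) {g : List A → A}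
    (hg : Multilinear k g) (s : ℤ) : Multilinear k (ins s g F) := by
  intro l r
  simp only [ins_append_cons]
  refine IsLinearMap.add_apply (IsLinearMap.add_apply ?_ ?_) (IsLinearMap.zsmul_apply ?_ _)
  · refine IsLinearMap.splitSum fun x w => IsLinearMap.splitSum fun y z => ?_
    simpa using IsLinearMap.zsmul_apply (hF (x ++ g y :: z) r) _
  · refine IsLinearMap.splitSum fun x w => IsLinearMap.splitSum fun y z =>
      IsLinearMap.zsmul_apply ?_ _
    exact (hF.hom x z ∘ₗ hg.hom w y).isLinear
  · refine IsLinearMap.splitSum fun x w => IsLinearMap.splitSum fun y z => ?_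
    simpa using IsLinearMap.zsmul_apply (hF l (x ++ g y :: z)) _

end Insertion

/-! ### Supports, signs, and successive insertions -/

section Supported

variable {k A N : Type*} [CommRing k] [AddCommGroup A] [Module k A] [AddCommGroup N] [Module k N]

/-- The function vanishes on all lists whose length is not `r`. -/
def Supported {A N : Type*} [Zero N] (r : ℕ) (g : List A → N) : Prop :=
  ∀ l : List A, l.length ≠ r → g l = 0

/-- The sign twist `l ↦ s ^ |l| f l`. -/
def sgn {A N : Type*} [AddCommGroup N] (s : ℤ) (f : List A → N) (l : List A) : N :=
  s ^ l.length • f l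

theorem Supported.sgn_eq {A : Type*} {r : ℕ} {f : List A → N} (hf : Supported r f) (s : ℤ) :
    sgn s f = s ^ r • f := by
  ext l
  by_cases h : l.length = r
  · simp [sgn, h]
  · simp [sgn, hf l h]

theorem ins_sgn {r : ℕ} {g : List A → A} (hg : Supported r g) {F : List A → N}
    (hF : Multilinear k F) (s : ℤ) {t : ℤ} (ht : t * t = 1) :
    ins s g (sgn t F) = t ^ (r + 1) • sgn t (ins s g F) := by
  ext l
  simp only [ins, sgn, Pi.smul_apply, ← splitSum_smul]
  refine splitSum_congr fun x w e => splitSum_congr fun y z e' => ?_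
  by_cases h : y.length = r
  · simp only [smul_smul]
    congr 1
    rw [← e, ← e']
    simp only [List.length_append, List.length_cons, h, pow_add]
    have h2 : t ^ r * t ^ r = 1 := by rw [← mul_pow, ht, one_pow]
    calc _ = s ^ x.length * (t ^ x.length * (t ^ z.length * t ^ 1)) := by ring
      _ = (t ^ r * t ^ r) * (s ^ x.length * (t ^ x.length * (t ^ z.length * t ^ 1))) := by
        rw [h2, one_mul]
      _ = _ := by ring
  · rw [hg y h, hF.map_zero]
    simp

/-- The decompositions `l = (u ++ v) ++ y ++ z`, listed from left to right. -/
theorem splitSum_rotate {A : Type*} (Ψ : List A → List A → List A → List A → List A → N)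
    (l : List A) :
    splitSum (fun x w => splitSum (fun y z => splitSum (fun u v => Ψ x u v y z) x) w) l =
      splitSum (fun u p => splitSum (fun v w => splitSum (fun y z => Ψ (u ++ v) u v y z) w) p) l :=
  (splitSum_congr fun x _ _ => (splitSum_comm _ _ _).trans (splitSum_congr fun _ _ e => by
    rw [e])).trans (splitSum_assoc (fun u v w => splitSum (fun y z => Ψ (u ++ v) u v y z) w) l)

/-- Two successive insertions: the second one meets the arguments to the left of the first one,
its own arguments, or those to its right. -/
theorem ins_ins {r : ℕ} {s t : ℤ} {g h : List A → A} (hs : s * s = 1) (hh : Supported r h)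
    {F : List A → N} (hF : Multilinear k F) (l : List A) :
    ins t h (ins s g F) l = dins s t g h F l + ins (s * t) (ins t h g) F l
      + s ^ (r + 1) • dins t s h g F l := by
  conv_lhs => rw [ins]
  simp only [ins_append_cons, smul_add, splitSum_add]
  congr 1
  · congr 1
    simp only [ins, hF.map_splitSum, ← splitSum_smul, splitSum_assoc]
    refine (splitSum_rotate _ _).trans ?_
    refine splitSum_congr fun u p _ => splitSum_congr fun v w _ => splitSum_congr fun y z _ =>
      splitSum_congr fun y' z' _ => ?_
    rw [hF.map_zsmul]
    simp only [smul_smul, List.length_append]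
    congr 1
    ring
  · simp only [dins, ins, ← splitSum_smul]
    symm
    refine (splitSum_rotate _ _).trans ?_
    refine splitSum_congr fun x p _ => (splitSum_rotate _ _).trans ?_
    refine splitSum_congr fun y q _ => splitSum_congr fun x' W _ => splitSum_congr fun y' z' _ => ?_
    by_cases hy : y.length = r
    · simp only [smul_smul, List.length_append, List.append_assoc, List.cons_append]
      congr 1
      have h2 : s ^ r * s ^ r = 1 := by rw [← mul_pow, hs, one_pow]
      rw [hy]
      calc _ = (s ^ r * s ^ r) * (s ^ (x.length + 1) * t ^ x.length * s ^ x'.length) := by ring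
        _ = _ := by rw [h2]; ring
    · rw [hh y hy, List.append_assoc, List.cons_append, hF.map_zero]
      simp

end Supported

/-! ### The convolution product and the Hochschild differential -/

/-- The convolution product `(f ⋆ g)(a₁, …, aₚ₊ᵣ) = f(a₁, …, aₚ) g(aₚ₊₁, …, aₚ₊ᵣ)`, which is the
cup product without its sign. -/
def conv {A : Type*} [Ring A] (f g : List A → A) : List A → A := splitSum fun x y => f x * g y

local infixl:70 " ⋆ " => conv

section Conv

variable {A : Type*} [Ring A]

/-- The identity of `A` as a cochain of degree `1`. -/
def idc : List A → A
  | [a] => a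
  | _ => 0

/-- The multiplication of `A` as a cochain of degree `2`. -/
def mulc : List A → A := idc ⋆ idc

/-- The Hochschild differential with the sign convention
`a₀ f(a₁, …, aₚ) - f(a₀ a₁, a₂, …, aₚ) + ⋯ + (-1) ^ (p + 1) f(a₀, …, aₚ₋₁) aₚ`. -/
def dH (f : List A → A) : List A → A :=
  idc ⋆ f - sgn (-1) f ⋆ idc - ins (-1) mulc f

theorem conv_assoc (f g h : List A → A) : f ⋆ g ⋆ h = f ⋆ (g ⋆ h) := by
  ext l
  have h1 : ∀ (w : List A) (a : A), splitSum (fun x y => f x * g y) w * a =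
      splitSum (fun x y => f x * g y * a) w := fun w a =>
    map_splitSum (AddMonoidHom.mulRight a) _ w
  have h2 : ∀ (w : List A) (a : A), a * splitSum (fun x y => g x * h y) w =
      splitSum (fun x y => a * (g x * h y)) w := fun w a =>
    map_splitSum (AddMonoidHom.mulLeft a) _ w
  simp only [conv, h1, h2, splitSum_assoc, mul_assoc]

theorem add_conv (f g h : List A → A) : (f + g) ⋆ h = f ⋆ h + g ⋆ h := by
  ext l; simp [conv, add_mul, splitSum_add]

theorem conv_add (f g h : List A → A) : f ⋆ (g + h) = f ⋆ g + f ⋆ h := by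
  ext l; simp [conv, mul_add, splitSum_add]

theorem zsmul_conv (n : ℤ) (f g : List A → A) : (n • f) ⋆ g = n • (f ⋆ g) := by
  ext l; simp only [conv, Pi.smul_apply, smul_mul_assoc, splitSum_smul]

theorem conv_zsmul (n : ℤ) (f g : List A → A) : f ⋆ (n • g) = n • (f ⋆ g) := by
  ext l; simp only [conv, Pi.smul_apply, mul_smul_comm, splitSum_smul]

theorem neg_conv (f g : List A → A) : (-f) ⋆ g = -(f ⋆ g) := by
  simpa using zsmul_conv (-1) f g

theorem conv_neg (f g : List A → A) : f ⋆ (-g) = -(f ⋆ g) := by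
  simpa using conv_zsmul (-1) f g

theorem sub_conv (f g h : List A → A) : (f - g) ⋆ h = f ⋆ h - g ⋆ h := by
  rw [sub_eq_add_neg, add_conv, neg_conv, ← sub_eq_add_neg]

theorem conv_sub (f g h : List A → A) : f ⋆ (g - h) = f ⋆ g - f ⋆ h := by
  rw [sub_eq_add_neg, conv_add, conv_neg, ← sub_eq_add_neg]

theorem sgn_conv (s : ℤ) (f g : List A → A) : sgn s (f ⋆ g) = sgn s f ⋆ sgn s g := by
  ext l
  simp only [sgn, conv, ← splitSum_smul]
  refine splitSum_congr fun x y e => ?_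
  rw [← e, List.length_append, pow_add, mul_smul, smul_mul_smul_comm, mul_smul]

theorem Supported.conv {p r : ℕ} {f g : List A → A} (hf : Supported p f) (hg : Supported r g) :
    Supported (p + r) (f ⋆ g) := by
  intro l hl
  refine splitSum_eq_zero fun x y e => ?_
  by_cases hx : x.length = p
  · rw [hg y, mul_zero]
    rintro rfl
    exact hl (by rw [← e, List.length_append, hx])
  · rw [hf x hx, zero_mul]

theorem supported_idc : Supported 1 (idc : List A → A)
  | [], _ => rfl
  | [_], h => absurd rfl h
  | _ :: _ :: _, _ => rfl

theorem supported_mulc : Supported 2 (mulc : List A → A) := supported_idc.conv supported_idc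

theorem idc_append_cons (x : List A) (b : A) (z : List A) (h : x ≠ [] ∨ z ≠ []) :
    idc (x ++ b :: z) = 0 := by
  refine supported_idc _ fun hl => ?_
  simp only [List.length_append, List.length_cons] at hl
  rcases h with h | h <;> have := List.length_pos_iff.2 h <;> omega

theorem ins_idc (s : ℤ) (g : List A → A) : ins s g idc = g := by
  ext l
  rw [ins, splitSum_left fun a x y => splitSum_eq_zero fun _ _ _ => by
    rw [idc_append_cons _ _ _ (Or.inl (by simp)), smul_zero],
    splitSum_right fun x a y => by rw [idc_append_cons _ _ _ (Or.inr (by simp)), smul_zero]]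
  simp [idc]

theorem dins_idc (s t : ℤ) (g h : List A → A) : dins s t g h idc = 0 := by
  ext l
  refine splitSum_eq_zero fun x w _ => splitSum_eq_zero fun y z _ => ?_
  rw [ins, splitSum_eq_zero, smul_zero]
  · intro x w _
    refine splitSum_eq_zero fun u v _ => ?_
    rw [List.append_assoc, List.cons_append, idc_append_cons _ _ _ (Or.inr (by simp)), smul_zero]

/-- Insertion is a skew derivation of the convolution product. -/
theorem ins_conv (s : ℤ) (g f h : List A → A) :
    ins s g (f ⋆ h) = ins s g f ⋆ h + sgn s f ⋆ ins s g h := by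
  ext l
  rw [conv, ins_splitSum]
  refine congrArg₂ _ (splitSum_congr fun x y _ => ?_) (splitSum_congr fun x y _ => ?_)
  · exact (map_ins (AddMonoidHom.mulRight (h y)) s g f x).symm
  · rw [sgn, smul_mul_assoc]
    exact congrArg _ (map_ins (AddMonoidHom.mulLeft (f x)) s g h y).symm

/-- A simultaneous insertion of `g` and `h` into a convolution product puts both into the left
factor, `g` into the left and `h` into the right factor, or both into the right factor. -/
theorem dins_conv (s t : ℤ) (g h f e : List A → A) :
    dins s t g h (f ⋆ e) = dins s t g h f ⋆ e + sgn t (ins s g f) ⋆ ins t h e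
      + sgn (s * t) f ⋆ dins s t g h e := by
  ext l
  have h1 : ∀ x b z, (f ⋆ e) (x ++ b :: z) = (f ⋆ fun v => e (v ++ b :: z)) x
      + splitSum (fun u v => f (x ++ b :: u) * e v) z := fun x b z => splitSum_append_cons _ _ _ _
  have h2 : ∀ (w : List A) (a : A) (Φ : List A → List A → A), splitSum Φ w * a =
      splitSum (fun x y => Φ x y * a) w := fun w a Φ => map_splitSum (AddMonoidHom.mulRight a) _ w
  have h3 : ∀ (w : List A) (a : A) (Φ : List A → List A → A), a * splitSum Φ w =
      splitSum (fun x y => a * Φ x y) w := fun w a Φ => map_splitSum (AddMonoidHom.mulLeft a) _ w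
  have h4 : ∀ (x : List A) (b a : A) (z : List A), ins s g (fun x => f (x ++ b :: z) * a) x =
      ins s g (fun x => f (x ++ b :: z)) x * a := fun x b a z =>
    (map_ins (AddMonoidHom.mulRight a) s g _ x).symm
  simp only [dins, h1, ins_add, ins_splitSum_right, ins_conv, smul_add, splitSum_add, h4,
    Pi.add_apply]
  have h5 : ∀ (F : List A → A) l, ins t h F l = splitSum (fun x w => splitSum (fun y z =>
      t ^ x.length • F (x ++ h y :: z)) w) l := fun _ _ => rfl
  simp only [conv, dins, h5, sgn, h2, h3, ← splitSum_smul, splitSum_assoc]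
  rw [splitSum_rotate, splitSum_rotate]
  rw [add_comm, ← add_assoc]
  congr 1
  · congr 1
    · simp only [smul_mul_assoc]
    · refine splitSum_congr fun u p _ => splitSum_congr fun v w _ => splitSum_congr fun y z _ => ?_
      simp only [List.length_append, pow_add, mul_smul, smul_mul_assoc, mul_smul_comm]
      rw [smul_comm]
  · refine splitSum_congr fun u p _ => splitSum_congr fun v w _ => splitSum_congr fun y z _ => ?_
    simp only [List.length_append, pow_add, mul_pow, smul_smul, smul_mul_assoc, mul_smul_comm]
    congr 1
    ring

end Conv

/-! ### Homotopies for the Hochschild differential -/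

section Commutators

/-- The decompositions `l = u ++ (v ++ y ++ y') ++ w'`, listed from left to right. -/
theorem splitSum_rotate' {A N : Type*} [AddCommGroup N]
    (Ψ : List A → List A → List A → List A → List A → List A → N) (l : List A) :
    splitSum (fun x w => splitSum (fun y z => splitSum (fun u v => splitSum (fun y' w' =>
      Ψ x u v y y' w') z) x) w) l =
    splitSum (fun u p => splitSum (fun Y w' => splitSum (fun v Q => splitSum (fun y y' =>
      Ψ (u ++ v) u v y y' w') Q) Y) p) l := by
  rw [splitSum_rotate]
  simp only [splitSum_assoc]

section
variable {k A N : Type*} [CommRing k] [AddCommGroup A] [Module k A] [AddCommGroup N] [Module k N]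

theorem ins_zero {F : List A → N} (hF : Multilinear k F) (s : ℤ) : ins s 0 F = 0 := by
  ext l
  exact splitSum_eq_zero fun x w _ => splitSum_eq_zero fun y z _ => by
    rw [Pi.zero_apply, hF.map_zero, smul_zero]

theorem ins_add_left {F : List A → N} (hF : Multilinear k F) (s : ℤ) (g h : List A → A) :
    ins s (g + h) F = ins s g F + ins s h F := by
  ext l
  simp only [ins, Pi.add_apply, hF.map_add, smul_add, splitSum_add]

theorem ins_zsmul_left {F : List A → N} (hF : Multilinear k F) (s n : ℤ) (g : List A → A) :
    ins s (n • g) F = n • ins s g F := by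
  ext l
  simp only [ins, Pi.smul_apply, hF.map_zsmul, ← splitSum_smul]
  simp only [smul_comm n]

theorem ins_zsmul_right {A : Type*} (s n : ℤ) (g : List A → A) (F : List A → N) :
    ins s g (n • F) = n • ins s g F := funext fun l => ins_smul s n g F l

theorem dins_zsmul_right {F : List A → N} (hF : Multilinear k F) (s t n : ℤ) (g h : List A → A) :
    dins s t g (n • h) F = n • dins s t g h F := by
  ext l
  simp only [dins, Pi.smul_apply, hF.map_zsmul, ins_smul, ← splitSum_smul]
  simp only [smul_comm n]

theorem neg_one_pow_mul_self (n : ℕ) : ((-1 : ℤ) ^ n) * (-1) ^ n = 1 := by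
  rw [← mul_pow]; simp

theorem ins_ins_comm {A : Type*} (s t : ℤ) (g h : List A → A)
    (F : List A → List A → N) (x z : List A) :
    ins s g (fun x' => ins t h (F x') z) x =
      ins t h (fun z' => ins s g (fun x' => F x' z') x) z := by
  simp only [ins, ← splitSum_smul]
  refine (splitSum_congr fun x w _ => splitSum_comm _ _ _).trans ?_
  rw [splitSum_comm]
  refine splitSum_congr fun u v _ => ?_
  refine ((splitSum_congr fun x w _ => splitSum_comm _ _ _).trans (splitSum_comm _ _ _)).trans ?_
  exact splitSum_congr fun _ _ _ => splitSum_congr fun _ _ _ => splitSum_congr fun _ _ _ =>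
    smul_comm _ _ _

theorem ins_hom_linear {F : List A → N} (hF : Multilinear k F) (s : ℤ) (g : List A → A)
    (x z : List A) : IsLinearMap k fun b => ins s g (fun x' => F (x' ++ b :: z)) x :=
  IsLinearMap.splitSum fun u v => IsLinearMap.splitSum fun y w => by
    simpa using IsLinearMap.zsmul_apply (hF (u ++ g y :: w) z) _

theorem multilinear_ins_cons {F : List A → N} (hF : Multilinear k F) (s : ℤ) (g : List A → A)
    (b : A) (z : List A) :
    Multilinear k fun x => ins s g (fun z' => F (x ++ b :: z')) z := fun l r =>
  IsLinearMap.splitSum fun u v => IsLinearMap.splitSum fun y w => by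
    simpa using IsLinearMap.zsmul_apply (hF l (r ++ b :: (u ++ g y :: w))) _
end

variable {k A N : Type*} [CommRing k] [Ring A] [Module k A] [AddCommGroup N] [Module k N]

theorem ins_mulc (s : ℤ) (g : List A → A) : ins s g mulc = g ⋆ idc + s • (idc ⋆ g) := by
  rw [mulc, ins_conv, ins_idc, supported_idc.sgn_eq, pow_one, zsmul_conv]

theorem dins_mulc (s t : ℤ) (g h : List A → A) : dins s t g h mulc = sgn t g ⋆ h := by
  rw [mulc, dins_conv, dins_idc, ins_idc, ins_idc, show (0 : List A → A) = (0 : ℤ) • 0 by simp,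
    zsmul_conv, conv_zsmul, zero_smul, zero_smul, zero_add, add_zero]

/-- The bar differential commutes with the insertion of `g` up to the insertion of the Hochschild
differential of `g`. -/
theorem ins_mulc_ins {r : ℕ} {g : List A → A} (hg : Supported r g) {s : ℤ}
    (hs : s = (-1) ^ (r + 1)) {F : List A → N} (hF : Multilinear k F) :
    ins (-1) mulc (ins s g F) = s • ins s g (ins (-1) mulc F) - ins (-s) (dH g) F := by
  have hss : s * s = 1 := by rw [hs, neg_one_pow_mul_self]
  have hs' : (-1 : ℤ) ^ r = -s := by rw [hs, pow_succ]; simp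
  ext l
  have h1 := ins_ins (t := -1) hss (g := g) supported_mulc hF l
  have h2 := ins_ins (s := -1) (t := s) (g := mulc) (by norm_num) hg hF l
  rw [Pi.sub_apply, Pi.smul_apply, h1, h2, ins_mulc, dH, hg.sgn_eq, hs', ← hs,
    show idc ⋆ g - (-s • g) ⋆ idc - ins (-1) mulc g
      = s • (g ⋆ idc + s • (idc ⋆ g)) + (-1 : ℤ) • ins (-1) mulc g by
        simp only [zsmul_conv, smul_add, smul_smul, hss]; module,
    pow_succ, pow_succ, pow_one, hss]
  simp only [ins_add_left hF, ins_zsmul_left hF, Pi.add_apply, Pi.smul_apply, smul_add, smul_smul,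
    hss, one_mul, mul_neg, mul_one, neg_mul]
  module

/-- The bar differential of the simultaneous insertion of two cocycles `g` and `h`: the terms that
do not come from the bar differential of `F` are those in which a multiplication joins the values of
`g` and `h` in adjacent positions. -/
theorem ins_mulc_dins {r q : ℕ} {g h : List A → A} (hg : Supported r g) (hh : Supported q h)
    {s t : ℤ} (hs : s = (-1) ^ (r + 1)) (ht : t = (-1) ^ (q + 1)) (hg' : dH g = 0) (hh' : dH h = 0)
    {F : List A → N} (hF : Multilinear k F) (hg'' : Multilinear k g) :
    ins (-1) mulc (dins s t g h F) = (s * t) • dins s t g h (ins (-1) mulc F)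
      - (s * t) • ins (-(s * t)) (sgn t g ⋆ h) F := by
  have hss : s * s = 1 := by rw [hs, neg_one_pow_mul_self]
  have htt : t * t = 1 := by rw [ht, neg_one_pow_mul_self]
  have ht' : (-1 : ℤ) ^ q = -t := by rw [ht, pow_succ]; simp
  have hbh : ins t h mulc = t • ins (-1) mulc h := by
    have : ins (-1) mulc h = idc ⋆ h - sgn (-1) h ⋆ idc := by
      rw [dH, sub_eq_zero] at hh'; exact hh'.symm
    rw [ins_mulc, this, hh.sgn_eq, ht', zsmul_conv, smul_sub, smul_smul, mul_neg, htt]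
    module
  -- `P` collects the terms in which the multiplication acts to the left of `h`, and `E` those in
  -- which it acts to the right of `h`.
  obtain ⟨P, hP⟩ : ∃ P : List A → N, P = fun l => splitSum (fun x w => splitSum (fun y z =>
    t ^ x.length • ins s g (ins (-1) mulc fun x' => F (x' ++ h y :: z)) x) w) l := ⟨_, rfl⟩
  obtain ⟨E, hE⟩ : ∃ E : List A → N, E = fun l => splitSum (fun x w => splitSum (fun y z =>
    (-t) ^ x.length • ins (-1) mulc (fun z' => ins s g (fun x' => F (x' ++ h y :: z')) x) z) w) l :=
    ⟨_, rfl⟩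
  -- The multiplication is applied after `g` and `h`.
  have hL : ∀ l, ins (-1) mulc (dins s t g h F) l =
      (s * t) • P l + dins s (-t) g (ins (-1) mulc h) F l - t • E l := by
    intro l
    change ins (-1) mulc (splitSum fun x w => splitSum (fun y z =>
      (t ^ x.length • ins s g (fun x' => F (x' ++ h y :: z)) x : N)) w) l = _
    rw [ins_splitSum]
    simp only [ins_splitSum_right, ins_splitSum, dins, hP, hE]
    simp only [← splitSum_smul, ← splitSum_add, smul_add, sub_eq_add_neg, ← splitSum_neg]
    refine splitSum_congr fun x w _ => splitSum_congr fun y z _ => ?_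
    have e1 : ins (-1) mulc (fun x => t ^ x.length • ins s g (fun x' => F (x' ++ h y :: z)) x) x
        = (s * t) • t ^ x.length • ins s g (ins (-1) mulc fun x' => F (x' ++ h y :: z)) x := by
      refine (congrFun
        (ins_sgn supported_mulc ((hF.append_cons _ _).ins hg'' s) (-1) htt) x).trans ?_
      rw [ins_mulc_ins hg hs (hF.append_cons _ _), hg', ins_zero (hF.append_cons _ _)]
      simp only [sgn, Pi.smul_apply, sub_zero, smul_smul]
      congr 1
      linear_combination (t ^ x.length * t * s) * htt
    have e2 : ins (-1) mulc (fun y => t ^ x.length • ins s g (fun x' => F (x' ++ h y :: z)) x) y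
        = t ^ x.length • ins s g (fun x' => F (x' ++ ins (-1) mulc h y :: z)) x := by
      rw [ins_smul]
      exact congrArg _
        (map_ins ((ins_hom_linear hF s g x z).mk' _).toAddMonoidHom (-1) mulc h y).symm
    rw [e1, e2, ins_smul, add_assoc]
    congr 1
    rw [smul_smul, ← mul_pow, neg_one_mul, smul_smul, smul_smul, smul_smul]
    congr 1
    by_cases hy : y.length = q
    · rw [hy, ht', ← neg_smul]
      congr 1
      rw [neg_pow t]
      ring
    · have : ins (-1) mulc (fun z' => ins s g (fun x' => F (x' ++ h y :: z')) x) z = 0 := by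
        have h0 : ∀ z, ins s g (fun x' => F (x' ++ h y :: z)) x = 0 := fun z => by
          rw [hh y hy]; exact (ins_hom_linear hF s g x z).map_zero
        simp only [h0]
        simp [ins, splitSum_zero]
      rw [this, smul_zero, smul_zero, neg_zero]
  -- The multiplication is applied before `g` and `h`; its arguments may be values of `g` and `h`.
  have hR : ∀ l, dins s t g h (ins (-1) mulc F) l =
      P l + s • dins s (-t) g (ins t h mulc) F l + ins (-(s * t)) (dins s t g h mulc) F l
      - s • E l := by
    intro l
    have e1 : ∀ x b z, ins s g (fun x' => (-1) ^ (x'.length + 1) •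
        ins (-1) mulc (fun z' => F (x' ++ b :: z')) z) x = -(s • (-1) ^ x.length •
          ins (-1) mulc (fun z' => ins s g (fun x' => F (x' ++ b :: z')) x) z) := by
      intro x b z
      have := congrFun (ins_sgn hg (multilinear_ins_cons hF (-1) mulc b z) s (t := -1)
        (by norm_num)) x
      rw [← hs] at this
      simp only [sgn, Pi.smul_apply] at this
      simp only [pow_succ, mul_neg_one, neg_smul, ins_neg]
      rw [← ins_ins_comm]
      exact congrArg Neg.neg this
    have e2 : ∀ x b z, ins s g (fun x' => splitSum (fun u v => splitSum (fun y w =>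
        (-1) ^ u.length • F (u ++ mulc (v ++ b :: y) :: w)) z) x') x =
        splitSum (fun u v => splitSum (fun y w => s • (-1) ^ u.length •
          ins s g (fun u' => F (u' ++ mulc (v ++ b :: y) :: w)) u) z) x
        + splitSum (fun u v => splitSum (fun y w => (-s) ^ u.length •
          F (u ++ ins s g (fun v' => mulc (v' ++ b :: y)) v :: w)) z) x := by
      intro x b z
      refine (ins_splitSum _ _ _ _).trans (congrArg₂ _ ?_ ?_)
      · refine splitSum_congr fun u v _ => (ins_splitSum_right _ _ _ _ _).trans ?_
        refine splitSum_congr fun y w _ => ?_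
        have := congrFun (ins_sgn hg (hF.append_cons (mulc (v ++ b :: y)) w) s (t := -1)
          (by norm_num)) u
        rwa [← hs] at this
      · refine splitSum_congr fun u v _ => ?_
        rw [ins_splitSum_right, ← splitSum_smul]
        refine splitSum_congr fun y w _ => ?_
        rw [ins_smul, smul_smul, ← mul_pow, mul_neg_one]
        exact congrArg _ (map_ins (hF.hom u w).toAddMonoidHom s g _ v).symm
    simp only [dins, ins_append_cons, ins_add, e1, e2, hP, hE, smul_add, splitSum_add]
    rw [sub_eq_add_neg]
    congr 1
    · rw [add_assoc]
      congr 1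
      congr 1
      · have e3 : ∀ u Y w, ins s g (fun x' => F (x' ++ ins t h mulc Y :: w)) u =
            splitSum (fun v Q => splitSum (fun y y' => t ^ v.length •
              ins s g (fun x' => F (x' ++ mulc (v ++ h y :: y') :: w)) u) Q) Y := by
          intro u Y w
          refine (map_splitSum ((ins_hom_linear hF s g u w).mk' _) _ _).trans ?_
          refine splitSum_congr fun v Q _ => (map_splitSum _ _ _).trans ?_
          exact splitSum_congr fun y y' _ => map_zsmul ((ins_hom_linear hF s g u w).mk' _) _ _
        simp only [e3, ← splitSum_smul]
        refine (splitSum_rotate' _ _).trans ?_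
        refine splitSum_congr fun u p _ => splitSum_congr fun Y w _ => splitSum_congr fun v Q _ =>
          splitSum_congr fun y y' _ => ?_
        simp only [smul_smul, List.length_append]
        congr 1
        rw [neg_pow t]
        ring
      · have e4 : ∀ u Y w, F (u ++ dins s t g h mulc Y :: w) =
            splitSum (fun v Q => splitSum (fun y y' => t ^ v.length •
              F (u ++ ins s g (fun v' => mulc (v' ++ h y :: y')) v :: w)) Q) Y := by
          intro u Y w
          refine (map_splitSum (hF.hom u w) _ _).trans ?_
          refine splitSum_congr fun v Q _ => (map_splitSum _ _ _).trans ?_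
          exact splitSum_congr fun y y' _ => map_zsmul (hF.hom u w) _ _
        have e5 : ins (-(s * t)) (dins s t g h mulc) F l = splitSum (fun u p => splitSum
            (fun Y w => (-(s * t)) ^ u.length • F (u ++ dins s t g h mulc Y :: w)) p) l := rfl
        simp only [e5, e4, ← splitSum_smul]
        refine (splitSum_rotate' _ _).trans ?_
        refine splitSum_congr fun u p _ => splitSum_congr fun Y w _ => splitSum_congr fun v Q _ =>
          splitSum_congr fun y y' _ => ?_
        simp only [smul_smul, List.length_append]
        congr 1
        rw [neg_pow s, neg_pow (s * t), mul_pow]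
        ring
    · simp only [← splitSum_smul, ← splitSum_neg]
      refine splitSum_congr fun x w _ => splitSum_congr fun y z _ => ?_
      rw [smul_neg, smul_smul, smul_smul, smul_smul, neg_pow t]
      congr 2
      ring
  ext l
  simp only [Pi.sub_apply, Pi.smul_apply]
  rw [hL, hR, hbh, dins_mulc, dins_zsmul_right hF]
  simp only [smul_add, smul_sub, smul_smul, Pi.smul_apply]
  rw [show s * t * (s * t) = 1 by linear_combination t * t * hss + htt,
    show s * t * s = t by linear_combination t * hss]
  module

theorem Supported.ins {A N : Type*} [AddCommGroup A] [Module k A] [AddCommGroup N] [Module k N]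
    {r p : ℕ} {g : List A → A} (hg : Supported r g) {F : List A → N} (hF : Multilinear k F)
    (hF' : Supported (p + 1) F) (s : ℤ) : Supported (p + r) (ins s g F) := by
  intro l hl
  refine splitSum_eq_zero fun x w e => splitSum_eq_zero fun y z e' => ?_
  by_cases hy : y.length = r
  · rw [hF', smul_zero]
    rintro h
    apply hl
    rw [← e, ← e']
    simp only [List.length_append, List.length_cons] at h ⊢
    omega
  · rw [hg y hy, hF.map_zero, smul_zero]

theorem Supported.zsmul {A N : Type*} [AddCommGroup N] {p : ℕ} {f : List A → N}
    (hf : Supported p f) (n : ℤ) : Supported p (n • f) := fun l hl => by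
  rw [Pi.smul_apply, hf l hl, smul_zero]

theorem dins_sgn {A N : Type*} [AddCommGroup A] [Module k A] [AddCommGroup N] [Module k N]
    {r q : ℕ} {g h : List A → A} (hg : Supported r g) (hh : Supported q h) {F : List A → N}
    (hF : Multilinear k F) (s t : ℤ) {v : ℤ} (hv : v * v = 1) :
    dins s t g h (sgn v F) = v ^ (r + q) • sgn v (dins s t g h F) := by
  ext l
  have h1 : ∀ x b z, ins s g (fun x' => v ^ (x' ++ b :: z).length • F (x' ++ b :: z)) x =
      (v ^ (z.length + 1) * v ^ (r + 1) * v ^ x.length) •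
        ins s g (fun x' => F (x' ++ b :: z)) x := by
    intro x b z
    have := congrFun (ins_sgn hg (hF.append_cons b z) s hv) x
    simp only [List.length_append, List.length_cons, pow_add v _ (z.length + 1),
      mul_comm _ (v ^ (z.length + 1)), mul_smul, ins_smul]
    exact congrArg _ this
  simp only [dins, sgn, Pi.smul_apply, ← splitSum_smul, h1]
  refine splitSum_congr fun x w e => splitSum_congr fun y z e' => ?_
  by_cases hy : y.length = q
  · simp only [smul_smul]
    congr 1
    rw [← e, ← e']
    simp only [List.length_append, hy, pow_add]
    have h2 : v ^ q * v ^ q = 1 := by rw [← mul_pow, hv, one_pow]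
    linear_combination (t ^ x.length * v ^ z.length * v ^ r * v ^ x.length) * hv
      - (t ^ x.length * v ^ z.length * v ^ r * v ^ x.length) * h2
  · have : ins s g (fun x' => F (x' ++ h y :: z)) x = 0 := by
      rw [hh y hy]; exact (ins_hom_linear hF s g x z).map_zero
    rw [this]
    simp

/-- The homotopy for the graded commutativity of the cup product. -/
theorem dH_ins {r p : ℕ} {f g : List A → A} (hg : Supported r g) (hf : Supported p f)
    {s : ℤ} (hs : s = (-1) ^ (r + 1)) (hF : Multilinear k f) :
    dH (ins s g f) = s • ins s g (dH f) + ins (-s) (dH g) f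
      - s • (g ⋆ f - ((-1) ^ (p * r) : ℤ) • (f ⋆ g)) := by
  have hss : s * s = 1 := by rw [hs, neg_one_pow_mul_self]
  have h1 : ins s g (sgn (-1) f) = s • sgn (-1) (ins s g f) := by
    rw [ins_sgn hg hF s (by norm_num), ← hs]
  have h2 : sgn s (sgn (-1) f) = ((-1) ^ (p * r) : ℤ) • f := by
    rw [hf.sgn_eq, (hf.zsmul _).sgn_eq, smul_smul, ← mul_pow, hs, pow_succ, mul_neg_one,
      mul_neg_one,
      neg_neg, ← pow_mul, mul_comm r]
  have h3 : ins s g (dH f) = g ⋆ f + s • (idc ⋆ ins s g f) - (s • (sgn (-1) (ins s g f) ⋆ idc)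
      + ((-1) ^ (p * r) : ℤ) • (f ⋆ g)) - ins s g (ins (-1) mulc f) := by
    have : dH f = idc ⋆ f + (-1 : ℤ) • (sgn (-1) f ⋆ idc) + (-1 : ℤ) • ins (-1) mulc f := by
      rw [dH]; module
    rw [this]
    have ha : ∀ a b : List A → A, ins s g (a + b) = ins s g a + ins s g b := ins_add s g
    rw [ha, ha, ins_zsmul_right, ins_zsmul_right, ins_conv, ins_conv, ins_idc, h1, h2,
      supported_idc.sgn_eq, pow_one, zsmul_conv, zsmul_conv, zsmul_conv]
    module
  rw [dH, ins_mulc_ins hg hs hF, h3]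
  simp only [smul_add, smul_sub, smul_smul, hss]
  module

/-- The homotopy for the compatibility of the bracket with the cup product. -/
theorem dH_dins {r q p : ℕ} {f g h : List A → A} (hg : Supported r g) (hh : Supported q h)
    (hf : Supported p f) (hp : Even p)
    {s t : ℤ} (hs : s = (-1) ^ (r + 1)) (ht : t = (-1) ^ (q + 1)) (hg' : dH g = 0) (hh' : dH h = 0)
    (hf' : dH f = 0) (hF : Multilinear k f) (hG : Multilinear k g) :
    dH (dins s t g h f) = (s * t ^ (r + 1)) • (ins (-(s * t)) (g ⋆ h) f - g ⋆ ins t h f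
      + t • (ins s g f ⋆ h)) := by
  have hss : s * s = 1 := by rw [hs, neg_one_pow_mul_self]
  have htt : t * t = 1 := by rw [ht, neg_one_pow_mul_self]
  have hb : ins (-1) mulc f = idc ⋆ f + (-1 : ℤ) • (sgn (-1) f ⋆ idc) := by
    rw [dH, sub_eq_zero] at hf'; rw [← hf']; module
  have ha : ∀ a b : List A → A, dins s t g h (a + b) = dins s t g h a + dins s t g h b :=
    dins_add s t g h
  have hsf : sgn (-1) f = f := by
    rw [hf.sgn_eq, hp.neg_one_pow, one_smul]
  rw [dH, ins_mulc_dins hg hh hs ht hg' hh' hF hG, hb, hsf, ha,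
    show ((-1 : ℤ) • (f ⋆ idc)) = ((-1 : ℤ) • f) ⋆ idc by rw [zsmul_conv],
    dins_conv, dins_conv, dins_idc, ins_idc, ins_idc]
  have h1 : sgn (-1) (dins s t g h f) = (s * t) • dins s t g h f := by
    have := dins_sgn hg hh hF s t (v := -1) (by norm_num)
    rw [hsf] at this
    have he : s * t = (-1) ^ (r + q) := by
      rw [hs, ht, pow_succ, pow_succ, pow_add]; ring
    rw [he]
    nth_rewrite 2 [this]
    rw [smul_smul, neg_one_pow_mul_self, one_smul]
  have h2 : sgn t (ins s g f) = t ^ (r + 1) • ins s g f := by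
    have htp : sgn t f = f := by
      obtain ⟨m, hm⟩ := hp
      rw [hf.sgn_eq, hm, pow_add, ← mul_pow, htt, one_pow, one_smul]
    have := ins_sgn hg hF s htt
    rw [htp] at this
    conv_rhs => rw [this]
    rw [smul_smul, ← mul_pow, htt, one_pow, one_smul]
  have h0 : ∀ a : List A → A, (0 : List A → A) ⋆ a = 0 := fun a => by
    simpa using zsmul_conv 0 0 a
  have h0' : ∀ a : List A → A, a ⋆ (0 : List A → A) = 0 := fun a => by
    simpa using conv_zsmul 0 a 0
  have h3 : dins s t g h ((-1 : ℤ) • f) = (-1 : ℤ) • dins s t g h f :=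
    funext fun l => dins_smul s t (-1) g h f l
  have h4 : sgn t ((-1 : ℤ) • ins s g f) = (-1 : ℤ) • sgn t (ins s g f) :=
    funext fun l => by simp only [sgn, Pi.smul_apply]; exact smul_comm _ _ _
  rw [h1, h0, h0', ins_zsmul_right, h3, h4, h2, hg.sgn_eq, supported_idc.sgn_eq, pow_one]
  simp only [zsmul_conv, ins_zsmul_left hF, smul_add, smul_sub, smul_smul, add_zero, zero_add]
  have e1 : s * t * (s * t) = 1 := by linear_combination t * t * hss + htt
  have e2 : s * t * t ^ r = s * t ^ (r + 1) := by ring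
  have e3 : s * t * (-1 * t ^ (r + 1)) = -(s * t ^ (r + 1) * t) := by ring
  rw [e1, e2, e3]
  module

end Commutators

/-! ### Spaces of cochains -/

section Cochains

variable {k A : Type*} [CommRing k] [Ring A] [Algebra k A]

/-- Homogeneity of degree `b`. -/
def Homogeneous (𝒜 : ℤ → Submodule k A) (b : ℤ) (f : List A → A) : Prop :=
  ∀ (l : List A) (ds : List ℤ), List.Forall₂ (fun a d => a ∈ 𝒜 d) l ds → f l ∈ 𝒜 (ds.sum + b)

variable {𝒜 : ℤ → Submodule k A}

theorem homogeneous_splitSum {Φ : List A → List A → A} {b : ℤ}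
    (h : ∀ x dx y dy, List.Forall₂ (fun a d => a ∈ 𝒜 d) x dx →
      List.Forall₂ (fun a d => a ∈ 𝒜 d) y dy → Φ x y ∈ 𝒜 (dx.sum + dy.sum + b)) :
    Homogeneous 𝒜 b (splitSum Φ) := by
  intro l ds hl
  induction hl generalizing Φ b with
  | nil => simpa [splitSum_nil] using h [] [] [] [] .nil .nil
  | @cons a d l ds ha hl ih =>
    refine Submodule.add_mem _ ?_ ?_
    · simpa using h [] [] _ _ .nil (.cons ha hl)
    · have := @ih (fun x y => Φ (a :: x) y) (d + b) fun x dx y dy hx hy => by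
        have := h (a :: x) (d :: dx) y dy (.cons ha hx) hy
        rwa [List.sum_cons,
          show d + dx.sum + dy.sum + b = dx.sum + dy.sum + (d + b) by ring] at this
      rwa [List.sum_cons, show d + ds.sum + b = ds.sum + (d + b) by ring]

theorem Homogeneous.append_cons {f : List A → A} {b : ℤ} (hf : Homogeneous 𝒜 b f)
    {a : A} {d : ℤ} (ha : a ∈ 𝒜 d) {z : List A} {dz : List ℤ}
    (hz : List.Forall₂ (fun a d => a ∈ 𝒜 d) z dz) :
    Homogeneous 𝒜 (d + dz.sum + b) fun x => f (x ++ a :: z) := by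
  intro l ds hl
  have := hf (l ++ a :: z) (ds ++ d :: dz) (List.rel_append hl (.cons ha hz))
  rwa [List.sum_append, List.sum_cons, add_assoc] at this

theorem Homogeneous.ins {f g : List A → A} {b c : ℤ} (hf : Homogeneous 𝒜 b f)
    (hg : Homogeneous 𝒜 c g) (s : ℤ) : Homogeneous 𝒜 (b + c) (ins s g f) := by
  refine homogeneous_splitSum fun x dx w dw hx hw => ?_
  rw [show dx.sum + dw.sum + (b + c) = dw.sum + (dx.sum + b + c) by ring]
  refine homogeneous_splitSum (fun y dy z dz hy hz => ?_) w dw hw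
  refine zsmul_mem ?_ _
  have := hf.append_cons (hg y dy hy) hz x dx hx
  rwa [show dx.sum + (dy.sum + c + dz.sum + b) = dy.sum + dz.sum + (dx.sum + b + c) by ring] at this

theorem HC.ins {p r : ℕ} {b c : ℤ} {f g : List A → A} (hf : f ∈ HC k 𝒜 (p + 1) b)
    (hg : g ∈ HC k 𝒜 r c) (s : ℤ) : ins s g f ∈ HC k 𝒜 (p + r) (b + c) :=
  ⟨Multilinear.ins hf.1 hg.1 s, Supported.ins hg.2.1 hf.1 hf.2.1 s, Homogeneous.ins hf.2.2 hg.2.2 s⟩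

theorem HC.dins {p r q : ℕ} {b c d : ℤ} {f g h : List A → A} (hf : f ∈ HC k 𝒜 (p + 2) b)
    (hg : g ∈ HC k 𝒜 r c) (hh : h ∈ HC k 𝒜 q d) (s t : ℤ) :
    dins s t g h f ∈ HC k 𝒜 (p + r + q) (b + c + d) := by
  have hF : Multilinear k f := hf.1
  refine ⟨?_, ?_, ?_⟩
  · refine Multilinear.splitSum (fun w l r => ?_) fun x => Multilinear.splitSum ?_ ?_
    · refine IsLinearMap.splitSum fun y z => ?_
      have := (Multilinear.ins (hF.append_cons (h y) z) hg.1 s) l r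
      simp only [List.length_append, List.length_cons]
      exact IsLinearMap.zsmul_apply this _
    · intro z l r
      refine IsLinearMap.zsmul_apply ?_ _
      exact ((ins_hom_linear hF s g x z).mk' _ ∘ₗ Multilinear.hom hh.1 l r).isLinear
    · intro y l r
      refine IsLinearMap.zsmul_apply ?_ _
      refine IsLinearMap.splitSum fun u v => IsLinearMap.splitSum fun y' w => ?_
      have := hF (u ++ g y' :: w ++ h y :: l) r
      simp only [List.append_assoc, List.cons_append] at this ⊢
      exact IsLinearMap.zsmul_apply this _
  · intro l hl
    refine splitSum_eq_zero fun x w e => splitSum_eq_zero fun y z e' => ?_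
    by_cases hy : y.length = q
    · rw [show Hoch.ins s g (fun x' => f (x' ++ h y :: z)) x = 0 from
        splitSum_eq_zero fun u v e₁ => splitSum_eq_zero fun y' w e₂ => ?_, smul_zero]
      by_cases hy' : y'.length = r
      · change s ^ u.length • f ((u ++ g y' :: w) ++ h y :: z) = 0
        rw [hf.2.1, smul_zero]
        intro hc
        apply hl
        rw [← e, ← e', ← e₁, ← e₂]
        simp only [List.length_append, List.length_cons] at hc ⊢
        omega
      · change s ^ u.length • (fun x' => f (x' ++ h y :: z)) (u ++ g y' :: w) = 0
        rw [hg.2.1 y' hy']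
        exact (congrArg _ ((hF.append_cons (h y) z).map_zero u w)).trans (smul_zero _)
    · rw [hh.2.1 y hy, (ins_hom_linear hF s g x z).map_zero, smul_zero]
  · refine homogeneous_splitSum fun x dx w dw hx hw => ?_
    rw [show dx.sum + dw.sum + (b + c + d) = dw.sum + (dx.sum + b + c + d) by ring]
    refine homogeneous_splitSum (fun y dy z dz hy hz => ?_) w dw hw
    refine zsmul_mem ?_ _
    have := Homogeneous.ins (Homogeneous.append_cons hf.2.2 (hh.2.2 y dy hy) hz) hg.2.2 s x dx hx
    rwa [show dx.sum + (dy.sum + d + dz.sum + b + c) = dy.sum + dz.sum + (dx.sum + b + c + d) by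
      ring] at this

theorem HC.add {p : ℕ} {b : ℤ} {f g : List A → A} (hf : f ∈ HC k 𝒜 p b) (hg : g ∈ HC k 𝒜 p b) :
    f + g ∈ HC k 𝒜 p b :=
  ⟨Multilinear.add hf.1 hg.1, fun l hl => by rw [Pi.add_apply, hf.2.1 l hl, hg.2.1 l hl, add_zero],
    fun l ds h => add_mem (hf.2.2 l ds h) (hg.2.2 l ds h)⟩

theorem HC.zsmul {p : ℕ} {b : ℤ} {f : List A → A} (hf : f ∈ HC k 𝒜 p b) (n : ℤ) :
    n • f ∈ HC k 𝒜 p b :=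
  ⟨Multilinear.zsmul hf.1 n, Supported.zsmul hf.2.1 n, fun l ds h => zsmul_mem (hf.2.2 l ds h) n⟩

theorem HC.sub {p : ℕ} {b : ℤ} {f g : List A → A} (hf : f ∈ HC k 𝒜 p b) (hg : g ∈ HC k 𝒜 p b) :
    f - g ∈ HC k 𝒜 p b := by
  rw [show f - g = f + (-1 : ℤ) • g by module]
  exact HC.add hf (HC.zsmul hg _)

theorem HC.zero {p : ℕ} {b : ℤ} : 0 ∈ HC k 𝒜 p b :=
  ⟨fun _ _ => (0 : A →ₗ[k] A).isLinear, fun _ _ => rfl, fun _ _ _ => zero_mem _⟩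

theorem multilinear_idc : Multilinear k (idc : List A → A) := by
  intro l r
  by_cases h : l ≠ [] ∨ r ≠ []
  · simp only [idc_append_cons _ _ _ h]
    exact (0 : A →ₗ[k] A).isLinear
  · push Not at h
    rw [h.1, h.2]
    exact (LinearMap.id : A →ₗ[k] A).isLinear

theorem Multilinear.conv {f g : List A → A} (hf : Multilinear k f) (hg : Multilinear k g) :
    Multilinear k (f ⋆ g) :=
  Multilinear.splitSum (fun y l r => ((LinearMap.mulRight k (g y)) ∘ₗ hf.hom l r).isLinear)
    fun x l r => ((LinearMap.mulLeft k (f x)) ∘ₗ hg.hom l r).isLinear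

theorem multilinear_mulc : Multilinear k (mulc : List A → A) :=
  multilinear_idc.conv multilinear_idc

/-- Multiplicativity of a family of submodules. -/
def IsMultiplicative (𝒜 : ℤ → Submodule k A) : Prop :=
  ∀ ⦃d e : ℤ⦄ ⦃a b : A⦄, a ∈ 𝒜 d → b ∈ 𝒜 e → a * b ∈ 𝒜 (d + e)

theorem HC.conv (h𝒜 : IsMultiplicative 𝒜) {p r : ℕ} {b c : ℤ} {f g : List A → A}
    (hf : f ∈ HC k 𝒜 p b) (hg : g ∈ HC k 𝒜 r c) : f ⋆ g ∈ HC k 𝒜 (p + r) (b + c) := by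
  refine ⟨Multilinear.conv hf.1 hg.1, Supported.conv hf.2.1 hg.2.1, ?_⟩
  refine homogeneous_splitSum fun x dx y dy hx hy => ?_
  have := h𝒜 (hf.2.2 x dx hx) (hg.2.2 y dy hy)
  rwa [show dx.sum + b + (dy.sum + c) = dx.sum + dy.sum + (b + c) by ring] at this

/-! ### The bracket, the differential and the cup product in terms of insertions -/

theorem brace_eq_ins {r : ℕ} {f g : List A → A} (hf : Multilinear k f) (hg : Supported r g) :
    brace f g = ins ((-1) ^ (r + 1)) g f := by
  ext l
  simp only [ins, splitSum_eq_sum_range, brace]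
  refine Finset.sum_congr rfl fun i hi => ?_
  have hi' : i ≤ l.length := by simpa [Nat.lt_succ_iff] using hi
  rw [List.length_drop]
  refine Finset.sum_congr rfl fun n hn => ?_
  rw [List.drop_drop, List.length_take, min_eq_left hi']
  by_cases h : n = r
  · rw [h, ← pow_mul, mul_comm i]
  · rw [hg, hf.map_zero, smul_zero, smul_zero]
    rw [List.length_take, List.length_drop]
    simp at hn
    omega

theorem bracket_eq_ins {p r : ℕ} {f g : List A → A} (hf : Multilinear k f) (hg : Multilinear k g)
    (hf' : Supported p f) (hg' : Supported r g) :
    bracket p r f g = ins ((-1) ^ (r + 1)) g f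
      - ((-1) ^ ((p + 1) * (r + 1)) : ℤ) • ins ((-1) ^ (p + 1)) f g := by
  rw [bracket, brace_eq_ins hf hg', brace_eq_ins hg hf']

theorem cup_eq_conv {p r : ℕ} {f g : List A → A} (hf : Supported p f) (hg : Supported r g) :
    cup f g = ((-1) ^ (p * r) : ℤ) • (f ⋆ g) := by
  ext l
  rw [Pi.smul_apply, Hoch.conv, ← splitSum_smul, splitSum_eq_sum_range, cup]
  refine Finset.sum_congr rfl fun i hi => ?_
  have hi' : i ≤ l.length := by simpa [Nat.lt_succ_iff] using hi
  by_cases h : i = p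
  · by_cases h' : l.length - i = r
    · rw [h', h]
    · rw [hg (l.drop i) (by simpa using h')]; simp
  · rw [hf (l.take i) (by simpa [hi'] using h)]; simp

theorem mTwo_eq : (mTwo : List A → A) = -mulc := by
  ext l
  match l with
  | [] => simp [mTwo, Hoch.mulc, Hoch.conv, splitSum, Hoch.idc]
  | [a] => simp [mTwo, Hoch.mulc, Hoch.conv, splitSum, Hoch.idc]
  | [a, b] => simp [mTwo, Hoch.mulc, Hoch.conv, splitSum, Hoch.idc]
  | _ :: _ :: _ :: l => simp [mTwo, supported_mulc _]

/-- The differential `[m₂, f]` is the classical Hochschild differential up to sign. -/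
theorem diff_eq_dH {p : ℕ} {f : List A → A} (hf : Multilinear k f) (hf' : Supported p f) :
    diff p f = ((-1) ^ p : ℤ) • dH f := by
  have h1 : Multilinear k ((-1 : ℤ) • mulc : List A → A) := multilinear_mulc.zsmul (-1)
  have hm : (mTwo : List A → A) = (-1 : ℤ) • mulc := by rw [mTwo_eq, neg_one_smul]
  rw [diff, hm, bracket_eq_ins h1 hf (Supported.zsmul supported_mulc _) hf', ins_zsmul_right,
    ins_zsmul_left hf, ins_mulc, dH, hf'.sgn_eq, zsmul_conv,
    show ((-1 : ℤ)) ^ ((2 + 1) * (p + 1)) = -(-1) ^ p by rw [pow_mul]; norm_num [pow_succ],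
    show ((-1 : ℤ)) ^ (2 + 1) = -1 by norm_num]
  simp only [smul_add, smul_sub, smul_smul, pow_succ, neg_one_pow_mul_self]
  module

end Cochains

/-! ### The calculus of cohomology classes -/

section Classes

variable {k A : Type*} [CommRing k] [Ring A] [Algebra k A] {𝒜 : ℤ → Submodule k A}

theorem mem_HZ_iff {p : ℕ} {b : ℤ} {f : List A → A} :
    f ∈ HZ k 𝒜 p b ↔ f ∈ HC k 𝒜 p b ∧ dH f = 0 := by
  refine and_congr_right fun hf => ?_
  rw [diff_eq_dH hf.1 hf.2.1]
  refine ⟨fun h => ?_, fun h => by rw [h, smul_zero]⟩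
  have := congrArg (fun g => ((-1) ^ p : ℤ) • g) h
  simpa only [smul_smul, neg_one_pow_mul_self, one_smul, smul_zero] using this

theorem dH_zsmul (n : ℤ) (f : List A → A) : dH (n • f) = n • dH f := by
  rw [dH, ins_zsmul_right, conv_zsmul, show sgn (-1) (n • f) = n • sgn (-1) f from
    funext fun l => smul_comm ((-1 : ℤ) ^ l.length) n (f l), zsmul_conv, dH, smul_sub, smul_sub]

theorem dH_add (f g : List A → A) : dH (f + g) = dH f + dH g := by
  rw [dH, conv_add, show sgn (-1) (f + g) = sgn (-1) f + sgn (-1) g from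
    funext fun l => smul_add _ _ _, add_conv,
    show ins (-1) mulc (f + g) = ins (-1) mulc f + ins (-1) mulc g from ins_add _ _ _ _, dH, dH]
  abel

theorem dH_sub (f g : List A → A) : dH (f - g) = dH f - dH g := by
  rw [show f - g = f + (-1 : ℤ) • g by module, dH_add, dH_zsmul]
  module

theorem mem_HB_succ {n : ℕ} {b : ℤ} {f : List A → A} :
    f ∈ HB k 𝒜 (n + 1) b ↔ ∃ w ∈ HC k 𝒜 n b, dH w = f := by
  constructor
  · rintro ⟨w, hw, rfl⟩
    refine ⟨((-1) ^ n : ℤ) • w, HC.zsmul hw _, ?_⟩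
    rw [diff_eq_dH hw.1 hw.2.1, dH_zsmul]
  · rintro ⟨w, hw, rfl⟩
    refine ⟨((-1) ^ n : ℤ) • w, HC.zsmul hw _, ?_⟩
    rw [diff_eq_dH (HC.zsmul hw _).1 (HC.zsmul hw _).2.1, dH_zsmul, smul_smul,
      neg_one_pow_mul_self, one_smul]

theorem dH_mem_HB {n m : ℕ} {b : ℤ} {w : List A → A} (hw : w ∈ HC k 𝒜 n b) (hm : m = n + 1) :
    dH w ∈ HB k 𝒜 m b := by
  subst hm
  exact mem_HB_succ.2 ⟨w, hw, rfl⟩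

theorem dH_zero : dH (0 : List A → A) = 0 := by
  simpa using dH_zsmul 0 (0 : List A → A)

theorem HB.zero {n : ℕ} {b : ℤ} : 0 ∈ HB k 𝒜 n b := by
  cases n with
  | zero => rfl
  | succ n => exact mem_HB_succ.2 ⟨0, HC.zero, dH_zero⟩

theorem HB.add {n : ℕ} {b : ℤ} {f g : List A → A} (hf : f ∈ HB k 𝒜 n b) (hg : g ∈ HB k 𝒜 n b) :
    f + g ∈ HB k 𝒜 n b := by
  cases n with
  | zero =>
    rw [show f = 0 from hf, show g = 0 from hg, add_zero]
    rfl
  | succ n =>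
    obtain ⟨v, hv, rfl⟩ := mem_HB_succ.1 hf
    obtain ⟨w, hw, rfl⟩ := mem_HB_succ.1 hg
    exact mem_HB_succ.2 ⟨v + w, HC.add hv hw, dH_add v w⟩

theorem HB.zsmul {n : ℕ} {b : ℤ} {f : List A → A} (hf : f ∈ HB k 𝒜 n b) (m : ℤ) :
    m • f ∈ HB k 𝒜 n b := by
  cases n with
  | zero =>
    rw [show f = 0 from hf, smul_zero]
    rfl
  | succ n =>
    obtain ⟨v, hv, rfl⟩ := mem_HB_succ.1 hf
    exact mem_HB_succ.2 ⟨m • v, HC.zsmul hv m, dH_zsmul m v⟩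

theorem HB.sub {n : ℕ} {b : ℤ} {f g : List A → A} (hf : f ∈ HB k 𝒜 n b) (hg : g ∈ HB k 𝒜 n b) :
    f - g ∈ HB k 𝒜 n b := by
  rw [show f - g = f + (-1 : ℤ) • g by module]
  exact HB.add hf (HB.zsmul hg _)

/-- The Hochschild differential is a skew derivation of the convolution product. -/
theorem dH_conv (f g : List A → A) : dH (f ⋆ g) = dH f ⋆ g + sgn (-1) f ⋆ dH g := by
  simp only [dH, ins_conv, sgn_conv, sub_conv, conv_sub, conv_assoc]
  abel

theorem dH_conv_eq_zero {f g : List A → A} (hf : dH f = 0) (hg : dH g = 0) : dH (f ⋆ g) = 0 := by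
  rw [dH_conv, hf, hg]
  simpa using congrArg₂ (· + ·) (zsmul_conv 0 0 g) (conv_zsmul 0 (sgn (-1) f) 0)

theorem HB.conv (h𝒜 : IsMultiplicative 𝒜) {n r m : ℕ} {b c : ℤ} {f g : List A → A}
    (hf : f ∈ HB k 𝒜 (n + 1) b) (hg : g ∈ HC k 𝒜 r c) (hg' : dH g = 0) (hm : m = n + r + 1) :
    f ⋆ g ∈ HB k 𝒜 m (b + c) := by
  obtain ⟨w, hw, rfl⟩ := mem_HB_succ.1 hf
  have : dH (w ⋆ g) = dH w ⋆ g := by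
    rw [dH_conv, hg']
    simpa using conv_zsmul 0 (sgn (-1) w) 0
  rw [← this]
  exact dH_mem_HB (HC.conv h𝒜 hw hg) hm

theorem HB.conv_left (h𝒜 : IsMultiplicative 𝒜) {n r m : ℕ} {b c : ℤ} {f g : List A → A}
    (hf : f ∈ HB k 𝒜 (n + 1) b) (hg : g ∈ HC k 𝒜 r c) (hg' : dH g = 0) (hm : m = n + r + 1) :
    g ⋆ f ∈ HB k 𝒜 m (c + b) := by
  obtain ⟨w, hw, rfl⟩ := mem_HB_succ.1 hf
  have : dH (g ⋆ w) = ((-1) ^ r : ℤ) • (g ⋆ dH w) := by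
    rw [dH_conv, hg', Supported.sgn_eq hg.2.1, zsmul_conv]
    simpa using zsmul_conv 0 0 w
  have h2 : g ⋆ dH w = ((-1) ^ r : ℤ) • dH (g ⋆ w) := by
    rw [this, smul_smul, neg_one_pow_mul_self, one_smul]
  rw [h2]
  exact HB.zsmul (dH_mem_HB (HC.conv h𝒜 hg hw) (by omega)) _

/-- Graded commutativity of the cup product of Hochschild classes. -/
theorem conv_comm_mem_HB {p r m : ℕ} {b c : ℤ} {f g : List A → A}
    (hf : f ∈ HC k 𝒜 (p + 1) b) (hf' : dH f = 0) (hg : g ∈ HC k 𝒜 r c) (hg' : dH g = 0)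
    (hm : m = p + r + 1) :
    g ⋆ f - ((-1) ^ ((p + 1) * r) : ℤ) • (f ⋆ g) ∈ HB k 𝒜 m (b + c) := by
  have h := dH_ins hg.2.1 hf.2.1 rfl hf.1
  have hF : Multilinear k f := hf.1
  have h0 : ins ((-1) ^ (r + 1)) g (0 : List A → A) = 0 := by
    simpa using ins_zsmul_right ((-1) ^ (r + 1)) 0 g (0 : List A → A)
  rw [hf', hg', ins_zero hF, h0, smul_zero, add_zero, zero_sub] at h
  have h2 : g ⋆ f - ((-1) ^ ((p + 1) * r) : ℤ) • (f ⋆ g) = (-(-1) ^ (r + 1) : ℤ) •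
      dH (ins ((-1) ^ (r + 1)) g f) := by
    rw [h, smul_neg, smul_smul, neg_mul, neg_one_pow_mul_self]
    module
  rw [h2]
  exact HB.zsmul (dH_mem_HB (HC.ins hf hg _) hm) _

/-- The bracket with a class of degree `4` is a derivation of the cup product: the part of this
identity that holds only up to a coboundary. -/
theorem ins_conv_mem_HB {r q m : ℕ} {b c d : ℤ} {u g h : List A → A}
    (hu : u ∈ HC k 𝒜 4 b) (hu' : dH u = 0) (hg : g ∈ HC k 𝒜 r c) (hg' : dH g = 0)
    (hh : h ∈ HC k 𝒜 q d) (hh' : dH h = 0) (hm : m = r + q + 3) :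
    ins ((-1) ^ (r + q + 1)) (g ⋆ h) u - g ⋆ ins ((-1) ^ (q + 1)) h u
      - ((-1) ^ q : ℤ) • (ins ((-1) ^ (r + 1)) g u ⋆ h) ∈ HB k 𝒜 m (b + c + d) := by
  have e := dH_dins hg.2.1 hh.2.1 hu.2.1 (by decide) rfl rfl hg' hh' hu' hu.1 hg.1
  have e1 : (-((-1 : ℤ) ^ (r + 1) * (-1) ^ (q + 1))) = (-1) ^ (r + q + 1) := by
    simp only [pow_succ, pow_add]; ring
  rw [e1] at e
  have e3 : ((-1 : ℤ) ^ (r + 1) * ((-1) ^ (q + 1)) ^ (r + 1)) *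
      ((-1 : ℤ) ^ (r + 1) * ((-1) ^ (q + 1)) ^ (r + 1)) = 1 := by
    rw [← pow_mul, ← pow_add, neg_one_pow_mul_self]
  have h2 : ins ((-1) ^ (r + q + 1)) (g ⋆ h) u - g ⋆ ins ((-1) ^ (q + 1)) h u
      - ((-1) ^ q : ℤ) • (ins ((-1) ^ (r + 1)) g u ⋆ h) =
      ((-1 : ℤ) ^ (r + 1) * ((-1) ^ (q + 1)) ^ (r + 1)) •
        dH (dins ((-1) ^ (r + 1)) ((-1) ^ (q + 1)) g h u) := by
    rw [e, smul_smul, e3, pow_succ _ q]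
    module
  rw [h2]
  exact HB.zsmul (dH_mem_HB (HC.dins (p := 2) hu hg hh _ _) (by omega)) _

/-! ### Multiplication by a central element -/

/-- The cochain `l ↦ f l * c`. -/
def mulR (c : A) (f : List A → A) (l : List A) : A := f l * c

theorem mulR_add (c : A) (f g : List A → A) : mulR c (f + g) = mulR c f + mulR c g :=
  funext fun _ => add_mul _ _ _

theorem mulR_zsmul (c : A) (n : ℤ) (f : List A → A) : mulR c (n • f) = n • mulR c f := by
  ext l; simp only [mulR, Pi.smul_apply, smul_mul_assoc]

theorem mulR_sub (c : A) (f g : List A → A) : mulR c (f - g) = mulR c f - mulR c g :=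
  funext fun _ => sub_mul _ _ _

theorem mulR_mulR (c d : A) (f : List A → A) : mulR c (mulR d f) = mulR (d * c) f :=
  funext fun _ => mul_assoc _ _ _

theorem conv_mulR (c : A) (f g : List A → A) : f ⋆ mulR c g = mulR c (f ⋆ g) := by
  ext l
  refine Eq.trans ?_ (map_splitSum (AddMonoidHom.mulRight c) _ l).symm
  exact splitSum_congr fun x y _ => (mul_assoc _ _ _).symm

theorem mulR_conv {c : A} (hc : ∀ a, c * a = a * c) (f g : List A → A) :
    mulR c f ⋆ g = mulR c (f ⋆ g) := by
  rw [← conv_mulR]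
  exact funext fun l => splitSum_congr fun x y _ => by
    rw [mulR, mulR, mul_assoc, hc]

theorem ins_mulR (s : ℤ) (g : List A → A) (c : A) (f : List A → A) :
    ins s g (mulR c f) = mulR c (ins s g f) :=
  funext fun l => (map_ins (AddMonoidHom.mulRight c) s g f l).symm

theorem dH_mulR {c : A} (hc : ∀ a, c * a = a * c) (f : List A → A) :
    dH (mulR c f) = mulR c (dH f) := by
  rw [dH, dH, conv_mulR, ins_mulR, mulR_sub, mulR_sub, ← mulR_conv hc (sgn (-1) f)]
  congr 3
  exact funext fun l => (smul_mul_assoc _ _ _).symm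

theorem HC.mulR (h𝒜 : IsMultiplicative 𝒜) {p : ℕ} {b d : ℤ} {f : List A → A}
    (hf : f ∈ HC k 𝒜 p b) {c : A} (hc : c ∈ 𝒜 d) : mulR c f ∈ HC k 𝒜 p (b + d) :=
  ⟨Multilinear.comp hf.1 (LinearMap.mulRight k c),
    fun l hl => by rw [Hoch.mulR, hf.2.1 l hl, zero_mul],
    fun l ds h => by rw [← add_assoc]; exact h𝒜 (hf.2.2 l ds h) hc⟩

theorem HB.mulR (h𝒜 : IsMultiplicative 𝒜) {n : ℕ} {b d : ℤ} {f : List A → A}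
    (hf : f ∈ HB k 𝒜 (n + 1) b) {c : A} (hc : c ∈ 𝒜 d) (hc' : ∀ a, c * a = a * c) :
    Hoch.mulR c f ∈ HB k 𝒜 (n + 1) (b + d) := by
  obtain ⟨w, hw, rfl⟩ := mem_HB_succ.1 hf
  exact mem_HB_succ.2 ⟨_, HC.mulR h𝒜 hw hc, dH_mulR hc' w⟩

/-! ### Insertion of a central element -/

theorem supported_const (c : A) : Supported 0 (const c)
  | [], h => absurd rfl h
  | _ :: _, _ => rfl

theorem multilinear_const (c : A) : Multilinear k (const c) := by
  intro l r
  have : ∀ a, const c (l ++ a :: r) = 0 := fun a => supported_const c _ (by simp)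
  simp only [this]
  exact (0 : A →ₗ[k] A).isLinear

theorem dH_const {c : A} (hc : ∀ a, c * a = a * c) : dH (const c) = 0 := by
  have h1 : idc ⋆ const c = mulR c idc := by
    ext l
    exact (splitSum_right (fun x a y => by simp [const]) l).trans rfl
  have h2 : const c ⋆ idc = mulR c idc := by
    ext l
    exact (splitSum_left (fun x a y => by simp [const]) l).trans (hc _)
  have h3 : ins (-1) mulc (const c) = 0 := by
    ext l
    exact splitSum_eq_zero fun x w _ => splitSum_eq_zero fun y z _ => by
      rw [supported_const c _ (by simp), smul_zero]
  rw [dH, (supported_const c).sgn_eq, h1, pow_zero, one_smul, h2, h3, sub_self, sub_zero]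

/-- Inserting a central element commutes with the differential up to sign, so that it acts on
cohomology. -/
theorem dH_ins_const {c : A} (hc : ∀ a, c * a = a * c) {p : ℕ} {f : List A → A}
    (hf : Supported p f) (hF : Multilinear k f) :
    dH (ins (-1) (const c) f) = -ins (-1) (const c) (dH f) := by
  have h1 : const c ⋆ f = mulR c f := by
    ext l
    exact (splitSum_left (fun x a y => by simp [const]) l).trans (hc _)
  have h2 : f ⋆ const c = mulR c f := by
    ext l
    exact (splitSum_right (fun x a y => by simp [const]) l).trans rfl
  rw [dH_ins (supported_const c) hf (by norm_num) hF, dH_const hc, ins_zero hF, h1, h2]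
  simp

end Classes

/-! ### Cochains of `Λ[ı^{±1}]` -/

section Laurent

open LaurentPolynomial

/-- The coefficients of a list of monomials. -/
abbrev coefs {Λ : Type*} (L : List (Λ × ℤ)) : List Λ := L.map Prod.fst

/-- The total exponent of a list of monomials. -/
def expSum {Λ : Type*} (L : List (Λ × ℤ)) : ℤ := (L.map Prod.snd).sum

theorem expSum_append {Λ : Type*} (L M : List (Λ × ℤ)) :
    expSum (L ++ M) = expSum L + expSum M := by
  simp [expSum]

theorem expSum_cons {Λ : Type*} (m : Λ × ℤ) (M : List (Λ × ℤ)) :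
    expSum (m :: M) = m.2 + expSum M := by
  simp [expSum]

variable {Λ : Type*} [Ring Λ]

/-- The monomial `c ıⁿ`. -/
def mono (m : Λ × ℤ) : Λ[T;T⁻¹] := C m.1 * T m.2

theorem mono_eq_single (m : Λ × ℤ) : mono m = .single m.2 m.1 := (single_eq_C_mul_T _ _).symm

theorem mono_mul (a b : Λ) (m n : ℤ) : mono (a, m) * mono (b, n) = mono (a * b, m + n) := by
  simp only [mono_eq_single, AddMonoidAlgebra.single_mul_single]

theorem mono_add (a b : Λ) (n : ℤ) : mono (a + b, n) = mono (a, n) + mono (b, n) := by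
  simp only [mono, map_add, add_mul]

theorem mono_zero (n : ℤ) : mono ((0 : Λ), n) = 0 := by
  simp only [mono, map_zero, zero_mul]

theorem mono_mul_T (a : Λ) (m q : ℤ) : mono (a, m) * T q = mono (a, m + q) := by
  simp only [mono, mul_assoc, T_add]

theorem C_eq_mono (a : Λ) : C a = mono (a, 0) := by simp [mono]

theorem laurent_induction {P : Λ[T;T⁻¹] → Prop} (a : Λ[T;T⁻¹])
    (add : ∀ a b, P a → P b → P (a + b)) (hm : ∀ m, P (mono m)) : P a :=
  LaurentPolynomial.induction_on' a add fun n c => hm (c, n)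

theorem T_central (q : ℤ) (a : Λ[T;T⁻¹]) : T q * a = a * T q := by
  induction a using laurent_induction with
  | add a b ha hb => rw [mul_add, ha, hb, add_mul]
  | hm m =>
    rw [show (T q : Λ[T;T⁻¹]) = mono (1, q) by simp [mono], mono_mul, mono_mul, one_mul, mul_one,
      add_comm]

theorem coeff_mono (c : Λ) (m n : ℤ) : (mono (c, m)).coeff n = if m = n then c else 0 := by
  rw [mono_eq_single, AddMonoidAlgebra.coeff_single, Finsupp.single_apply]

theorem sum_coeff_mono {N : Type*} [AddCommMonoid N] (c : Λ) (m : ℤ) (h : ℤ → Λ → N)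
    (h0 : h m 0 = 0) : (mono (c, m)).coeff.sum h = h m c := by
  rw [mono_eq_single, AddMonoidAlgebra.coeff_single, Finsupp.sum_single_index h0]

theorem coeff_C_mul (a : Λ) (x : Λ[T;T⁻¹]) (n : ℤ) : (C a * x).coeff n = a * x.coeff n := by
  induction x using laurent_induction with
  | add x y hx hy => simp only [mul_add, AddMonoidAlgebra.coeff_add, Finsupp.add_apply, hx, hy]
  | hm m =>
    rw [C_eq_mono, mono_mul, coeff_mono, coeff_mono]
    simp

theorem coeff_mul_C (a : Λ) (x : Λ[T;T⁻¹]) (n : ℤ) : (x * C a).coeff n = x.coeff n * a := by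
  induction x using laurent_induction with
  | add x y hx hy => simp only [add_mul, AddMonoidAlgebra.coeff_add, Finsupp.add_apply, hx, hy]
  | hm m =>
    rw [C_eq_mono, mono_mul, coeff_mono, coeff_mono]
    simp

theorem coeff_mul_T (x : Λ[T;T⁻¹]) (q n : ℤ) : (x * T q).coeff (n + q) = x.coeff n := by
  induction x using laurent_induction with
  | add x y hx hy => simp only [add_mul, AddMonoidAlgebra.coeff_add, Finsupp.add_apply, hx, hy]
  | hm m => rw [mono_mul_T, coeff_mono, coeff_mono]; simp

theorem ext_cons (f : List Λ → Λ) (a : Λ[T;T⁻¹]) (l : List Λ[T;T⁻¹]) :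
    ext f (a :: l) = a.coeff.sum fun n c => ext (fun t => f (c :: t)) l * T n := rfl

theorem ext_zero : ext (0 : List Λ → Λ) = 0 := by
  ext1 l
  induction l with
  | nil => exact map_zero _
  | cons a l ih =>
    rw [ext_cons]
    exact Finset.sum_eq_zero fun n _ => (congrArg (· * T n) ih).trans (zero_mul _)

theorem ext_add (f g : List Λ → Λ) : ext (f + g) = ext f + ext g := by
  ext1 l
  induction l generalizing f g with
  | nil => exact map_add _ _ _
  | cons a l ih =>
    rw [Pi.add_apply, ext_cons, ext_cons, ext_cons, ← Finsupp.sum_add]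
    refine Finsupp.sum_congr fun n _ => ?_
    rw [← add_mul]
    exact congrArg (· * T n) (ih (fun t => f (a.coeff n :: t)) (fun t => g (a.coeff n :: t)))

theorem Supported.ext {f : List Λ → Λ} {p : ℕ} (hf : Supported p f) : Supported p (ext f) := by
  have key : ∀ (l : List Λ[T;T⁻¹]) (f : List Λ → Λ), (∀ t, t.length = l.length → f t = 0) →
      Hoch.ext f l = 0 := by
    intro l
    induction l with
    | nil => exact fun f h => (congrArg _ (h [] rfl)).trans (map_zero _)
    | cons a l ih =>
      intro f h
      rw [ext_cons]
      refine Finset.sum_eq_zero fun n _ => ?_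
      change Hoch.ext (fun t => f (a.coeff n :: t)) l * T n = 0
      rw [ih _ fun t ht => h _ (by simp [ht]), zero_mul]
  exact fun l hl => key l f fun t ht => hf t (ht ▸ hl)

variable [Algebra ℂ Λ]

theorem ext_smul (r : ℂ) (f : List Λ → Λ) : ext (r • f) = r • ext f := by
  ext1 l
  induction l generalizing f with
  | nil =>
    change C (r • f []) = r • C (f [])
    rw [C_eq_mono, C_eq_mono, mono_eq_single, mono_eq_single]
    exact (AddMonoidAlgebra.smul_single _ _ _).symm
  | cons a l ih =>
    rw [Pi.smul_apply, ext_cons, ext_cons, Finsupp.smul_sum]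
    refine Finsupp.sum_congr fun n _ => ?_
    rw [← smul_mul_assoc]
    exact congrArg (· * T n) (ih (fun t => f (a.coeff n :: t)))

theorem Multilinear.cons {A N : Type*} [AddCommGroup A] [Module ℂ A] [AddCommGroup N] [Module ℂ N]
    {f : List A → N} (hf : Multilinear ℂ f) (c : A) :
    Multilinear ℂ fun t => f (c :: t) := fun l r => hf (c :: l) r

theorem Multilinear.ext {f : List Λ → Λ} (hf : Multilinear ℂ f) : Multilinear ℂ (ext f) := by
  intro l
  induction l generalizing f with
  | nil =>
    intro r
    have h0 : (fun t => f (0 :: t)) = 0 := funext fun t => hf.map_zero [] t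
    have h1 : ∀ a b, (fun t => f ((a + b) :: t)) = (fun t => f (a :: t)) + fun t => f (b :: t) :=
      fun a b => funext fun t => hf.map_add [] t a b
    have h2 : ∀ (c : ℂ) a, (fun t => f ((c • a) :: t)) = c • fun t => f (a :: t) :=
      fun c a => funext fun t => (hf [] t).map_smul c a
    refine ⟨fun a b => ?_, fun c a => ?_⟩
    · refine Finsupp.sum_add_index' (fun n => ?_) fun n c d => ?_
      · rw [h0, ext_zero, Pi.zero_apply, zero_mul]
      · rw [h1, ext_add, Pi.add_apply, add_mul]
    · refine (Finsupp.sum_smul_index' (fun n => ?_)).trans ?_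
      · rw [h0, ext_zero, Pi.zero_apply, zero_mul]
      · simp only [h2, ext_smul, Pi.smul_apply, smul_mul_assoc]
        exact Finsupp.smul_sum.symm
  | cons b l ih =>
    intro r
    refine ⟨fun x y => ?_, fun c x => ?_⟩
    · simp only [List.cons_append, ext_cons, (ih (hf.cons _) r).map_add, add_mul]
      exact Finsupp.sum_add
    · simp only [List.cons_append, ext_cons, (ih (hf.cons _) r).map_smul, smul_mul_assoc]
      exact Finsupp.smul_sum.symm

theorem ext_map_mono {f : List Λ → Λ} (hf : Multilinear ℂ f) (L : List (Λ × ℤ)) :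
    ext f (L.map mono) = mono (f (coefs L), expSum L) := by
  induction L generalizing f with
  | nil => exact C_eq_mono _
  | cons m L ih =>
    rw [List.map_cons, ext_cons, mono.eq_1, ← mono.eq_1 m, ← Prod.mk.eta (p := m), sum_coeff_mono]
    · rw [ih (hf.cons _), mono_mul_T, expSum_cons, add_comm]
      rfl
    · rw [show (fun t => f (0 :: t)) = 0 from funext fun t => hf.map_zero [] t, ext_zero,
        Pi.zero_apply, zero_mul]

/-- Multilinear functions that agree on monomials are equal. -/
theorem Multilinear.eq_of_mono {N : Type*} [AddCommGroup N] [Module ℂ N] {F G : List Λ[T;T⁻¹] → N}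
    (hF : Multilinear ℂ F) (hG : Multilinear ℂ G)
    (h : ∀ L : List (Λ × ℤ), F (L.map mono) = G (L.map mono)) : F = G := by
  have key : ∀ (l : List Λ[T;T⁻¹]) (L : List (Λ × ℤ)),
      F (L.map mono ++ l) = G (L.map mono ++ l) := by
    intro l
    induction l with
    | nil => intro L; simpa using h L
    | cons a l ih =>
      intro L
      induction a using laurent_induction with
      | add a b ha hb => rw [hF.map_add, hG.map_add, ha, hb]
      | hm m => simpa using ih (L ++ [m])
  exact funext fun l => key l []

theorem Multilinear.eq_ext {F : List Λ[T;T⁻¹] → Λ[T;T⁻¹]} (hF : Multilinear ℂ F)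
    {f : List Λ → Λ} (hf : Multilinear ℂ f)
    (h : ∀ L : List (Λ × ℤ), F (L.map mono) = mono (f (coefs L), expSum L)) : F = Hoch.ext f :=
  hF.eq_of_mono hf.ext fun L => by rw [h, ext_map_mono hf]

theorem mem_gr {d : ℤ} {a : Λ[T;T⁻¹]} :
    a ∈ gr Λ d ↔ a = 0 ∨ ∃ m : Λ × ℤ, d = -2 * m.2 ∧ a = mono m := by
  constructor
  · intro ha
    induction ha using Submodule.span_induction with
    | mem a h => obtain ⟨c, n, h, rfl⟩ := h; exact Or.inr ⟨(c, n), h, rfl⟩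
    | zero => exact Or.inl rfl
    | add a b _ _ ha hb =>
      rcases ha with rfl | ⟨⟨a, n⟩, h, rfl⟩
      · rwa [zero_add]
      · rcases hb with rfl | ⟨⟨b, n'⟩, h', rfl⟩
        · rw [add_zero]; exact Or.inr ⟨_, h, rfl⟩
        · obtain rfl : n = n' := by simp only at h h'; omega
          exact Or.inr ⟨(a + b, n), h, (mono_add _ _ _).symm⟩
    | smul r a _ ha =>
      rcases ha with rfl | ⟨⟨a, n⟩, h, rfl⟩
      · exact Or.inl (smul_zero _)
      · refine Or.inr ⟨(r • a, n), h, ?_⟩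
        rw [mono_eq_single, mono_eq_single]
        simp only [AddMonoidAlgebra.smul_single]
  · rintro (rfl | ⟨m, h, rfl⟩)
    · exact zero_mem _
    · exact Submodule.subset_span ⟨m.1, m.2, h, rfl⟩

theorem mono_mem_gr (c : Λ) (n : ℤ) : mono (c, n) ∈ gr Λ (-2 * n) := mem_gr.2 (Or.inr ⟨_, rfl, rfl⟩)

theorem isMultiplicative_gr : IsMultiplicative (gr Λ) := by
  intro d e a b ha hb
  rcases mem_gr.1 ha with rfl | ⟨m, rfl, rfl⟩
  · rw [zero_mul]; exact zero_mem _
  · rcases mem_gr.1 hb with rfl | ⟨m', rfl, rfl⟩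
    · rw [mul_zero]; exact zero_mem _
    · rw [← Prod.mk.eta (p := m), ← Prod.mk.eta (p := m'), mono_mul, ← mul_add]
      exact mono_mem_gr _ _

theorem Multilinear.homogeneous_gr {F : List Λ[T;T⁻¹] → Λ[T;T⁻¹]} (hF : Multilinear ℂ F) {b : ℤ}
    (h : ∀ L : List (Λ × ℤ), F (L.map mono) ∈ gr Λ (-2 * expSum L + b)) :
    Homogeneous (gr Λ) b F := by
  have key : ∀ (l : List Λ[T;T⁻¹]) (ds : List ℤ), List.Forall₂ (fun a d => a ∈ gr Λ d) l ds →
      ∀ L : List (Λ × ℤ), F (L.map mono ++ l) ∈ gr Λ (-2 * expSum L + ds.sum + b) := by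
    intro l ds hl
    induction hl with
    | nil => intro L; simpa using h L
    | @cons a d l ds ha hl ih =>
      intro L
      rcases mem_gr.1 ha with rfl | ⟨m, rfl, rfl⟩
      · rw [hF.map_zero]; exact zero_mem _
      · have := ih (L ++ [m])
        rw [expSum_append, expSum_cons, show expSum ([] : List (Λ × ℤ)) = 0 from rfl] at this
        rw [List.sum_cons]
        rw [show -2 * expSum L + (-2 * m.2 + ds.sum) + b =
          -2 * (expSum L + (m.2 + 0)) + ds.sum + b by ring]
        simpa using this
  intro l ds hl
  simpa [expSum] using key l ds hl []

theorem ext_mem_HC {f : List Λ → Λ} {p : ℕ} (hf : Multilinear ℂ f) (hf' : Supported p f) :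
    ext f ∈ HC ℂ (gr Λ) p 0 :=
  ⟨hf.ext, hf'.ext, hf.ext.homogeneous_gr fun L => by
    rw [ext_map_mono hf, add_zero]; exact mono_mem_gr _ _⟩

theorem mem_HC_degZero {f : List Λ → Λ} {p : ℕ} :
    f ∈ HC ℂ (degZero Λ) p 0 ↔ Multilinear ℂ f ∧ Supported p f := by
  refine ⟨fun h => ⟨h.1, h.2.1⟩, fun h => ⟨h.1, h.2, ?_⟩⟩
  have key : ∀ (l : List Λ) (ds : List ℤ), List.Forall₂ (fun a d => a ∈ degZero Λ d) l ds →
      ds.sum = 0 ∨ ∃ x z, l = x ++ 0 :: z := by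
    intro l ds hl
    induction hl with
    | nil => exact Or.inl rfl
    | @cons a d l ds ha hl ih =>
      by_cases hd : d = 0
      · rcases ih with h | ⟨x, z, rfl⟩
        · exact Or.inl (by rw [List.sum_cons, hd, h, add_zero])
        · exact Or.inr ⟨a :: x, z, rfl⟩
      · rw [degZero, if_neg hd, Submodule.mem_bot] at ha
        exact Or.inr ⟨[], l, by rw [ha]; rfl⟩
  intro l ds hl
  rcases key l ds hl with h0 | ⟨x, z, rfl⟩
  · rw [h0, add_zero, degZero, if_pos rfl]; trivial
  · rw [h.1.map_zero]; exact zero_mem _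

theorem isMultiplicative_degZero : IsMultiplicative (degZero Λ) := by
  intro d e a b ha hb
  unfold degZero at *
  split_ifs at * <;> simp_all

end Laurent

/-! ### The extension of cochains from `Λ` to `Λ[ı^{±1}]` -/

section Laurent

open LaurentPolynomial

variable {Λ : Type*} [Ring Λ] [Algebra ℂ Λ]

/-- The map `c ↦ c ıⁿ`. -/
def monoHom (n : ℤ) : Λ →+ Λ[T;T⁻¹] :=
  AddMonoidHom.mk' (fun c => mono (c, n)) fun a b => mono_add a b n

theorem mono_splitSum {B : Type*} (Φ : List B → List B → Λ) (l : List B) (n : ℤ) :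
    mono (splitSum Φ l, n) = splitSum (fun x y => mono (Φ x y, n)) l :=
  map_splitSum (monoHom n) Φ l

theorem mono_zsmul (j : ℤ) (c : Λ) (n : ℤ) : mono (j • c, n) = j • mono (c, n) :=
  map_zsmul (monoHom n) j c

theorem splitSum_coefs {N : Type*} [AddCommGroup N] (Φ : List Λ → List Λ → N) (L : List (Λ × ℤ)) :
    splitSum Φ (coefs L) = splitSum (fun x y => Φ (coefs x) (coefs y)) L :=
  splitSum_map Φ Prod.fst L

theorem idc_eq_ext : (idc : List Λ[T;T⁻¹] → Λ[T;T⁻¹]) = ext idc :=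
  multilinear_idc.eq_ext multilinear_idc fun L => by
    match L with
    | [] => exact (mono_zero _).symm
    | [m] => simp [idc, expSum]
    | _ :: _ :: _ => exact (mono_zero _).symm

theorem ext_conv {f g : List Λ → Λ} (hf : Multilinear ℂ f) (hg : Multilinear ℂ g) :
    ext f ⋆ ext g = ext (f ⋆ g) :=
  (hf.ext.conv hg.ext).eq_ext (hf.conv hg) fun L => by
    rw [conv, splitSum_map, conv, splitSum_coefs, mono_splitSum]
    refine splitSum_congr fun x y e => ?_
    rw [ext_map_mono hf, ext_map_mono hg, mono_mul, ← e, expSum_append]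

theorem mulc_eq_ext : (mulc : List Λ[T;T⁻¹] → Λ[T;T⁻¹]) = ext mulc := by
  rw [mulc, idc_eq_ext, ext_conv multilinear_idc multilinear_idc, mulc]

theorem ext_ins {f g : List Λ → Λ} (hf : Multilinear ℂ f) (hg : Multilinear ℂ g) (s : ℤ) :
    ins s (ext g) (ext f) = ext (ins s g f) :=
  (hf.ext.ins hg.ext s).eq_ext (hf.ins hg s) fun L => by
    rw [ins, splitSum_map, ins, splitSum_coefs, mono_splitSum]
    refine splitSum_congr fun x w e => ?_
    rw [splitSum_map, splitSum_coefs, mono_splitSum]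
    refine splitSum_congr fun y z e' => ?_
    have := ext_map_mono hf (x ++ (g (coefs y), expSum y) :: z)
    rw [ext_map_mono hg, mono_zsmul, List.length_map, List.length_map]
    rw [List.map_append, List.map_cons, expSum_append, expSum_cons] at this
    rw [this, ← e, ← e', expSum_append, expSum_append]
    simp

theorem ext_zsmul (n : ℤ) (f : List Λ → Λ) : ext (n • f) = n • ext f :=
  map_zsmul (AddMonoidHom.mk' (ext (Λ := Λ)) ext_add) n f

theorem ext_sub (f g : List Λ → Λ) : ext (f - g) = ext f - ext g :=
  map_sub (AddMonoidHom.mk' (ext (Λ := Λ)) ext_add) f g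

theorem Multilinear.sgn {A N : Type*} [AddCommGroup A] [Module ℂ A] [AddCommGroup N] [Module ℂ N]
    {f : List A → N} (hf : Multilinear ℂ f) (s : ℤ) : Multilinear ℂ (sgn s f) := by
  intro l r
  simp only [Hoch.sgn, List.length_append, List.length_cons]
  exact IsLinearMap.zsmul_apply (hf l r) _

theorem ext_sgn {f : List Λ → Λ} (hf : Multilinear ℂ f) (s : ℤ) : sgn s (ext f) = ext (sgn s f) :=
  (hf.ext.sgn s).eq_ext (hf.sgn s) fun L => by
    rw [sgn, ext_map_mono hf, sgn, mono_zsmul, List.length_map, List.length_map]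

theorem dH_ext {f : List Λ → Λ} (hf : Multilinear ℂ f) : dH (ext f) = ext (dH f) := by
  rw [dH, idc_eq_ext, mulc_eq_ext, ext_conv multilinear_idc hf, ext_sgn hf,
    ext_conv (hf.sgn _) multilinear_idc, ext_ins hf multilinear_mulc, dH, ext_sub, ext_sub]

theorem ext_mem_HB {f : List Λ → Λ} {n : ℕ} (hf : f ∈ HB ℂ (degZero Λ) n 0) :
    ext f ∈ HB ℂ (gr Λ) n 0 := by
  cases n with
  | zero => rw [show f = 0 from hf, ext_zero]; exact HB.zero
  | succ n =>
    obtain ⟨w, hw, rfl⟩ := mem_HB_succ.1 hf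
    have hw' := mem_HC_degZero.1 hw
    exact mem_HB_succ.2 ⟨ext w, ext_mem_HC hw'.1 hw'.2, dH_ext hw'.1⟩

/-- The extension of a cochain is linear over `ℂ[ı^{±1}]` in every entry. -/
theorem ext_append_mul_T {f : List Λ → Λ} (hf : Multilinear ℂ f) (x : List Λ[T;T⁻¹])
    (a : Λ[T;T⁻¹]) (q : ℤ) (z : List Λ[T;T⁻¹]) :
    ext f (x ++ (a * T q) :: z) = ext f (x ++ a :: z) * T q := by
  induction x generalizing f with
  | nil =>
    induction a using laurent_induction with
    | add a b ha hb =>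
      rw [add_mul, hf.ext.map_add, hf.ext.map_add, ha, hb, add_mul]
    | hm m =>
      have h0 : ∀ n, ext (fun t => f (0 :: t)) z * (T n : Λ[T;T⁻¹]) = 0 := fun n => by
        rw [show (fun t => f (0 :: t)) = 0 from funext fun t => hf.map_zero [] t, ext_zero,
          Pi.zero_apply, zero_mul]
      rw [← Prod.mk.eta (p := m), mono_mul_T, List.nil_append, List.nil_append, ext_cons, ext_cons,
        sum_coeff_mono _ _ _ (h0 _), sum_coeff_mono _ _ _ (h0 _), T_add, mul_assoc]
  | cons b x ih =>
    rw [List.cons_append, List.cons_append, ext_cons, ext_cons, Finsupp.sum_mul]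
    refine Finsupp.sum_congr fun n _ => ?_
    rw [ih (hf.cons _), mul_assoc, mul_assoc, T_central]

theorem ins_mulR_T {f : List Λ → Λ} (hf : Multilinear ℂ f) (s : ℤ)
    (g : List Λ[T;T⁻¹] → Λ[T;T⁻¹]) (q : ℤ) :
    ins s (mulR (T q) g) (ext f) = mulR (T q) (ins s g (ext f)) := by
  rw [← ins_mulR]
  ext1 l
  refine splitSum_congr fun x w _ => splitSum_congr fun y z _ => ?_
  rw [mulR, ext_append_mul_T hf]
  rfl

/-! ### The Euler derivation -/

theorem supported_euler : Supported 1 (euler Λ)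
  | [], _ => rfl
  | [_], h => absurd rfl h
  | _ :: _ :: _, _ => rfl

theorem euler_mono (c : Λ) (n : ℤ) : euler Λ [mono (c, n)] = mono ((-n) • c, n) := by
  rw [euler, sum_coeff_mono]
  · rfl
  · simp

theorem multilinear_euler : Multilinear ℂ (euler Λ) := by
  intro l r
  by_cases h : l = [] ∧ r = []
  · rw [h.1, h.2]
    refine ⟨fun a b => ?_, fun c a => ?_⟩
    · change (a.coeff + b.coeff).sum (fun n c => C ((-n) • c) * T n) = _
      refine Finsupp.sum_add_index' (fun n => ?_) fun n c d => ?_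
      · simp
      · rw [smul_add, map_add, add_mul]
    · change (c • a.coeff).sum (fun n c => C ((-n) • c) * T n) = _
      refine (Finsupp.sum_smul_index' (fun n => ?_)).trans ?_
      · simp
      · change _ = c • a.coeff.sum fun n c => C ((-n) • c) * T n
        rw [Finsupp.smul_sum]
        refine Finsupp.sum_congr fun n _ => ?_
        rw [smul_comm, ← mono.eq_1 (_, n), ← mono.eq_1 (_, n), mono_eq_single, mono_eq_single]
        exact (AddMonoidAlgebra.smul_single _ _ _).symm
  · have : ∀ a, euler Λ (l ++ a :: r) = 0 := fun a => supported_euler _ fun hl => h (by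
      simp only [List.length_append, List.length_cons] at hl
      constructor <;> apply List.eq_nil_of_length_eq_zero <;> omega)
    simp only [this]
    exact (0 : Λ[T;T⁻¹] →ₗ[ℂ] Λ[T;T⁻¹]).isLinear

theorem euler_mem_HC : euler Λ ∈ HC ℂ (gr Λ) 1 0 := by
  refine ⟨multilinear_euler, supported_euler, multilinear_euler.homogeneous_gr fun L => ?_⟩
  match L with
  | [] => exact zero_mem _
  | [(c, n)] =>
    rw [List.map_cons, List.map_nil, euler_mono, add_zero, expSum_cons]
    simpa [expSum] using mono_mem_gr ((-n) • c) n
  | _ :: _ :: _ => exact zero_mem _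

theorem ins_euler (s : ℤ) (g : List Λ[T;T⁻¹] → Λ[T;T⁻¹]) :
    ins s g (euler Λ) = fun l => euler Λ [g l] := by
  ext1 l
  have h : ∀ x b z, (x ≠ [] ∨ z ≠ []) → euler Λ (x ++ b :: z) = 0 := by
    intro x b z h
    refine supported_euler _ fun hl => ?_
    simp only [List.length_append, List.length_cons] at hl
    rcases h with h | h <;> have := List.length_pos_iff.2 h <;> omega
  rw [ins, splitSum_left fun a x y => splitSum_eq_zero fun _ _ _ => by
    rw [h _ _ _ (Or.inl (by simp)), smul_zero],
    splitSum_right fun x a y => by rw [h _ _ _ (Or.inr (by simp)), smul_zero]]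
  simp

/-- The insertion of `δ` is the sum over the positions of the argument that is replaced. -/
theorem ins_euler_cons {N : Type*} [AddCommGroup N] [Module ℂ N] {F : List Λ[T;T⁻¹] → N}
    (hF : Multilinear ℂ F) (a : Λ[T;T⁻¹]) (l : List Λ[T;T⁻¹]) :
    ins 1 (euler Λ) F (a :: l) =
      F (euler Λ [a] :: l) + ins 1 (euler Λ) (fun l => F (a :: l)) l := by
  rw [ins, splitSum_cons]
  congr 1
  · have h : ∀ y z : List Λ[T;T⁻¹], F (euler Λ (a :: y) :: z) = F ([] ++ euler Λ (a :: y) :: z) :=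
      fun _ _ => rfl
    rw [splitSum_cons, splitSum_left]
    · have : F (([] : List Λ[T;T⁻¹]) ++ euler Λ [] :: a :: l) = 0 := hF.map_zero [] _
      simp only [List.length_nil, pow_zero, one_smul, this, zero_add]
      rfl
    · intro b x y
      have : F (([] : List Λ[T;T⁻¹]) ++ euler Λ (a :: b :: x) :: y) = 0 := hF.map_zero [] _
      rw [this, smul_zero]
  · exact splitSum_congr fun x w _ => splitSum_congr fun y z _ => by simp

theorem ins_euler_ext_mono {f : List Λ → Λ} (hf : Multilinear ℂ f) (L : List (Λ × ℤ)) :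
    ins 1 (euler Λ) (ext f) (L.map mono) = (-expSum L) • mono (f (coefs L), expSum L) := by
  induction L generalizing f with
  | nil =>
    have : ext f [euler Λ []] = 0 := hf.ext.map_zero [] []
    simp [ins, splitSum_nil, this, expSum]
  | cons m L ih =>
    obtain ⟨c, n⟩ := m
    have h0 : ∀ l, ext (fun t => f (0 :: t)) l * (T n : Λ[T;T⁻¹]) = 0 := fun l => by
        rw [show (fun t => f (0 :: t)) = 0 from funext fun t => hf.map_zero [] t, ext_zero,
          Pi.zero_apply, zero_mul]
    have h1 : (fun l => ext f (mono (c, n) :: l)) = mulR (T n) (ext fun t => f (c :: t)) :=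
      funext fun l => sum_coeff_mono _ _ _ (h0 l)
    have h2 : ext f (mono ((-n) • c, n) :: L.map mono) =
        (-n) • ext f (mono (c, n) :: L.map mono) := by
      rw [mono_zsmul]; exact hf.ext.map_zsmul [] _ _ _
    have h3 := ext_map_mono hf ((c, n) :: L)
    rw [List.map_cons] at h3
    rw [List.map_cons, ins_euler_cons hf.ext, euler_mono, h1, ins_mulR, mulR, ih (hf.cons c), h2,
      h3, smul_mul_assoc, mono_mul_T, expSum_cons, add_comm (expSum L)]
    simp only [List.map_cons]
    module

/-- The extension of a cochain preserves the degree, so it commutes with the derivation `δ`. -/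
theorem ins_euler_ext {f : List Λ → Λ} (hf : Multilinear ℂ f) (s : ℤ) :
    ins s (ext f) (euler Λ) = ins 1 (euler Λ) (ext f) :=
  (multilinear_euler.ins hf.ext s).eq_of_mono (hf.ext.ins multilinear_euler 1) fun L => by
    rw [ins_euler]
    beta_reduce
    rw [ext_map_mono hf, euler_mono, ins_euler_ext_mono hf, mono_zsmul]

/-- The Leibniz rule for `δ` and `δ(ı^q) = -q ı^q`. -/
theorem euler_mul_T (a : Λ[T;T⁻¹]) (q : ℤ) :
    euler Λ [a * T q] = euler Λ [a] * T q - q • (a * T q) := by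
  have h := multilinear_euler (Λ := Λ)
  induction a using laurent_induction with
  | add a b ha hb =>
    have h1 := h.map_add [] [] a b
    have h2 := h.map_add [] [] (a * T q) (b * T q)
    simp only [List.nil_append] at h1 h2
    rw [add_mul, h1, h2, ha, hb, add_mul, smul_add]
    abel
  | hm m =>
    obtain ⟨c, n⟩ := m
    rw [mono_mul_T, euler_mono, euler_mono, mono_mul_T, mono_zsmul, mono_zsmul]
    module

/-- The Euler derivation is a cocycle. -/
theorem dH_euler : dH (euler Λ) = 0 := by
  have h := multilinear_euler (Λ := Λ)
  have hs : dH (euler Λ) = idc ⋆ euler Λ + euler Λ ⋆ idc - ins (-1) mulc (euler Λ) := by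
    rw [dH, supported_euler.sgn_eq, pow_one, zsmul_conv]
    module
  have hm : Multilinear ℂ (dH (euler Λ)) := by
    rw [hs, show idc ⋆ euler Λ + euler Λ ⋆ idc - ins (-1) mulc (euler Λ) =
      idc ⋆ euler Λ + euler Λ ⋆ idc + (-1 : ℤ) • ins (-1) mulc (euler Λ) by module]
    exact ((multilinear_idc.conv h).add (h.conv multilinear_idc)).add
      ((h.ins multilinear_mulc _).zsmul _)
  refine hm.eq_of_mono (fun _ _ => (0 : Λ[T;T⁻¹] →ₗ[ℂ] Λ[T;T⁻¹]).isLinear) fun L => ?_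
  by_cases hL : (L.map mono).length = 2
  · match L, hL with
    | [(a, m), (b, n)], _ =>
      have h1 : mono (a, m) * mono ((-n) • b, n) + mono ((-m) • a, m) * mono (b, n) -
          mono ((-(m + n)) • (a * b), m + n) = 0 := by
        rw [mono_mul, mono_mul, mul_smul_comm, smul_mul_assoc, mono_zsmul, mono_zsmul, mono_zsmul]
        module
      have e1 : ∀ x y, (idc ⋆ euler Λ) [x, y] = x * euler Λ [y] := fun x y => by
        change 0 * _ + (x * euler Λ [y] + 0 * _) = _
        simp
      have e2 : ∀ x y, (euler Λ ⋆ idc) [x, y] = euler Λ [x] * y := fun x y => by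
        change 0 * _ + (euler Λ [x] * y + 0 * _) = _
        simp
      have e3 : ∀ x y : Λ[T;T⁻¹], mulc [x, y] = x * y := fun x y => by
        change 0 * _ + (x * y + 0 * _) = _
        simp
      rw [hs, ins_euler]
      change (idc ⋆ euler Λ) [mono (a, m), mono (b, n)] + (euler Λ ⋆ idc) [mono (a, m), mono (b, n)]
        - euler Λ [mulc [mono (a, m), mono (b, n)]] = 0
      rw [e1, e2, e3, mono_mul, euler_mono, euler_mono, euler_mono, h1]
  · rw [hs, Pi.sub_apply, Pi.add_apply, supported_idc.conv supported_euler _ hL,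
      supported_euler.conv supported_idc _ hL,
      supported_mulc.ins (p := 0) h supported_euler _ _ hL]
    simp

end Laurent

/-! ### The bracket with a class of degree four -/

section DegreeFour

variable {k A : Type*} [CommRing k] [Ring A] [Algebra k A] {𝒜 : ℤ → Submodule k A}

/-- The bracket of a cochain `u` of degree `4` with a cochain `x` of degree `r`, in terms of
insertions. -/
def br (r : ℕ) (u x : List A → A) : List A → A :=
  ins ((-1) ^ (r + 1)) x u + ((-1) ^ r : ℤ) • ins (-1) u x

theorem neg_one_pow_four_add_one : (-1 : ℤ) ^ (4 + 1) = -1 := by norm_num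

theorem bracket_four {r : ℕ} {u x : List A → A} (hu : Multilinear k u) (hx : Multilinear k x)
    (hu' : Supported 4 u) (hx' : Supported r x) : bracket 4 r u x = br r u x := by
  rw [bracket_eq_ins hu hx hu' hx', neg_one_pow_four_add_one, br,
    show ((-1 : ℤ)) ^ ((4 + 1) * (r + 1)) = -(-1) ^ r by rw [pow_mul]; norm_num [pow_succ]]
  module

theorem HC.br {r : ℕ} {b c : ℤ} {u x : List A → A} (hu : u ∈ HC k 𝒜 4 b)
    (hx : x ∈ HC k 𝒜 (r + 1) c) : br (r + 1) u x ∈ HC k 𝒜 (r + 4) (b + c) := by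
  refine HC.add ?_ (HC.zsmul ?_ _)
  · have := HC.ins hu hx ((-1) ^ (r + 1 + 1))
    rwa [show 3 + (r + 1) = r + 4 by omega] at this
  · have := HC.ins hx hu (-1)
    rwa [add_comm c] at this

theorem ins_right_zero (s : ℤ) (g : List A → A) : ins s g (0 : List A → A) = 0 := by
  simpa using ins_zsmul_right s 0 g (0 : List A → A)

theorem sgn_neg_one_four {u : List A → A} (hu : Supported 4 u) : sgn (-1) u = u := by
  rw [hu.sgn_eq]; norm_num

/-- The coboundary of `[u, x]` for a cocycle `u`; the cup products in the homotopies for `x` and `u`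
cancel. -/
theorem dH_br_aux {r : ℕ} {b c : ℤ} {u x : List A → A} (hu : u ∈ HC k 𝒜 4 b) (hu' : dH u = 0)
    (hx : x ∈ HC k 𝒜 r c) :
    dH (br r u x) = ins (-(-1) ^ (r + 1)) (dH x) u - ((-1) ^ r : ℤ) • ins (-1) u (dH x) := by
  have h1 := dH_ins (s := (-1) ^ (r + 1)) hx.2.1 hu.2.1 rfl hu.1
  have h2 := dH_ins (s := -1) hu.2.1 hx.2.1 (by norm_num) hx.1
  have hX : Multilinear k x := hx.1
  rw [hu', ins_right_zero, smul_zero, zero_add, pow_mul] at h1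
  rw [hu', ins_zero hX, add_zero, mul_comm r, pow_mul] at h2
  rw [br, dH_add, dH_zsmul, h1, h2, pow_succ, show ((-1 : ℤ) ^ 4) ^ r = 1 by norm_num]
  module

theorem dH_br {r : ℕ} {b c : ℤ} {u x : List A → A} (hu : u ∈ HC k 𝒜 4 b) (hu' : dH u = 0)
    (hx : x ∈ HC k 𝒜 r c) (hx' : dH x = 0) : dH (br r u x) = 0 := by
  have hU : Multilinear k u := hu.1
  rw [dH_br_aux hu hu' hx, hx', ins_right_zero, ins_zero hU, smul_zero, sub_zero]

/-- The bracket with a cocycle preserves coboundaries. -/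
theorem HB.br {r : ℕ} {b c : ℤ} {u f : List A → A} (hu : u ∈ HC k 𝒜 4 b) (hu' : dH u = 0)
    (hf : f ∈ HB k 𝒜 (r + 2) c) : br (r + 2) u f ∈ HB k 𝒜 (r + 5) (b + c) := by
  obtain ⟨w, hw, rfl⟩ := mem_HB_succ.1 hf
  have h : Hoch.br (r + 2) u (dH w) = dH (Hoch.br (r + 1) u w) := by
    rw [dH_br_aux hu hu' hw, Hoch.br, pow_succ _ (r + 1), pow_succ _ (r + 2), pow_succ _ (r + 1),
      show -((-1 : ℤ) ^ (r + 1) * -1) = (-1) ^ (r + 1) by ring,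
      show (-1 : ℤ) ^ (r + 1) * -1 * -1 = (-1) ^ (r + 1) by ring]
    module
  rw [h]
  exact dH_mem_HB (HC.br hu hw) rfl

theorem br_add (r : ℕ) {u : List A → A} (hu : Multilinear k u) (x y : List A → A) :
    br r u (x + y) = br r u x + br r u y := by
  rw [br, ins_add_left hu, show ins (-1) u (x + y) = ins (-1) u x + ins (-1) u y from
    ins_add _ _ _ _, br, br]
  module

theorem br_zsmul (r : ℕ) {u : List A → A} (hu : Multilinear k u) (n : ℤ) (x : List A → A) :
    br r u (n • x) = n • br r u x := by
  rw [br, ins_zsmul_left hu, ins_zsmul_right, br]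
  module

/-- If `[u, u] = 0`, then `[u, u x] = u [u, x]`. -/
theorem br_conv_self {r : ℕ} {b c : ℤ} {u x : List A → A} (h𝒜 : IsMultiplicative 𝒜)
    (hu : u ∈ HC k 𝒜 4 b) (hu' : dH u = 0)
    (huu : br 4 u u ∈ HB k 𝒜 7 (b + b)) (hx : x ∈ HC k 𝒜 r c) (hx' : dH x = 0) :
    br (4 + r) u (u ⋆ x) - u ⋆ br r u x ∈ HB k 𝒜 (r + 7) (b + b + c) := by
  have h1 := ins_conv_mem_HB (m := r + 7) hu hu' hu hu' hx hx' (by omega)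
  have h2 : br 4 u u ⋆ x ∈ HB k 𝒜 (r + 7) (b + b + c) := HB.conv h𝒜 huu hx hx' (by omega)
  have h3 : ((-1 : ℤ) ^ (4 + r)) = (-1) ^ r := by rw [pow_add]; norm_num
  have h4 : ((-1 : ℤ) ^ (4 + r + 1)) = (-1) ^ (r + 1) := by rw [pow_succ, h3, pow_succ]
  have h5 : br 4 u u = (2 : ℤ) • ins (-1) u u := by
    rw [br, neg_one_pow_four_add_one, show (-1 : ℤ) ^ 4 = 1 by norm_num]
    module
  rw [neg_one_pow_four_add_one] at h1
  have h6 : br (4 + r) u (u ⋆ x) - u ⋆ br r u x =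
      (ins ((-1) ^ (4 + r + 1)) (u ⋆ x) u - u ⋆ ins ((-1) ^ (r + 1)) x u
        - ((-1) ^ r : ℤ) • (ins (-1) u u ⋆ x)) + ((-1) ^ r : ℤ) • (br 4 u u ⋆ x) := by
    rw [h5, br, br, ins_conv, sgn_neg_one_four hu.2.1, h3, conv_add, conv_zsmul, zsmul_conv]
    module
  rw [h6]
  exact HB.add h1 (HB.zsmul h2 _)

end DegreeFour

/-! ### Restriction to `Λ` -/

section Laurent

open LaurentPolynomial

variable {Λ : Type*} [Ring Λ] [Algebra ℂ Λ]

/-- The coefficient of `ıⁿ` in the restriction of a cochain of `Λ[ı^{±1}]` to `Λ`. -/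
def res (n : ℤ) (F : List Λ[T;T⁻¹] → Λ[T;T⁻¹]) (l : List Λ) : Λ := (F (l.map C)).coeff n

theorem res_add (n : ℤ) (F G : List Λ[T;T⁻¹] → Λ[T;T⁻¹]) : res n (F + G) = res n F + res n G := rfl

theorem res_zsmul (n j : ℤ) (F : List Λ[T;T⁻¹] → Λ[T;T⁻¹]) : res n (j • F) = j • res n F := by
  ext1 l
  simp only [res, Pi.smul_apply, AddMonoidAlgebra.coeff_smul, Finsupp.smul_apply]

theorem res_sub (n : ℤ) (F G : List Λ[T;T⁻¹] → Λ[T;T⁻¹]) : res n (F - G) = res n F - res n G := by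
  rw [show F - G = F + (-1 : ℤ) • G by module, res_add, res_zsmul]
  module

theorem coeff_splitSum {B : Type*} (Φ : List B → List B → Λ[T;T⁻¹]) (l : List B) (n : ℤ) :
    (splitSum Φ l).coeff n = splitSum (fun x y => (Φ x y).coeff n) l :=
  map_splitSum (AddMonoidHom.mk' (fun a : Λ[T;T⁻¹] => a.coeff n) fun _ _ => rfl) Φ l

theorem ext_map_C {f : List Λ → Λ} (hf : Multilinear ℂ f) (l : List Λ) :
    ext f (l.map C) = C (f l) := by
  have := ext_map_mono hf (l.map fun c => (c, 0))
  have h1 : (fun c : Λ => mono (c, 0)) = C := funext fun c => (C_eq_mono c).symm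
  have h2 : expSum (l.map fun c : Λ => (c, (0 : ℤ))) = 0 := by
    simp [expSum, Function.comp_def]
  rw [List.map_map, Function.comp_def, h1, h2, ← C_eq_mono] at this
  simpa [coefs, Function.comp_def] using this

theorem res_mulR (q : ℤ) (F : List Λ[T;T⁻¹] → Λ[T;T⁻¹]) : res q (mulR (T q) F) = res 0 F := by
  ext1 l
  have := coeff_mul_T (F (l.map C)) q 0
  rwa [zero_add] at this

theorem res_ext {f : List Λ → Λ} (hf : Multilinear ℂ f) : res 0 (ext f) = f := by
  ext1 l
  rw [res, ext_map_C hf, C_apply, if_pos rfl]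

/-- Restriction commutes with the differential: the coefficient of `ıⁿ` is a homomorphism of
`Λ`-bimodules. -/
theorem res_dH (n : ℤ) (F : List Λ[T;T⁻¹] → Λ[T;T⁻¹]) : res n (dH F) = dH (res n F) := by
  have hi : ∀ l : List Λ, idc (l.map C) = C (idc l) := fun l => by
    rw [idc_eq_ext, ext_map_C multilinear_idc]
  have hm : ∀ l : List Λ, mulc (l.map C) = C (mulc l) := fun l => by
    rw [mulc_eq_ext, ext_map_C multilinear_mulc]
  rw [dH, res_sub, res_sub, dH]
  congr 1
  · congr 1
    · ext1 l
      rw [res, conv, splitSum_map, coeff_splitSum]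
      exact splitSum_congr fun x y _ => by rw [hi, coeff_C_mul]; rfl
    · ext1 l
      rw [res, conv, splitSum_map, coeff_splitSum]
      refine splitSum_congr fun x y _ => ?_
      rw [hi, coeff_mul_C, sgn, List.length_map, AddMonoidAlgebra.coeff_smul, Finsupp.smul_apply]
      rfl
  · ext1 l
    rw [res, ins, splitSum_map, coeff_splitSum]
    refine splitSum_congr fun x w _ => ?_
    rw [splitSum_map, coeff_splitSum]
    refine splitSum_congr fun y z _ => ?_
    rw [hm, List.length_map, AddMonoidAlgebra.coeff_smul, Finsupp.smul_apply, res, List.map_append,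
      List.map_cons]

theorem Multilinear.res {F : List Λ[T;T⁻¹] → Λ[T;T⁻¹]} (hF : Multilinear ℂ F) (n : ℤ) :
    Multilinear ℂ (res n F) := by
  intro l r
  refine ⟨fun a b => ?_, fun c a => ?_⟩
  · have : (C (a + b) : Λ[T;T⁻¹]) = C a + C b := _root_.map_add C a b
    simp only [Hoch.res, List.map_append, List.map_cons, this, hF.map_add]
    rfl
  · have : C (c • a) = c • C a := by
      rw [C_eq_mono, C_eq_mono, mono_eq_single, mono_eq_single]
      exact (AddMonoidAlgebra.smul_single _ _ _).symm
    simp only [Hoch.res, List.map_append, List.map_cons, this, (hF _ _).map_smul,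
      AddMonoidAlgebra.coeff_smul, Finsupp.smul_apply]

theorem res_mem_HC {F : List Λ[T;T⁻¹] → Λ[T;T⁻¹]} {p : ℕ} {b : ℤ} (hF : F ∈ HC ℂ (gr Λ) p b)
    (n : ℤ) : res n F ∈ HC ℂ (degZero Λ) p 0 :=
  mem_HC_degZero.2 ⟨Multilinear.res hF.1 n, fun l hl => by
    rw [res, hF.2.1 _ (by simpa using hl)]; rfl⟩

theorem res_mem_HB {F : List Λ[T;T⁻¹] → Λ[T;T⁻¹]} {p : ℕ} {b : ℤ} (hF : F ∈ HB ℂ (gr Λ) p b)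
    (n : ℤ) : res n F ∈ HB ℂ (degZero Λ) p 0 := by
  cases p with
  | zero => rw [show F = 0 from hF]; exact HB.zero
  | succ p =>
    obtain ⟨w, hw, rfl⟩ := mem_HB_succ.1 hF
    rw [res_dH]
    exact mem_HB_succ.2 ⟨_, res_mem_HC hw n, rfl⟩

theorem euler_map_C (l : List Λ) : euler Λ (l.map C) = 0 := by
  match l with
  | [] => rfl
  | [a] => rw [List.map_cons, List.map_nil, C_eq_mono, euler_mono, neg_zero, zero_smul, mono_zero]
  | _ :: _ :: _ => rfl

theorem conv_euler_map_C (F : List Λ[T;T⁻¹] → Λ[T;T⁻¹]) (l : List Λ) :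
    (F ⋆ euler Λ) (l.map C) = 0 := by
  rw [conv, splitSum_map]
  exact splitSum_eq_zero fun x y _ => by rw [euler_map_C, mul_zero]

/-- The derivation `δ` vanishes on `Λ`. -/
theorem res_conv_euler (n : ℤ) (F : List Λ[T;T⁻¹] → Λ[T;T⁻¹]) : res n (F ⋆ euler Λ) = 0 := by
  ext1 l
  rw [res, conv_euler_map_C]
  rfl

theorem res_ins_conv_euler {F : List Λ[T;T⁻¹] → Λ[T;T⁻¹]} (hF : Multilinear ℂ F) (s : ℤ)
    (G : List Λ[T;T⁻¹] → Λ[T;T⁻¹]) (n : ℤ) : res n (ins s (G ⋆ euler Λ) F) = 0 := by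
  ext1 l
  rw [res, ins, splitSum_map, splitSum_eq_zero]
  · rfl
  · intro x w _
    rw [splitSum_map]
    exact splitSum_eq_zero fun y z _ => by rw [conv_euler_map_C, hF.map_zero, smul_zero]

end Laurent

/-! ### The cochains `(x + y δ) ı^q` and `δ x ı^q` -/

section Cup

variable {A : Type*} [Ring A]

theorem conv_const (f : List A → A) (c : A) : f ⋆ const c = mulR c f :=
  funext fun l => splitSum_right (fun _ _ _ => mul_zero _) l

theorem cup_const {p : ℕ} {f : List A → A} (hf : Supported p f) (c : A) :
    cup f (const c) = mulR c f := by
  rw [cup_eq_conv hf (supported_const c), mul_zero, pow_zero, one_smul, conv_const]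

theorem cup_four {r : ℕ} {u f : List A → A} (hu : Supported 4 u) (hf : Supported r f) :
    cup u f = u ⋆ f := by
  rw [cup_eq_conv hu hf, pow_mul, show (-1 : ℤ) ^ 4 = 1 by norm_num, one_pow, one_smul]

theorem Supported.add {r : ℕ} {f g : List A → A} (hf : Supported r f) (hg : Supported r g) :
    Supported r (f + g) := fun l hl => by rw [Pi.add_apply, hf l hl, hg l hl, add_zero]

end Cup

section Laurent

open LaurentPolynomial

variable {Λ : Type*} [Ring Λ] [Algebra ℂ Λ]

/-- The cochain `(x + c y δ) ı^q`, in terms of the unsigned convolution product; the sign of the cup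
product `y δ` is `c = (-1) ^ |y|`. -/
def tot (c : ℤ) (x y : List Λ → Λ) (q : ℤ) : List Λ[T;T⁻¹] → Λ[T;T⁻¹] :=
  mulR (T q) (ext x + c • (ext y ⋆ euler Λ))

theorem total_eq_tot {n : ℕ} {x y : List Λ → Λ} (hx : Supported (n + 1) x) (hy : Supported n y)
    (q : ℤ) : total x y q = tot ((-1) ^ n) x y q := by
  rw [total, cup_eq_conv hy.ext supported_euler, mul_one]
  exact cup_const (hx.ext.add ((hy.ext.conv supported_euler).zsmul _)) _

theorem eulerMul_eq_mulR {r : ℕ} {x : List Λ → Λ} (hx : Supported r x) (q : ℤ) :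
    eulerMul x q = mulR (T q) (((-1) ^ r : ℤ) • (euler Λ ⋆ ext x)) := by
  rw [eulerMul, cup_eq_conv supported_euler hx.ext, one_mul]
  exact cup_const ((supported_euler.conv hx.ext).zsmul _) _

theorem T_mem_gr (q : ℤ) : (T q : Λ[T;T⁻¹]) ∈ gr Λ (-2 * q) := by
  have := mono_mem_gr (1 : Λ) q
  rwa [mono, map_one, one_mul] at this

theorem HC.mulR_T {F : List Λ[T;T⁻¹] → Λ[T;T⁻¹]} {p : ℕ} (hF : F ∈ HC ℂ (gr Λ) p 0) (q : ℤ) :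
    Hoch.mulR (T q) F ∈ HC ℂ (gr Λ) p (-2 * q) := by
  have := HC.mulR isMultiplicative_gr hF (T_mem_gr q)
  rwa [zero_add] at this

theorem HB.mulR_T {F : List Λ[T;T⁻¹] → Λ[T;T⁻¹]} {p : ℕ} (hF : F ∈ HB ℂ (gr Λ) (p + 1) 0)
    (q : ℤ) : Hoch.mulR (T q) F ∈ HB ℂ (gr Λ) (p + 1) (-2 * q) := by
  have := HB.mulR isMultiplicative_gr hF (T_mem_gr q) (T_central q)
  rwa [zero_add] at this

theorem tot_mem_HC {n : ℕ} {x y : List Λ → Λ} (hx : x ∈ HC ℂ (degZero Λ) (n + 1) 0)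
    (hy : y ∈ HC ℂ (degZero Λ) n 0) (c q : ℤ) :
    tot c x y q ∈ HC ℂ (gr Λ) (n + 1) (-2 * q) := by
  rw [mem_HC_degZero] at hx hy
  refine HC.mulR_T (HC.add (ext_mem_HC hx.1 hx.2) (HC.zsmul ?_ _)) q
  have := HC.conv isMultiplicative_gr (ext_mem_HC hy.1 hy.2) (euler_mem_HC (Λ := Λ))
  rwa [zero_add] at this

theorem tot_sub (c : ℤ) (x y x' y' : List Λ → Λ) (q : ℤ) :
    tot c x y q - tot c x' y' q = tot c (x - x') (y - y') q := by
  rw [tot, tot, tot, ← mulR_sub, ext_sub, ext_sub, sub_conv, smul_sub]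
  congr 1
  abel

theorem conv_tot {u x y : List Λ → Λ} (hu : Multilinear ℂ u) (hx : Multilinear ℂ x)
    (hy : Multilinear ℂ y) (c q : ℤ) : ext u ⋆ tot c x y q = tot c (u ⋆ x) (u ⋆ y) q := by
  rw [tot, tot, conv_mulR, conv_add, conv_zsmul, ← conv_assoc, ext_conv hu hx, ext_conv hu hy]

/-- If `x` and `y` are coboundaries, then so is `(x + y δ) ı^q`. -/
theorem tot_mem_HB {n : ℕ} {x y : List Λ → Λ} (hx : x ∈ HB ℂ (degZero Λ) (n + 2) 0)
    (hy : y ∈ HB ℂ (degZero Λ) (n + 1) 0) (c q : ℤ) :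
    tot c x y q ∈ HB ℂ (gr Λ) (n + 2) (-2 * q) := by
  refine HB.mulR_T (HB.add (ext_mem_HB hx) (HB.zsmul ?_ _)) q
  have := HB.conv (m := n + 2) isMultiplicative_gr (ext_mem_HB hy) (euler_mem_HC (Λ := Λ)) dH_euler
    (by omega)
  rwa [zero_add] at this

theorem res_tot {x : List Λ → Λ} (hx : Multilinear ℂ x) (y : List Λ → Λ) (c q : ℤ) :
    res q (tot c x y q) = x := by
  rw [tot, res_mulR, res_add, res_zsmul, res_conv_euler, smul_zero, add_zero, res_ext hx]

theorem ext_br {u x : List Λ → Λ} (hu : Multilinear ℂ u) (hx : Multilinear ℂ x) (r : ℕ) :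
    ext (br r u x) = br r (ext u) (ext x) := by
  rw [br, ext_add, ext_zsmul, ← ext_ins hu hx, ← ext_ins hx hu, br]

/-- The derivation `δ` multiplies `ı` by `-1`. -/
theorem ins_mulR_T_euler {f : List Λ → Λ} (hf : Multilinear ℂ f) (s : ℤ) :
    ins s (mulR (T 1) (ext f)) (euler Λ) =
      mulR (T 1) (ins 1 (euler Λ) (ext f) - ext f) := by
  rw [mulR_sub, ← ins_euler_ext hf s, ins_euler, ins_euler]
  ext1 l
  rw [mulR, euler_mul_T, one_smul]
  rfl

theorem sgn_neg_one_euler : sgn (-1) (euler Λ) = -euler Λ := by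
  rw [supported_euler.sgn_eq, pow_one, neg_one_smul]

/-- The bracket `[u ı, δ x ı^q]` is cohomologous to `(u x ± δ [u, x]) ı^{q + 1}`. -/
theorem bracket_eulerMul_mem_HB {r : ℕ} {u x : List Λ → Λ} (hu : u ∈ HC ℂ (degZero Λ) 4 0)
    (hu' : dH u = 0) (hx : x ∈ HC ℂ (degZero Λ) r 0) (hx' : dH x = 0) (q : ℤ) :
    bracket 4 (r + 1) (mulR (T 1) (ext u)) (eulerMul x q) - mulR (T (q + 1))
        (ext (u ⋆ x) + ((-1) ^ r : ℤ) • (euler Λ ⋆ ext (br r u x)))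
      ∈ HB ℂ (gr Λ) (r + 4) (-2 * (q + 1)) := by
  rw [mem_HC_degZero] at hu hx
  have hU := ext_mem_HC hu.1 hu.2
  have hX := ext_mem_HC hx.1 hx.2
  have hU' : dH (ext u) = 0 := by rw [dH_ext hu.1, hu', ext_zero]
  have hX' : dH (ext x) = 0 := by rw [dH_ext hx.1, hx', ext_zero]
  -- The product `δ x` is inserted into `u` by the Leibniz rule up to a coboundary, while `u` is
  -- inserted into `δ x` by the Leibniz rule on cochains; the term `u x` in `e1` comes from
  -- `[δ, ı] = -ı`.
  have key := HB.mulR_T (HB.zsmul (ins_conv_mem_HB (m := r + 4) hU hU' (euler_mem_HC (Λ := Λ))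
    dH_euler hX hX' (by omega)) ((-1) ^ r)) (q + 1)
  have hδX := (HC.conv isMultiplicative_gr (euler_mem_HC (Λ := Λ)) hX)
  have hW := HC.mulR_T hU 1
  have hV := HC.mulR_T (HC.zsmul hδX ((-1) ^ r)) q
  rw [eulerMul_eq_mulR hx.2, bracket_four hW.1 hV.1 hW.2.1 (by rw [add_comm r]; exact hV.2.1)]
  convert key using 1
  have e1 : ins (-1) (mulR (T 1) (ext u)) (euler Λ ⋆ ext x) =
      mulR (T 1) (ins 1 (euler Λ) (ext u) ⋆ ext x - ext u ⋆ ext x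
        - euler Λ ⋆ ins (-1) (ext u) (ext x)) := by
    rw [ins_conv, ins_mulR_T_euler hu.1, ins_mulR_T hx.1, conv_mulR, mulR_conv (T_central 1),
      sgn_neg_one_euler, neg_conv, sub_conv, ← mulR_add, sub_eq_add_neg _ (_ ⋆ ins _ _ _)]
  have e2 : ((-1 : ℤ) ^ r * (-1) ^ r) = 1 := neg_one_pow_mul_self r
  rw [br, ins_mulR, ins_mulR_T hu.1, ins_mulR, ins_zsmul_left hU.1, ins_zsmul_right, e1]
  simp only [← mulR_zsmul, ← mulR_add, ← mulR_sub, mulR_mulR, ← T_add, add_comm 1 q]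
  rw [ext_br hu.1 hx.1, br, ← ext_conv hu.1 hx.1, conv_add, conv_zsmul]
  congr 1
  rw [show (-1 : ℤ) ^ (r + 1 + 1) = (-1) ^ r by ring,
    show (-1 : ℤ) ^ (1 + r + 1) = (-1) ^ r by ring,
    show (-1 : ℤ) ^ (1 + 1) = 1 by norm_num]
  simp only [smul_add, smul_sub, smul_smul, e2, pow_succ, mul_neg_one, neg_mul]
  module

theorem ins_euler_map_C {f : List Λ → Λ} (hf : Multilinear ℂ f) (l : List Λ) :
    ins 1 (euler Λ) (ext f) (l.map C) = 0 := by
  rw [← ins_euler_ext hf 1, ins_euler]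
  change euler Λ [ext f (l.map C)] = 0
  rw [ext_map_C hf]
  exact euler_map_C [f l]

theorem res_conv_ins_euler {f : List Λ → Λ} (hf : Multilinear ℂ f) (n : ℤ)
    (G : List Λ[T;T⁻¹] → Λ[T;T⁻¹]) : res n (G ⋆ ins 1 (euler Λ) (ext f)) = 0 := by
  ext1 l
  rw [res, conv, splitSum_map, splitSum_eq_zero]
  · rfl
  · intro x y _
    rw [ins_euler_map_C hf, mul_zero]

/-- The restriction of `[u ı, (x + y δ) ı^q]` to `Λ` is `([u, x] ± y u) ı^{q + 1}`. -/
theorem res_bracket_tot {n : ℕ} {u x y : List Λ → Λ} (hu : u ∈ HC ℂ (degZero Λ) 4 0)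
    (hx : x ∈ HC ℂ (degZero Λ) (n + 1) 0) (hy : y ∈ HC ℂ (degZero Λ) n 0) (q : ℤ) :
    res (q + 1) (bracket 4 (n + 1) (mulR (T 1) (ext u)) (tot ((-1) ^ n) x y q)) =
      br (n + 1) u x + ((-1) ^ n : ℤ) • (y ⋆ u) := by
  have hV := tot_mem_HC hx hy ((-1) ^ n) q
  rw [mem_HC_degZero] at hu hx hy
  have hU := ext_mem_HC hu.1 hu.2
  have hW := HC.mulR_T hU 1
  rw [bracket_four hW.1 hV.1 hW.2.1 hV.2.1]
  have e1 : ins (-1) (mulR (T 1) (ext u)) (ext y ⋆ euler Λ) =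
      mulR (T 1) (ins (-1) (ext u) (ext y) ⋆ euler Λ
        + ((-1) ^ n : ℤ) • (ext y ⋆ ins 1 (euler Λ) (ext u) - ext y ⋆ ext u)) := by
    rw [ins_conv, ins_mulR_T_euler hu.1, ins_mulR_T hy.1, conv_mulR, mulR_conv (T_central 1),
      hy.2.ext.sgn_eq, zsmul_conv, conv_sub, mulR_add]
  have e2 : ((-1 : ℤ) ^ n * (-1) ^ n) = 1 := neg_one_pow_mul_self n
  rw [br, tot, ins_mulR, ins_mulR_T hu.1, ins_mulR, ins_add_left hU.1, ins_zsmul_left hU.1,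
    show ∀ f g : List Λ[T;T⁻¹] → Λ[T;T⁻¹], ins (-1) (mulR (T 1) (ext u)) (f + g) =
      ins (-1) (mulR (T 1) (ext u)) f + ins (-1) (mulR (T 1) (ext u)) g from
      fun f g => ins_add _ _ _ _, ins_zsmul_right, e1, ins_mulR_T hx.1]
  simp only [← mulR_zsmul, ← mulR_add, mulR_mulR, ← T_add, add_comm 1 q, res_mulR]
  simp only [res_add, res_zsmul, res_sub, res_conv_euler, res_conv_ins_euler hu.1,
    res_ins_conv_euler hU.1, ext_ins hu.1 hx.1, ext_ins hx.1 hu.1, ext_conv hy.1 hu.1,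
    res_ext (hu.1.ins hx.1 _), res_ext (hx.1.ins hu.1 _), res_ext (hy.1.conv hu.1)]
  rw [br]
  simp only [smul_add, smul_sub, smul_zero, smul_smul, e2, pow_succ, mul_neg_one, neg_mul]
  module

end Laurent

/-! ### The `δ`-component of a class -/

section DeltaPart

open LaurentPolynomial

variable {Λ : Type*} [Ring Λ] [Algebra ℂ Λ]

theorem HB.sub_comm {k A : Type*} [CommRing k] [Ring A] [Algebra k A] {𝒜 : ℤ → Submodule k A}
    {n : ℕ} {b : ℤ} {f g : List A → A} (h : f - g ∈ HB k 𝒜 n b) : g - f ∈ HB k 𝒜 n b := by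
  have := HB.zsmul h (-1)
  rwa [neg_one_smul, neg_sub] at this

theorem HB.conv_ext {n r m : ℕ} {b : ℤ} {f : List Λ[T;T⁻¹] → Λ[T;T⁻¹]} {g : List Λ → Λ}
    (hf : f ∈ HB ℂ (gr Λ) (n + 1) b) (hg : g ∈ HC ℂ (degZero Λ) r 0) (hg' : dH g = 0)
    (hm : m = n + r + 1) : ext g ⋆ f ∈ HB ℂ (gr Λ) m b := by
  rw [mem_HC_degZero] at hg
  have := HB.conv_left isMultiplicative_gr hf (ext_mem_HC hg.1 hg.2)
    (by rw [dH_ext hg.1, hg', ext_zero]) hm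
  rwa [zero_add] at this

theorem HC.conv_degZero {p r : ℕ} {f g : List Λ → Λ} (hf : f ∈ HC ℂ (degZero Λ) p 0)
    (hg : g ∈ HC ℂ (degZero Λ) r 0) : f ⋆ g ∈ HC ℂ (degZero Λ) (p + r) 0 := by
  have := HC.conv isMultiplicative_degZero hf hg
  rwa [zero_add] at this

/-- The cocycles `(a ± δ b) ı^q` and `(a' ± v δ) ı^q` are cohomologous if `a` and `a'` as well as
`b` and `± v` are. -/
theorem mulR_sub_tot_mem_HB {n : ℕ} {a a' b v : List Λ → Λ}
    (ha : a - a' ∈ HB ℂ (degZero Λ) (n + 2) 0) (hv : v ∈ HC ℂ (degZero Λ) (n + 1) 0)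
    (hv' : dH v = 0) (hb : b + ((-1) ^ (n + 1) : ℤ) • v ∈ HB ℂ (degZero Λ) (n + 1) 0) (q : ℤ) :
    mulR (T q) (ext a + ((-1) ^ (n + 2) : ℤ) • (euler Λ ⋆ ext b)) - tot ((-1) ^ (n + 1)) a' v q
      ∈ HB ℂ (gr Λ) (n + 2) (-2 * q) := by
  rw [mem_HC_degZero] at hv
  have h1 := HB.conv_left (m := n + 2) isMultiplicative_gr (ext_mem_HB hb)
    (euler_mem_HC (Λ := Λ)) dH_euler (by omega)
  have h2 := conv_comm_mem_HB (m := n + 2) (ext_mem_HC hv.1 hv.2)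
    (by rw [dH_ext hv.1, hv', ext_zero]) (euler_mem_HC (Λ := Λ)) dH_euler (by omega)
  rw [zero_add] at h1 h2
  have h3 := HB.mulR_T (HB.add (ext_mem_HB ha) (HB.add (HB.zsmul h1 ((-1) ^ (n + 2))) h2)) q
  rw [tot, ← mulR_sub]
  convert h3 using 2
  rw [ext_sub, ext_add, ext_zsmul, conv_add, conv_zsmul, mul_one, smul_add, smul_smul,
    show (-1 : ℤ) ^ (n + 2) * (-1) ^ (n + 1) = -1 by
      rw [pow_succ _ (n + 1)]; linear_combination -neg_one_pow_mul_self (n + 1)]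
  module

theorem const_one_eq_ext : (const 1 : List Λ[T;T⁻¹] → Λ[T;T⁻¹]) = ext (const 1) := by
  ext1 l
  match l with
  | [] => exact (map_one C).symm
  | a :: l =>
    rw [ext_cons, show (fun n c => ext (fun t : List Λ => const (1 : Λ) (c :: t)) l * T n) =
      fun (_ : ℤ) (_ : Λ) => (0 : Λ[T;T⁻¹]) from funext fun n => funext fun c => by
        rw [show (fun t : List Λ => const (1 : Λ) (c :: t)) = 0 from rfl, ext_zero, Pi.zero_apply,
          zero_mul]]
    exact (Finset.sum_const_zero).symm

theorem const_T_eq_mulR : (const (T 1) : List Λ[T;T⁻¹] → Λ[T;T⁻¹]) = mulR (T 1) (const 1) := by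
  ext1 l
  match l with
  | [] => exact (one_mul _).symm
  | _ :: _ => exact (zero_mul _).symm

theorem ins_const_T {f : List Λ → Λ} (hf : Multilinear ℂ f) (s : ℤ) :
    ins s (const (T 1)) (ext f) = mulR (T 1) (ext (ins s (const 1) f)) := by
  rw [const_T_eq_mulR, ins_mulR_T hf, const_one_eq_ext, ext_ins hf (multilinear_const 1)]

theorem ins_const_T_euler (s : ℤ) : ins s (const (T 1)) (euler Λ) = -const (T 1) := by
  rw [ins_euler]
  ext1 l
  match l with
  | [] =>
    have : (T 1 : Λ[T;T⁻¹]) = mono (1, 1) := by rw [mono, map_one, one_mul]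
    change euler Λ [T 1] = -T 1
    rw [this, euler_mono, neg_one_smul]
    exact map_neg (monoHom 1) 1
  | _ :: _ =>
    have := euler_mono (0 : Λ) 0
    rw [smul_zero, mono_zero] at this
    exact this.trans neg_zero.symm

/-- The `δ`-component of a cochain of `Λ[ı^{±1}]`, up to sign: the coefficient of `ı^{q + 1}` after
the insertion of `ı`, corrected by the insertion of `1` into the coefficient of `ı^q`. -/
def deltaPart (q : ℤ) (F : List Λ[T;T⁻¹] → Λ[T;T⁻¹]) : List Λ → Λ :=
  res (q + 1) (ins (-1) (const (T 1)) F) - ins (-1) (const 1) (res q F)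

/-- Inserting the central elements `ı` and `1` detects the `δ`-component on cohomology. -/
theorem deltaPart_mem_HB {m : ℕ} {b : ℤ} {F : List Λ[T;T⁻¹] → Λ[T;T⁻¹]}
    (hF : F ∈ HB ℂ (gr Λ) (m + 2) b) (q : ℤ) :
    deltaPart q F ∈ HB ℂ (degZero Λ) (m + 1) 0 := by
  obtain ⟨w, hw, rfl⟩ := mem_HB_succ.1 hF
  have hw' := res_mem_HC hw q
  have h1 : (const (T 1) : List Λ[T;T⁻¹] → Λ[T;T⁻¹]) ∈ HC ℂ (gr Λ) 0 (-2 * 1) := by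
    have : (const 1 : List Λ[T;T⁻¹] → Λ[T;T⁻¹]) ∈ HC ℂ (gr Λ) 0 0 := by
      rw [const_one_eq_ext]
      exact ext_mem_HC (multilinear_const 1) (supported_const 1)
    rw [const_T_eq_mulR]
    exact HC.mulR_T this 1
  have h2 : (const 1 : List Λ → Λ) ∈ HC ℂ (degZero Λ) 0 0 :=
    mem_HC_degZero.2 ⟨multilinear_const 1, supported_const 1⟩
  have h3 := res_mem_HC (HC.ins hw h1 (-1)) (q + 1)
  have h4 := HC.ins hw' h2 (-1)
  rw [zero_add] at h4
  have e1 := dH_ins_const (T_central 1) hw.2.1 hw.1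
  have e2 := dH_ins_const (c := (1 : Λ)) (fun a => by rw [one_mul, mul_one]) hw'.2.1 hw'.1
  rw [deltaPart, res_dH, ← neg_eq_iff_eq_neg.2 e1, ← neg_eq_iff_eq_neg.2 e2,
    ← neg_one_smul ℤ (dH (ins _ _ w)), res_zsmul, res_dH, neg_one_smul, ← neg_sub', ← dH_sub,
    ← neg_one_smul ℤ]
  exact HB.zsmul (dH_mem_HB (HC.sub h3 h4) rfl) _

/-- The `δ`-component of `(x + y δ) ı^q` is `± y`: the insertions of `ı` and `1` into `x` cancel,
and `δ(ı) = -ı` leaves `y`. -/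
theorem deltaPart_tot {n : ℕ} {x y : List Λ → Λ} (hx : Multilinear ℂ x)
    (hy : Multilinear ℂ y) (hy' : Supported n y) (c q : ℤ) :
    deltaPart q (tot c x y q) = (-(c * (-1) ^ n)) • y := by
  rw [deltaPart, res_tot hx, tot, ins_mulR, show ∀ f g : List Λ[T;T⁻¹] → Λ[T;T⁻¹],
      ins (-1) (const (T 1)) (f + g) = ins (-1) (const (T 1)) f + ins (-1) (const (T 1)) g from
      fun f g => ins_add _ _ _ _, ins_zsmul_right, ins_conv, ins_const_T hx, ins_const_T hy,
    ins_const_T_euler, conv_neg, conv_const, mulR_conv (T_central 1), hy'.ext.sgn_eq, mulR_zsmul,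
    ← neg_smul, ← mulR_zsmul, ← mulR_add, ← mulR_zsmul, ← mulR_add, mulR_mulR, ← T_add,
    add_comm 1 q, res_mulR]
  simp only [res_add, res_zsmul, res_conv_euler, res_ext hy,
    res_ext (hx.ins (multilinear_const 1) _)]
  module

/-- The cohomology of `Λ` embeds as the two components of `(x + y δ) ı^q`. -/
theorem mem_HB_of_tot_mem_HB {n : ℕ} {x y : List Λ → Λ} (hx : Multilinear ℂ x)
    (hy : y ∈ HC ℂ (degZero Λ) (n + 1) 0) {c : ℤ} (hc : c * c = 1) {q b : ℤ}
    (h : tot c x y q ∈ HB ℂ (gr Λ) (n + 2) b) :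
    x ∈ HB ℂ (degZero Λ) (n + 2) 0 ∧ y ∈ HB ℂ (degZero Λ) (n + 1) 0 := by
  rw [mem_HC_degZero] at hy
  constructor
  · have := res_mem_HB h q
    rwa [res_tot hx] at this
  · have := HB.zsmul (deltaPart_mem_HB h q) (-(c * (-1) ^ (n + 1)))
    rwa [deltaPart_tot hx hy.1 hy.2, smul_smul, neg_mul_neg, mul_mul_mul_comm, hc,
      neg_one_pow_mul_self, mul_one, one_smul] at this

end DeltaPart

/-! ### Multiplication by powers of `u` -/

section Powers

open LaurentPolynomial

variable {Λ : Type*} [Ring Λ] [Algebra ℂ Λ]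

theorem conv_iterate_tot {u : List Λ → Λ} (hu : Multilinear ℂ u) (m : ℕ) {x y : List Λ → Λ}
    (hx : Multilinear ℂ x) (hy : Multilinear ℂ y) (c q : ℤ) :
    (conv (ext u))^[m] (tot c x y q) = tot c ((conv u)^[m] x) ((conv u)^[m] y) q := by
  induction m generalizing x y with
  | zero => rfl
  | succ m ih =>
    rw [Function.iterate_succ_apply, conv_tot hu hx hy, ih (hu.conv hx) (hu.conv hy)]
    rfl

theorem conv_iterate_mem_HC {u : List Λ → Λ} (hu : u ∈ HC ℂ (degZero Λ) 4 0) (m : ℕ) {r : ℕ}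
    {x : List Λ → Λ} (hx : x ∈ HC ℂ (degZero Λ) r 0) :
    (conv u)^[m] x ∈ HC ℂ (degZero Λ) (r + 4 * m) 0 := by
  induction m generalizing x r with
  | zero => exact hx
  | succ m ih =>
    have := ih (HC.conv_degZero hu hx)
    rwa [show 4 + r + 4 * m = r + 4 * (m + 1) by ring] at this

theorem conv_iterate_sub {A : Type*} [Ring A] (u : List A → A) (m : ℕ) (x y : List A → A) :
    (conv u)^[m] (x - y) = (conv u)^[m] x - (conv u)^[m] y := by
  induction m generalizing x y with
  | zero => rfl
  | succ m ih => rw [Function.iterate_succ_apply, conv_sub, ih]; rfl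

theorem powCup_eq_iterate {A : Type*} [Ring A] {u : List A → A} (hu : Supported 4 u) (m : ℕ)
    {r : ℕ} {x : List A → A} (hx : Supported r x) : powCup u m x = (conv u)^[m] x := by
  induction m generalizing x r with
  | zero => rfl
  | succ m ih =>
    have := ih (hu.conv hx)
    rw [powCup, Function.iterate_succ_apply, cup_four hu hx]
    exact this

theorem conv_iterate_mem_HB {u : List Λ → Λ} (hu : u ∈ HC ℂ (degZero Λ) 4 0) (hu' : dH u = 0)
    (m : ℕ) {r : ℕ} {b : ℤ} {F : List Λ[T;T⁻¹] → Λ[T;T⁻¹]} (hF : F ∈ HB ℂ (gr Λ) (r + 1) b) :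
    (conv (ext u))^[m] F ∈ HB ℂ (gr Λ) (r + 1 + 4 * m) b := by
  induction m generalizing F r with
  | zero => exact hF
  | succ m ih =>
    have := ih (HB.conv_ext (m := r + 4 + 1) hF hu hu' rfl)
    rwa [show r + 4 + 1 + 4 * m = r + 1 + 4 * (m + 1) by ring] at this

/-- Multiplication by `u` is injective on Hochschild cohomology in positive degrees. -/
def MulInjective (u : List Λ → Λ) : Prop :=
  ∀ (n : ℕ) (y : List Λ → Λ), y ∈ HC ℂ (degZero Λ) (n + 1) 0 → dH y = 0 →
    u ⋆ y ∈ HB ℂ (degZero Λ) (n + 5) 0 → y ∈ HB ℂ (degZero Λ) (n + 1) 0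

/-- Multiplication by `u` maps onto Hochschild cohomology in degrees at least `5`. -/
def MulSurjective (u : List Λ → Λ) : Prop :=
  ∀ (n : ℕ) (x : List Λ → Λ), x ∈ HC ℂ (degZero Λ) (n + 5) 0 → dH x = 0 →
    ∃ x' ∈ HC ℂ (degZero Λ) (n + 1) 0, dH x' = 0 ∧ u ⋆ x' - x ∈ HB ℂ (degZero Λ) (n + 5) 0

theorem MulInjective.iterate {u : List Λ → Λ} (h : MulInjective u)
    (hu : u ∈ HC ℂ (degZero Λ) 4 0) (hu' : dH u = 0) (m : ℕ) {n : ℕ} {y : List Λ → Λ}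
    (hy : y ∈ HC ℂ (degZero Λ) (n + 1) 0) (hy' : dH y = 0)
    (hm : (conv u)^[m] y ∈ HB ℂ (degZero Λ) (n + 1 + 4 * m) 0) :
    y ∈ HB ℂ (degZero Λ) (n + 1) 0 := by
  induction m generalizing y n with
  | zero => exact hm
  | succ m ih =>
    refine h n y hy hy' (ih (n := n + 4) ?_ (dH_conv_eq_zero hu' hy') ?_)
    · have := HC.conv_degZero hu hy
      rwa [show 4 + (n + 1) = n + 4 + 1 by ring] at this
    · rwa [show n + 1 + 4 * (m + 1) = n + 4 + 1 + 4 * m by ring] at hm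

end Powers

/-! ### The bracket with `u ı` for a class acting bijectively -/

section Bijective

open LaurentPolynomial

variable {Λ : Type*} [Ring Λ] [Algebra ℂ Λ]

/-- The restriction to `Λ` of the hypothesis `[u ı, (x + y δ) ı^q] = 0` says that
`[u, x] = ± u y`. -/
theorem br_add_conv_mem_HB {n : ℕ} {u x y : List Λ → Λ} (hu : u ∈ HC ℂ (degZero Λ) 4 0)
    (hu' : dH u = 0) (hx : x ∈ HC ℂ (degZero Λ) (n + 1) 0) (hy : y ∈ HC ℂ (degZero Λ) n 0)
    (hy' : dH y = 0) {q b : ℤ}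
    (hxy : bracket 4 (n + 1) (mulR (T 1) (ext u)) (tot ((-1) ^ n) x y q) ∈
      HB ℂ (gr Λ) (n + 4) b) :
    br (n + 1) u x + ((-1) ^ n : ℤ) • (u ⋆ y) ∈ HB ℂ (degZero Λ) (n + 4) 0 := by
  have h1 := res_mem_HB hxy (q + 1)
  rw [res_bracket_tot hu hx hy] at h1
  have h2 := conv_comm_mem_HB (m := n + 4) hu hu' hy hy' (by omega)
  rw [pow_mul, show (-1 : ℤ) ^ (3 + 1) = 1 by norm_num, one_pow, one_smul, zero_add] at h2
  convert HB.sub h1 (HB.zsmul h2 ((-1) ^ n)) using 1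
  module

/-- The bracket `[u ı, δ x ı^{q - 1}]` is `u · (x + y δ) ı^q`. -/
theorem bracket_sub_conv_tot_mem_HB {n : ℕ} {u x y : List Λ → Λ}
    (hu : u ∈ HC ℂ (degZero Λ) 4 0) (hu' : dH u = 0) (hx : x ∈ HC ℂ (degZero Λ) (n + 1) 0)
    (hx' : dH x = 0) (hy : y ∈ HC ℂ (degZero Λ) n 0) (hy' : dH y = 0) {q : ℤ}
    (h : br (n + 1) u x + ((-1) ^ n : ℤ) • (u ⋆ y) ∈ HB ℂ (degZero Λ) (n + 4) 0) :
    bracket 4 (n + 2) (mulR (T 1) (ext u)) (eulerMul x (q - 1)) -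
      ext u ⋆ tot ((-1) ^ n) x y q ∈ HB ℂ (gr Λ) (n + 5) (-2 * q) := by
  have h1 := bracket_eulerMul_mem_HB hu hu' hx hx' (q - 1)
  have hv : u ⋆ y ∈ HC ℂ (degZero Λ) (n + 4) 0 := by
    have := HC.conv_degZero hu hy
    rwa [add_comm 4] at this
  have e1 : (-1 : ℤ) ^ (n + 4) = (-1) ^ n := by rw [pow_add]; norm_num
  have e2 : (-1 : ℤ) ^ (n + 5) = (-1) ^ (n + 1) := by rw [pow_succ _ (n + 4), e1, pow_succ]
  have h2 := mulR_sub_tot_mem_HB (n := n + 3) (a := u ⋆ x) (a' := u ⋆ x) (b := br (n + 1) u x)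
    (by rw [sub_self]; exact HB.zero) hv (dH_conv_eq_zero hu' hy')
    (by change _ + ((-1) ^ (n + 4) : ℤ) • _ ∈ _; rw [e1]; exact h) q
  change mulR (T q) (_ + ((-1) ^ (n + 5) : ℤ) • _) - tot ((-1) ^ (n + 4)) _ _ _ ∈ _ at h2
  rw [e1, e2] at h2
  rw [sub_add_cancel] at h1
  rw [conv_tot (mem_HC_degZero.1 hu).1 (mem_HC_degZero.1 hx).1 (mem_HC_degZero.1 hy).1]
  convert HB.add h1 h2 using 1
  abel

/-- The numerator of `[u ı, u⁻¹ δ x ı^{q - 1}]` over the denominator `u²` is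
`u² · (x + y δ) ı^q`, up to a coboundary, and it has Hochschild degree `n + 9`. -/
theorem tot_sub_bracket_mem_HB {n : ℕ} {u x y : List Λ → Λ} (hu : u ∈ HC ℂ (degZero Λ) 4 0)
    (hu' : dH u = 0) (huu : bracket 4 4 u u ∈ HB ℂ (degZero Λ) 7 0)
    (hx : x ∈ HC ℂ (degZero Λ) (n + 1) 0) (hx' : dH x = 0)
    (hy : y ∈ HC ℂ (degZero Λ) n 0) (hy' : dH y = 0) {q : ℤ}
    (h : br (n + 1) u x + ((-1) ^ n : ℤ) • (u ⋆ y) ∈ HB ℂ (degZero Λ) (n + 4) 0) :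
    ext u ⋆ (ext u ⋆ tot ((-1) ^ n) x y q) -
      (Frac.bracket (ext u) 4 (n + 2) (mulR (T 1) (ext u)) ⟨eulerMul x (q - 1), 1⟩).num
      ∈ HB ℂ (gr Λ) (n + 9) (-2 * q) ∧
    Supported (n + 9)
      (Frac.bracket (ext u) 4 (n + 2) (mulR (T 1) (ext u)) ⟨eulerMul x (q - 1), 1⟩).num := by
  have hx0 := mem_HC_degZero.1 hx
  have hu0 := mem_HC_degZero.1 hu
  have hU := ext_mem_HC hu0.1 hu0.2
  have hX := ext_mem_HC hx0.1 hx0.2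
  have hW := HC.mulR_T hU 1
  have hV : eulerMul x (q - 1) ∈ HC ℂ (gr Λ) (n + 2) (-2 * (q - 1)) := by
    have := HC.mulR_T (HC.zsmul (HC.conv isMultiplicative_gr (euler_mem_HC (Λ := Λ)) hX)
      ((-1) ^ (n + 1))) (q - 1)
    rwa [← eulerMul_eq_mulR hx0.2, add_comm 1] at this
  have hV' : dH (eulerMul x (q - 1)) = 0 := by
    have h0 : dH (ext x) = 0 := by rw [dH_ext hx0.1, hx', ext_zero]
    rw [eulerMul_eq_mulR hx0.2, dH_mulR (T_central _), dH_zsmul, dH_conv_eq_zero dH_euler h0,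
      smul_zero]
    exact funext fun l => zero_mul _
  have h1 := HB.conv_ext (m := n + 9) (bracket_sub_conv_tot_mem_HB (q := q) hu hu' hx hx' hy hy' h)
    hu hu' (by omega)
  -- The denominator does not contribute, since `[u ı, u] = [u, u] ı = 0`.
  have h2 : bracket 4 4 (mulR (T 1) (ext u)) (ext u) ∈ HB ℂ (gr Λ) 7 (-2 * 1) := by
    have := HB.mulR_T (ext_mem_HB huu) 1
    rw [bracket_four hu0.1 hu0.1 hu0.2 hu0.2, ext_br hu0.1 hu0.1] at this
    rw [bracket_four hW.1 hU.1 hW.2.1 hU.2.1]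
    convert this using 1
    rw [br, ins_mulR, ins_mulR_T hu0.1, ← mulR_zsmul, ← mulR_add, br]
  have h3 := HB.conv (m := n + 9) isMultiplicative_gr h2 hV hV' (by omega)
  rw [show -2 * 1 + -2 * (q - 1) = -2 * q by ring] at h3
  have h4 : bracket 4 (n + 2) (mulR (T 1) (ext u)) (eulerMul x (q - 1)) ∈
      HC ℂ (gr Λ) (n + 5) (-2 * 1 + -2 * (q - 1)) := by
    rw [bracket_four hW.1 hV.1 hW.2.1 hV.2.1]
    exact HC.br hW hV
  have h5 : bracket 4 4 (mulR (T 1) (ext u)) (ext u) ∈ HC ℂ (gr Λ) 7 (-2 * 1 + 0) := by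
    rw [bracket_four hW.1 hU.1 hW.2.1 hU.2.1]
    exact HC.br (r := 3) hW hU
  rw [Frac.bracket, cup_four hu0.2.ext h4.2.1, cup_eq_conv h5.2.1 hV.2.1, one_smul]
  refine ⟨?_, ?_⟩
  · convert HB.sub (HB.zsmul h3 ((-1) ^ (7 * (n + 2)))) h1 using 1
    rw [conv_sub]
    module
  · intro l hl
    dsimp only
    have e1 := hu0.2.ext.conv h4.2.1 l (by omega)
    have e2 := Supported.conv h5.2.1 hV.2.1 l (by omega)
    rw [Pi.sub_apply, Pi.smul_apply, e1, e2, smul_zero, sub_zero]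

/-- The theorem for a cocycle `u` such that multiplication by `u` is bijective on Hochschild
cohomology in positive degrees. -/
theorem solution_of_mul_bijective {u : List Λ → Λ} (hu : u ∈ HZ ℂ (degZero Λ) 4 0)
    (hinj : MulInjective u) (hsurj : MulSurjective u)
    (huu : bracket 4 4 u u ∈ HB ℂ (degZero Λ) 7 0)
    (n : ℕ) (q : ℤ) (x y : List Λ → Λ) (hx : x ∈ HZ ℂ (degZero Λ) (n + 2) 0)
    (hy : y ∈ HZ ℂ (degZero Λ) (n + 1) 0)
    (hxy : bracket 4 (n + 2) (cup (ext u) (iota Λ 1)) (total x y q) ∈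
      HB ℂ (gr Λ) (n + 5) (-2 * (q + 1))) :
    Frac.SameClass ℂ (gr Λ) (ext u) (n + 2) (-2 * q) ⟨total x y q, 0⟩
      (Frac.bracket (ext u) 4 (n + 3) (cup (ext u) (iota Λ 1)) ⟨eulerMul x (q - 1), 1⟩) ∧
    (∀ x' ∈ HZ ℂ (degZero Λ) (n + 2) 0, ∀ y' ∈ HZ ℂ (degZero Λ) (n + 1) 0,
      Frac.SameClass ℂ (gr Λ) (ext u) (n + 2) (-2 * q) ⟨total x' y' q, 0⟩
        (Frac.bracket (ext u) 4 (n + 3) (cup (ext u) (iota Λ 1)) ⟨eulerMul x (q - 1), 1⟩) →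
      SameClass ℂ (gr Λ) (n + 2) (-2 * q) (total x' y' q) (total x y q)) ∧
    ∀ r, n = r + 3 → ∃ x' ∈ HZ ℂ (degZero Λ) (r + 1) 0,
      SameClass ℂ (degZero Λ) (n + 2) 0 (cup u x') x ∧
      SameClass ℂ (gr Λ) (n + 2) (-2 * q) (total x y q)
        (bracket 4 (r + 2) (cup (ext u) (iota Λ 1)) (eulerMul x' (q - 1))) := by
  obtain ⟨hu, hu'⟩ := mem_HZ_iff.1 hu
  obtain ⟨hx, hx'⟩ := mem_HZ_iff.1 hx
  obtain ⟨hy, hy'⟩ := mem_HZ_iff.1 hy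
  have hu0 := mem_HC_degZero.1 hu
  have hx0 := mem_HC_degZero.1 hx
  have hy0 := mem_HC_degZero.1 hy
  have hWeq : cup (ext u) (iota Λ 1) = mulR (T 1) (ext u) := cup_const hu0.2.ext _
  rw [total_eq_tot hx0.2 hy0.2, hWeq] at hxy ⊢
  have hbr := br_add_conv_mem_HB hu hu' hx hy hy' hxy
  obtain ⟨hmain, hnum⟩ := tot_sub_bracket_mem_HB (q := q) hu hu' huu hx hx' hy hy' hbr
  refine ⟨⟨0, ?_⟩, ?_, ?_⟩
  · change _ - _ ∈ HB ℂ (gr Λ) (n + 10) _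
    change powCup _ 2 _ - _ ∈ _
    rw [powCup_eq_iterate hu0.2.ext 2 (tot_mem_HC hx hy _ _).2.1]
    exact hmain
  · rintro x' hx1 y' hy1 ⟨m, hm⟩
    obtain ⟨hx1, hx1'⟩ := mem_HZ_iff.1 hx1
    obtain ⟨hy1, hy1'⟩ := mem_HZ_iff.1 hy1
    have hx10 := mem_HC_degZero.1 hx1
    have hy10 := mem_HC_degZero.1 hy1
    rw [total_eq_tot hx10.2 hy10.2] at hm ⊢
    change powCup _ (m + 2) _ - powCup _ (m + 0) _ ∈ HB _ _ (n + 2 + 4 * (m + 0 + 2)) _ at hm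
    rw [powCup_eq_iterate hu0.2.ext _ (tot_mem_HC hx1 hy1 _ _).2.1,
      powCup_eq_iterate hu0.2.ext _ hnum] at hm
    -- Both numerators agree with `u^{m + 2}` times the respective class, so `u^{m + 2}` annihilates
    -- the class of `(x' - x + (y' - y) δ) ı^q`, hence its two components.
    have h1 := conv_iterate_mem_HB hu hu' m hmain
    rw [conv_iterate_sub] at h1
    change (conv (ext u))^[m] ((conv (ext u))^[2] _) - _ ∈ _ at h1
    rw [← Function.iterate_add_apply, show n + 1 + 8 + 1 + 4 * m = n + 2 + 4 * (m + 0 + 2) by ring]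
      at h1
    have h2 := HB.sub hm h1
    rw [add_zero, sub_sub_sub_cancel_right, ← conv_iterate_sub, tot_sub] at h2
    have hX := HC.sub hx1 hx
    have hY := HC.sub hy1 hy
    have hX0 := (mem_HC_degZero.1 hX).1
    rw [conv_iterate_tot hu0.1 _ hX0 (mem_HC_degZero.1 hY).1] at h2
    have hYm := conv_iterate_mem_HC hu (m + 2) hY
    have hXm := conv_iterate_mem_HC hu (m + 2) hX
    rw [show n + 1 + 4 * (m + 2) = n + 4 * (m + 2) + 1 by ring] at hYm
    rw [show n + 2 + 4 * (m + 0 + 2) = n + 4 * (m + 2) + 2 by ring] at h2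
    obtain ⟨h3, h4⟩ := mem_HB_of_tot_mem_HB (mem_HC_degZero.1 hXm).1 hYm
      (neg_one_pow_mul_self (n + 1)) h2
    rw [show n + 4 * (m + 2) + 2 = n + 1 + 1 + 4 * (m + 2) by ring] at h3
    rw [show n + 4 * (m + 2) + 1 = n + 1 + 4 * (m + 2) by ring] at h4
    have h5 := hinj.iterate hu hu' (m + 2) hX (by rw [dH_sub, hx1', hx', sub_zero]) h3
    have h6 := hinj.iterate hu hu' (m + 2) hY (by rw [dH_sub, hy1', hy', sub_zero]) h4
    rw [Hoch.SameClass, tot_sub]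
    exact tot_mem_HB h5 h6 _ _
  · rintro r rfl
    obtain ⟨x', hz, hz', hxz⟩ := hsurj r x hx hx'
    have hz0 := mem_HC_degZero.1 hz
    refine ⟨x', mem_HZ_iff.2 ⟨hz, hz'⟩, ?_, ?_⟩
    · rw [Hoch.SameClass, cup_four hu0.2 hz0.2]
      exact hxz
    have e1 : (-1 : ℤ) ^ (r + 4) = (-1) ^ r := by rw [pow_add]; norm_num
    -- `u · ([u, x'] ± y) = [u, u x'] ± u y = [u, x] ± u y = 0`, and `u` is not a zero divisor.
    have hb : br (r + 1) u x' + ((-1) ^ (r + 4) : ℤ) • y ∈ HB ℂ (degZero Λ) (r + 4) 0 := by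
      have hb1 : br (r + 1) u x' ∈ HC ℂ (degZero Λ) (r + 4) 0 := by
        have := HC.br hu hz
        rwa [zero_add] at this
      refine hinj (r + 3) _ (HC.add hb1 (HC.zsmul hy _)) ?_ ?_
      · rw [dH_add, dH_zsmul, dH_br hu hu' hz hz', hy', smul_zero, add_zero]
      · have h1 := br_conv_self isMultiplicative_degZero hu hu'
          (by rw [bracket_four hu0.1 hu0.1 hu0.2 hu0.2] at huu; exact huu) hz hz'
        have h2 := HB.br hu hu' hxz
        rw [sub_eq_add_neg, ← neg_one_smul ℤ, br_add _ hu0.1, br_zsmul _ hu0.1] at h2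
        simp only [add_zero] at h1 h2
        rw [show 4 + (r + 1) = r + 3 + 2 by ring] at h1
        convert HB.add (HB.sub h2 h1) hbr using 1
        rw [conv_add, conv_zsmul]
        module
    have h1 := bracket_eulerMul_mem_HB hu hu' hz hz' (q - 1)
    have h2 := mulR_sub_tot_mem_HB (n := r + 3) hxz hy hy' hb q
    rw [sub_add_cancel] at h1
    rw [show (-1 : ℤ) ^ (r + 3 + 2) = (-1) ^ (r + 1) by
      rw [show r + 3 + 2 = r + 1 + 4 by ring, pow_add]; norm_num] at h2
    refine HB.sub_comm ?_
    convert HB.add h1 h2 using 1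
    abel

end Bijective

/-! ### Projective resolutions and stable isomorphisms -/

section Resolution

universe v
variable {R : Type v} [Ring R]

/-- A map from a projective module into the kernel of the next map lifts along an exact pair. -/
theorem exists_lift_of_exact {P A B C : Type*} [AddCommGroup P] [Module R P] [AddCommGroup A]
    [Module R A] [AddCommGroup B] [Module R B] [AddCommGroup C] [Module R C]
    [Module.Projective R P] {f : A →ₗ[R] B} {g : B →ₗ[R] C} (hfg : Function.Exact f g)
    (h : P →ₗ[R] B) (hh : g ∘ₗ h = 0) : ∃ k : P →ₗ[R] A, f ∘ₗ k = h := by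
  have hr : ∀ x, h x ∈ LinearMap.range f := fun x => (hfg (h x)).1 (LinearMap.congr_fun hh x)
  obtain ⟨k, hk⟩ := Module.projective_lifting_property f.rangeRestrict
    (h.codRestrict (LinearMap.range f) hr) f.surjective_rangeRestrict
  exact ⟨k, LinearMap.ext fun x => congrArg Subtype.val (LinearMap.congr_fun hk x)⟩

/-- The maps `d` and `π` form a projective resolution of `M`. -/
structure IsResolution {P : ℕ → Type*} {M : Type*} [∀ n, AddCommGroup (P n)]
    [∀ n, Module R (P n)] [AddCommGroup M] [Module R M] (d : ∀ n, P (n + 1) →ₗ[R] P n)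
    (π : P 0 →ₗ[R] M) : Prop where
  projective : ∀ n, Module.Projective R (P n)
  exact : ∀ n, Function.Exact (d (n + 1)) (d n)
  exact_zero : Function.Exact (d 0) π
  surjective : Function.Surjective π

variable {P Q : ℕ → Type*} {M N : Type v} [∀ n, AddCommGroup (P n)] [∀ n, Module R (P n)]
  [∀ n, AddCommGroup (Q n)] [∀ n, Module R (Q n)] [AddCommGroup M] [Module R M]
  [AddCommGroup N] [Module R N] {dP : ∀ n, P (n + 1) →ₗ[R] P n} {dQ : ∀ n, Q (n + 1) →ₗ[R] Q n}
  {πP : P 0 →ₗ[R] M} {πQ : Q 0 →ₗ[R] N}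

theorem IsResolution.comp_eq_zero (hP : IsResolution dP πP) (n : ℕ) : dP n ∘ₗ dP (n + 1) = 0 :=
  (hP.exact n).linearMap_comp_eq_zero

/-- The first step in the construction of a homotopy: an endomorphism of the resolution that lifts
a map factoring through a projective module is, up to a map factoring through `π`, homotopic to
zero. -/
theorem IsResolution.homotopy_zero (hP : IsResolution dP πP) {e : M →ₗ[R] M}
    (he : FactorsThroughProjective e) {a : P 0 →ₗ[R] P 0} {b : P 1 →ₗ[R] P 1}
    (ha : πP ∘ₗ a = e ∘ₗ πP) (hb : dP 0 ∘ₗ b = a ∘ₗ dP 0) :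
    ∃ (s : P 0 →ₗ[R] P 1) (t : P 1 →ₗ[R] P 2), b = dP 1 ∘ₗ t + s ∘ₗ dP 0 := by
  obtain ⟨S, _, _, _, g, h, rfl⟩ := he
  have := hP.projective 0
  have := hP.projective 1
  obtain ⟨h', rfl⟩ := Module.projective_lifting_property πP h hP.surjective
  obtain ⟨s, hs⟩ := exists_lift_of_exact hP.exact_zero (a - h' ∘ₗ g ∘ₗ πP)
    (by rw [LinearMap.comp_sub, ha]; exact sub_self _)
  have h0 : πP ∘ₗ dP 0 = 0 := hP.exact_zero.linearMap_comp_eq_zero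
  obtain ⟨t, ht⟩ := exists_lift_of_exact (hP.exact 0) (b - s ∘ₗ dP 0) (by
    rw [LinearMap.comp_sub, hb, ← LinearMap.comp_assoc, hs, LinearMap.sub_comp,
      LinearMap.comp_assoc, LinearMap.comp_assoc, h0, LinearMap.comp_zero, LinearMap.comp_zero,
      sub_zero, sub_self])
  exact ⟨s, t, by rw [ht]; abel⟩

theorem IsResolution.homotopy_succ (hP : IsResolution dP πP) {n : ℕ} {b : P (n + 1) →ₗ[R] P (n + 1)}
    {c : P (n + 2) →ₗ[R] P (n + 2)} {s : P n →ₗ[R] P (n + 1)} {t : P (n + 1) →ₗ[R] P (n + 2)}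
    (h : b = dP (n + 1) ∘ₗ t + s ∘ₗ dP n) (hc : dP (n + 1) ∘ₗ c = b ∘ₗ dP (n + 1)) :
    ∃ t' : P (n + 2) →ₗ[R] P (n + 3), c = dP (n + 2) ∘ₗ t' + t ∘ₗ dP (n + 1) := by
  have := hP.projective (n + 2)
  obtain ⟨t', ht'⟩ := exists_lift_of_exact (hP.exact (n + 1)) (c - t ∘ₗ dP (n + 1)) (by
    rw [LinearMap.comp_sub, hc, h, LinearMap.add_comp, LinearMap.comp_assoc (dP _) (dP _) s,
      hP.comp_eq_zero, LinearMap.comp_zero, add_zero, LinearMap.comp_assoc, sub_self])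
  exact ⟨t', by rw [ht']; abel⟩

/-- A chain map `f` of projective resolutions that lifts a stable isomorphism has a homotopy
inverse in positive degrees. -/
theorem IsResolution.exists_homotopy_inverse (hP : IsResolution dP πP) (hQ : IsResolution dQ πQ)
    {φ : N →ₗ[R] M} (hφ : IsStableIso φ) {f : ∀ n, Q n →ₗ[R] P n}
    (hf : ∀ n, dP n ∘ₗ f (n + 1) = f n ∘ₗ dQ n) (hf0 : πP ∘ₗ f 0 = φ ∘ₗ πQ) (n : ℕ) :
    ∃ (a : P n →ₗ[R] Q n) (b : P (n + 1) →ₗ[R] Q (n + 1)), dQ n ∘ₗ b = a ∘ₗ dP n ∧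
      (∃ (s : P n →ₗ[R] P (n + 1)) (t : P (n + 1) →ₗ[R] P (n + 2)),
        f (n + 1) ∘ₗ b - LinearMap.id = dP (n + 1) ∘ₗ t + s ∘ₗ dP n) ∧
      ∃ (s : Q n →ₗ[R] Q (n + 1)) (t : Q (n + 1) →ₗ[R] Q (n + 2)),
        b ∘ₗ f (n + 1) - LinearMap.id = dQ (n + 1) ∘ₗ t + s ∘ₗ dQ n := by
  induction n with
  | zero =>
    obtain ⟨g, hg1, hg2⟩ := hφ
    have := hP.projective 0
    have := hP.projective 1
    obtain ⟨a, ha⟩ := Module.projective_lifting_property πQ (g ∘ₗ πP) hQ.surjective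
    obtain ⟨b, hb⟩ := exists_lift_of_exact hQ.exact_zero (a ∘ₗ dP 0) (by
      rw [← LinearMap.comp_assoc, ha, LinearMap.comp_assoc,
        hP.exact_zero.linearMap_comp_eq_zero, LinearMap.comp_zero])
    refine ⟨a, b, hb, hP.homotopy_zero (a := f 0 ∘ₗ a - LinearMap.id) hg1 ?_ ?_,
      hQ.homotopy_zero (a := a ∘ₗ f 0 - LinearMap.id) hg2 ?_ ?_⟩
    · rw [LinearMap.comp_sub, LinearMap.sub_comp, ← LinearMap.comp_assoc, hf0, LinearMap.comp_assoc,
        ha]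
      rfl
    · rw [LinearMap.comp_sub, LinearMap.sub_comp, ← LinearMap.comp_assoc, hf, LinearMap.comp_assoc,
        hb]
      rfl
    · rw [LinearMap.comp_sub, LinearMap.sub_comp, ← LinearMap.comp_assoc, ha, LinearMap.comp_assoc,
        hf0]
      rfl
    · rw [LinearMap.comp_sub, LinearMap.sub_comp, ← LinearMap.comp_assoc, hb, LinearMap.comp_assoc,
        hf]
      rfl
  | succ n ih =>
    obtain ⟨a, b, hab, ⟨s, t, hst⟩, s', t', hst'⟩ := ih
    have := hP.projective (n + 2)
    obtain ⟨c, hc⟩ := exists_lift_of_exact (hQ.exact n) (b ∘ₗ dP (n + 1)) (by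
      rw [← LinearMap.comp_assoc, hab, LinearMap.comp_assoc, hP.comp_eq_zero,
        LinearMap.comp_zero])
    refine ⟨b, c, hc, ⟨t, hP.homotopy_succ hst ?_⟩, t', hQ.homotopy_succ hst' ?_⟩
    · rw [LinearMap.comp_sub, LinearMap.sub_comp, ← LinearMap.comp_assoc, hf, LinearMap.comp_assoc,
        hc]
      rfl
    · rw [LinearMap.comp_sub, LinearMap.sub_comp, ← LinearMap.comp_assoc, hc, LinearMap.comp_assoc,
        hf]
      rfl

/-- Cohomology in positive degrees is invariant under stable isomorphisms: injectivity. -/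
theorem IsResolution.exists_factor_of_comp (hP : IsResolution dP πP) (hQ : IsResolution dQ πQ)
    {φ : N →ₗ[R] M} (hφ : IsStableIso φ) {f : ∀ n, Q n →ₗ[R] P n}
    (hf : ∀ n, dP n ∘ₗ f (n + 1) = f n ∘ₗ dQ n) (hf0 : πP ∘ₗ f 0 = φ ∘ₗ πQ) {n : ℕ}
    {L : Type*} [AddCommGroup L] [Module R L] {y : P (n + 1) →ₗ[R] L} (hy : y ∘ₗ dP (n + 1) = 0)
    {z : Q n →ₗ[R] L} (hz : y ∘ₗ f (n + 1) = z ∘ₗ dQ n) : ∃ w : P n →ₗ[R] L, y = w ∘ₗ dP n := by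
  obtain ⟨a, b, hab, ⟨s, t, hst⟩, -⟩ := hP.exists_homotopy_inverse hQ hφ hf hf0 n
  refine ⟨z ∘ₗ a - y ∘ₗ s, ?_⟩
  have h1 : y ∘ₗ (f (n + 1) ∘ₗ b - LinearMap.id) = y ∘ₗ s ∘ₗ dP n := by
    rw [hst, LinearMap.comp_add, ← LinearMap.comp_assoc, hy, LinearMap.zero_comp, zero_add]
  rw [LinearMap.comp_sub, ← LinearMap.comp_assoc, hz, LinearMap.comp_assoc, hab,
    LinearMap.comp_id] at h1
  rw [LinearMap.sub_comp, LinearMap.comp_assoc, LinearMap.comp_assoc, ← h1]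
  abel

/-- Cohomology in positive degrees is invariant under stable isomorphisms: surjectivity. -/
theorem IsResolution.exists_comp_sub (hP : IsResolution dP πP) (hQ : IsResolution dQ πQ)
    {φ : N →ₗ[R] M} (hφ : IsStableIso φ) {f : ∀ n, Q n →ₗ[R] P n}
    (hf : ∀ n, dP n ∘ₗ f (n + 1) = f n ∘ₗ dQ n) (hf0 : πP ∘ₗ f 0 = φ ∘ₗ πQ) {n : ℕ}
    {L : Type*} [AddCommGroup L] [Module R L] {x : Q (n + 1) →ₗ[R] L} (hx : x ∘ₗ dQ (n + 1) = 0) :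
    ∃ x' : P (n + 1) →ₗ[R] L, x' ∘ₗ dP (n + 1) = 0 ∧
      ∃ w : Q n →ₗ[R] L, x' ∘ₗ f (n + 1) - x = w ∘ₗ dQ n := by
  obtain ⟨a, b, hab, -, s, t, hst⟩ := hP.exists_homotopy_inverse hQ hφ hf hf0 n
  have := hP.projective (n + 2)
  obtain ⟨c, hc⟩ := exists_lift_of_exact (hQ.exact n) (b ∘ₗ dP (n + 1)) (by
    rw [← LinearMap.comp_assoc, hab, LinearMap.comp_assoc, hP.comp_eq_zero, LinearMap.comp_zero])
  refine ⟨x ∘ₗ b, ?_, x ∘ₗ s, ?_⟩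
  · rw [LinearMap.comp_assoc, ← hc, ← LinearMap.comp_assoc, hx, LinearMap.zero_comp]
  · rw [LinearMap.comp_assoc, ← LinearMap.comp_id x, LinearMap.comp_assoc, LinearMap.id_comp,
      ← LinearMap.comp_sub, hst, LinearMap.comp_add, ← LinearMap.comp_assoc, hx,
      LinearMap.zero_comp, zero_add, LinearMap.comp_assoc]
    rfl

end Resolution

/-! ### Multilinear functions with values in a bimodule -/

section Env

variable {Λ : Type*} [Ring Λ] [Algebra ℂ Λ]

theorem Env.tmul_mul_tmul (a b c d : Λ) :
    Env.tmul a b * Env.tmul c d = Env.tmul (a * c) (d * b) :=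
  Algebra.TensorProduct.tmul_mul_tmul a c (MulOpposite.op b) (MulOpposite.op d)

theorem Env.tmul_one_one : Env.tmul (1 : Λ) 1 = 1 := rfl

/-- The element `a ⊗ b` as a bilinear function. -/
def Env.tmulₗ : Λ →ₗ[ℂ] Λ →ₗ[ℂ] Env Λ :=
  (TensorProduct.mk ℂ Λ Λᵐᵒᵖ).compl₂ (MulOpposite.opLinearEquiv ℂ).toLinearMap

theorem Env.tmulₗ_apply (a b : Λ) : Env.tmulₗ a b = Env.tmul a b := rfl

@[elab_as_elim]
theorem Env.induction {P : Env Λ → Prop} (e : Env Λ) (tmul : ∀ a b, P (Env.tmul a b))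
    (add : ∀ e f, P e → P f → P (e + f)) : P e := by
  refine TensorProduct.induction_on (motive := P) e ?_ (fun a b => tmul a b.unop) add
  have := tmul 0 0
  rwa [← Env.tmulₗ_apply, map_zero] at this

instance : IsScalarTower ℂ (Env Λ) Λ where
  smul_assoc r e x := by
    induction e using Env.induction with
    | tmul a b =>
      rw [← Env.tmulₗ_apply, ← LinearMap.smul_apply, ← map_smul, Env.tmulₗ_apply, Env.tmulₗ_apply,
        Env.tmul_smul, Env.tmul_smul, smul_mul_assoc, smul_mul_assoc]
    | add e f he hf => rw [smul_add, add_smul, add_smul, he, hf, smul_add]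

end Env

section ModuleValued

variable {Λ M N : Type*} [Ring Λ] [Algebra ℂ Λ] [AddCommGroup M] [Module (Env Λ) M]
  [AddCommGroup N] [Module (Env Λ) N]

/-- The convolution product `(u F)(a₁, …) = Σ u(a₁, …, aᵢ) F(aᵢ₊₁, …)` of a cochain `u` and a
bimodule-valued function. -/
def lconv (u : List Λ → Λ) (F : List Λ → M) : List Λ → M :=
  splitSum fun x y => Env.tmul (u x) 1 • F y

/-- The function `(a₁, …, aₙ) ↦ ± F(a₁, …, aₙ₋₁) aₙ`. -/
def rmul (F : List Λ → M) : List Λ → M :=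
  splitSum fun x y => (-1 : ℤ) ^ x.length • Env.tmul 1 (idc y) • F x

/-- The Hochschild differential of a bimodule-valued function. -/
def dM (F : List Λ → M) : List Λ → M := lconv idc F - rmul F - ins (-1) mulc F

theorem lconv_eq_conv (u F : List Λ → Λ) : lconv u F = u ⋆ F :=
  funext fun _ => splitSum_congr fun _ _ _ => by rw [Env.tmul_smul, mul_one]

theorem dM_eq_dH (F : List Λ → Λ) : dM F = dH F := by
  rw [dM, dH, lconv_eq_conv]
  congr 2
  exact funext fun _ => splitSum_congr fun _ _ _ => by
    rw [Env.tmul_smul, one_mul, sgn, smul_mul_assoc]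

theorem lconv_comp (φ : M →ₗ[Env Λ] N) (u : List Λ → Λ) (F : List Λ → M) (l : List Λ) :
    φ (lconv u F l) = lconv u (fun l => φ (F l)) l :=
  (map_splitSum φ _ l).trans (splitSum_congr fun _ _ _ => map_smul _ _ _)

theorem dM_comp (φ : M →ₗ[Env Λ] N) (F : List Λ → M) (l : List Λ) :
    φ (dM F l) = dM (fun l => φ (F l)) l := by
  rw [dM, Pi.sub_apply, Pi.sub_apply, map_sub, map_sub, lconv_comp]
  congr 1
  · congr 1
    exact (map_splitSum φ _ l).trans (splitSum_congr fun _ _ _ => by rw [map_zsmul, map_smul])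
  · exact map_ins φ.toAddMonoidHom _ _ _ _

theorem lconv_lconv (u v : List Λ → Λ) (F : List Λ → M) :
    lconv (u ⋆ v) F = lconv u (lconv v F) := by
  ext1 l
  have h1 : lconv (u ⋆ v) F l = splitSum (fun x w => splitSum (fun y z =>
      Env.tmul (u y * v z) 1 • F w) x) l := splitSum_congr fun x w _ => by
    have : ∀ f : List Λ → List Λ → Λ, Env.tmul (splitSum f x) 1 • F w =
        splitSum (fun y z => Env.tmul (f y z) 1 • F w) x := fun f =>
      map_splitSum (((LinearMap.toSpanSingleton (Env Λ) M (F w)).toAddMonoidHom).comp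
        (Env.tmulₗ.flip (1 : Λ)).toAddMonoidHom) f x
    exact this _
  rw [h1, splitSum_assoc (fun y z w => Env.tmul (u y * v z) 1 • F w)]
  refine splitSum_congr fun x w _ => ?_
  refine Eq.trans ?_ (map_splitSum (DistribSMul.toAddMonoidHom M (Env.tmul (u x) 1)) _ w).symm
  refine splitSum_congr fun y z _ => ?_
  rw [DistribSMul.toAddMonoidHom_apply, smul_smul, Env.tmul_mul_tmul, one_mul]

theorem sub_lconv (u v : List Λ → Λ) (F : List Λ → M) :
    lconv (u - v) F = lconv u F - lconv v F := by
  ext1 l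
  rw [Pi.sub_apply, sub_eq_add_neg (lconv _ _ l), lconv, lconv, lconv, ← splitSum_neg,
    ← splitSum_add]
  refine splitSum_congr fun x y _ => ?_
  rw [Pi.sub_apply, ← Env.tmulₗ_apply, map_sub, LinearMap.sub_apply, sub_smul, sub_eq_add_neg]
  rfl

theorem lconv_sub (u : List Λ → Λ) (F G : List Λ → M) :
    lconv u (F - G) = lconv u F - lconv u G := by
  ext1 l
  rw [Pi.sub_apply, sub_eq_add_neg (lconv _ _ l), lconv, lconv, lconv, ← splitSum_neg,
    ← splitSum_add]
  refine splitSum_congr fun x y _ => ?_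
  rw [Pi.sub_apply, smul_sub, sub_eq_add_neg]

/-- The Hochschild differential commutes with multiplication by a cocycle of even degree. -/
theorem dM_lconv {u : List Λ → Λ} (hu : Supported 4 u) (hu' : dH u = 0) (F : List Λ → M) :
    dM (lconv u F) = lconv u (dM F) := by
  have h0 : ∀ (x : List Λ) (z : M), (-1 : ℤ) ^ x.length • Env.tmul (u x) 1 • z =
      Env.tmul (u x) 1 • z := by
    intro x z
    by_cases hx : x.length = 4
    · rw [hx, show (-1 : ℤ) ^ 4 = 1 by norm_num, one_smul]
    · rw [hu x hx, ← Env.tmulₗ_apply, map_zero, LinearMap.zero_apply, zero_smul, smul_zero]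
  have h1 : ins (-1) mulc u = idc ⋆ u - u ⋆ idc := by
    rw [dH, sgn_neg_one_four hu, sub_eq_zero] at hu'
    exact hu'.symm
  have h2 : rmul (lconv u F) = lconv u (rmul F) := by
    ext1 l
    have e1 : rmul (lconv u F) l = splitSum (fun x w => splitSum (fun y z =>
        (-1 : ℤ) ^ z.length • Env.tmul (u y) (idc w) • F z) x) l := by
      refine splitSum_congr fun x w _ => ?_
      rw [lconv, ← splitSum_smul, ← splitSum_smul]
      refine splitSum_congr fun y z e => ?_
      rw [smul_smul (Env.tmul 1 _), Env.tmul_mul_tmul, one_mul, one_mul, ← e, List.length_append,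
        pow_add, mul_comm, mul_smul]
      congr 1
      have := h0 y (Env.tmul 1 (idc w) • F z)
      rwa [smul_smul (Env.tmul _ _), Env.tmul_mul_tmul, mul_one, mul_one] at this
    rw [e1, splitSum_assoc (fun y z w => (-1 : ℤ) ^ z.length • Env.tmul (u y) (idc w) • F z)]
    refine splitSum_congr fun x w _ => ?_
    rw [rmul, ← splitSum_smul]
    refine splitSum_congr fun y z _ => ?_
    rw [smul_comm (Env.tmul _ _), smul_smul (Env.tmul _ _), Env.tmul_mul_tmul, mul_one, mul_one]
  have h3 : ins (-1) mulc (lconv u F) = lconv (ins (-1) mulc u) F + lconv u (ins (-1) mulc F) := by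
    ext1 l
    rw [lconv, ins_splitSum, Pi.add_apply]
    congr 1
    · refine splitSum_congr fun x y _ => ?_
      exact (map_ins (((LinearMap.toSpanSingleton (Env Λ) M (F y)).toAddMonoidHom).comp
        (Env.tmulₗ.flip (1 : Λ)).toAddMonoidHom) _ _ _ _).symm
    · refine splitSum_congr fun x y _ => ?_
      rw [← h0 x (ins _ _ _ _)]
      exact congrArg _ (map_ins (DistribSMul.toAddMonoidHom M (Env.tmul (u x) 1)) _ _ F y).symm
  rw [dM, dM, lconv_sub, lconv_sub, h2, h3, h1, sub_lconv, lconv_lconv, lconv_lconv]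
  abel

end ModuleValued

/-! ### The bar resolution -/

section Bar

variable {Λ M N : Type*} [Ring Λ] [Algebra ℂ Λ] [AddCommGroup M] [Module (Env Λ) M] [Module ℂ M]
  [IsScalarTower ℂ (Env Λ) M] [AddCommGroup N] [Module (Env Λ) N]

theorem Bar.projective (n : ℕ) : Module.Projective (Env Λ) (Bar Λ n) := by
  infer_instance

/-- The generator `1 ⊗ a₁ ⊗ ⋯ ⊗ aₙ ⊗ 1` of the bar resolution, as a function of the list
`[a₁, …, aₙ]`. -/
def barGen (Λ : Type*) [Ring Λ] [Algebra ℂ Λ] (n : ℕ) (l : List Λ) : Bar Λ n :=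
  if h : l.length = n then barElem 1 1 fun i => l.get (i.cast h.symm) else 0

theorem supported_barGen (n : ℕ) : Supported n (barGen Λ n) := fun _ h => dif_neg h

theorem barGen_ofFn {n : ℕ} (a : Fin n → Λ) : barGen Λ n (List.ofFn a) = barElem 1 1 a := by
  rw [barGen, dif_pos (List.length_ofFn)]
  congr 1
  ext i
  simp

theorem barElem_eq {n : ℕ} (b c : Λ) (a : Fin n → Λ) :
    barElem b c a = Env.tmul b c • barGen Λ n (List.ofFn a) := by
  rw [barGen_ofFn, barElem, barElem, TensorProduct.smul_tmul', Env.tmul_one_one, smul_eq_mul,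
    mul_one]

theorem exists_ofFn {A : Type*} {n : ℕ} {l : List A} (h : l.length = n) :
    ∃ a : Fin n → A, List.ofFn a = l := by
  subst h
  exact ⟨l.get, List.ofFn_get l⟩

theorem ofFn_update {A : Type*} {n : ℕ} [DecidableEq (Fin n)] (a : Fin n → A) (i : Fin n) (x : A) :
    List.ofFn (Function.update a i x) =
      (List.ofFn a).take i ++ x :: (List.ofFn a).drop (i + 1) := by
  have h := List.set_eq_take_append_cons_drop (l := List.ofFn a) (i := i) (a := x)
  rw [if_pos (by simp)] at h
  rw [← h]
  refine List.ext_getElem (by simp) fun j h1 h2 => ?_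
  simp only [List.getElem_ofFn, List.getElem_set, Function.update_apply, Fin.ext_iff, eq_comm]

/-- The multilinear map given by a multilinear function on lists. -/
def Multilinear.toMultilinearMap {A N : Type*} [AddCommGroup A] [Module ℂ A] [AddCommGroup N]
    [Module ℂ N] {F : List A → N} (hF : Multilinear ℂ F) (n : ℕ) :
    MultilinearMap ℂ (fun _ : Fin n => A) N where
  toFun a := F (List.ofFn a)
  map_update_add' a i x y := by
    rw [ofFn_update, ofFn_update, ofFn_update, hF.map_add]
  map_update_smul' a i c x := by
    rw [ofFn_update, ofFn_update, (hF _ _).map_smul]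

theorem multilinear_barGen (n : ℕ) : Multilinear ℂ (barGen Λ n) := by
  intro l r
  by_cases h : l.length + r.length + 1 = n
  · subst h
    have hl : l.length < l.length + r.length + 1 := by omega
    obtain ⟨v, hv⟩ := exists_ofFn (show (l ++ (0 : Λ) :: r).length = l.length + r.length + 1 by
      simp [add_assoc])
    have e : ∀ a : Λ, l ++ a :: r = List.ofFn (Function.update v ⟨l.length, hl⟩ a) := fun a => by
      rw [ofFn_update, hv]
      simp
    simp only [e, barGen_ofFn, barElem]
    constructor
    · intro a b
      rw [MultilinearMap.map_update_add, TensorProduct.tmul_add]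
    · intro c a
      rw [MultilinearMap.map_update_smul, TensorProduct.tmul_smul]
  · have e : ∀ a : Λ, barGen Λ n (l ++ a :: r) = 0 := fun a =>
      supported_barGen n _ (by simp; omega)
    simp only [e]
    exact (0 : Λ →ₗ[ℂ] Bar Λ n).isLinear

/-- The bimodule homomorphism on the bar resolution given by a multilinear function. -/
def barLift (n : ℕ) {F : List Λ → M} (hF : Multilinear ℂ F) : Bar Λ n →ₗ[Env Λ] M :=
  TensorProduct.AlgebraTensorModule.lift
    (LinearMap.toSpanSingleton (Env Λ) ((PiTensorProduct ℂ fun _ : Fin n => Λ) →ₗ[ℂ] M)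
      (PiTensorProduct.lift (hF.toMultilinearMap n)))

theorem barLift_barGen {n : ℕ} {F : List Λ → M} (hF : Multilinear ℂ F) (hF' : Supported n F)
    (l : List Λ) : barLift n hF (barGen Λ n l) = F l := by
  by_cases h : l.length = n
  · obtain ⟨a, rfl⟩ := exists_ofFn h
    rw [barGen_ofFn, barElem, barLift, TensorProduct.AlgebraTensorModule.lift_tmul,
      LinearMap.toSpanSingleton_apply,
      Env.tmul_one_one, one_smul, PiTensorProduct.lift.tprod]
    rfl
  · rw [supported_barGen n l h, map_zero, hF' l h]

/-- The bar resolution is generated by the elements `b ⊗ a₁ ⊗ ⋯ ⊗ aₙ ⊗ c`. -/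
theorem bar_induction {n : ℕ} {P : Bar Λ n → Prop} (z : Bar Λ n)
    (gen : ∀ (b c : Λ) (l : List Λ), P (Env.tmul b c • barGen Λ n l))
    (add : ∀ x y, P x → P y → P (x + y)) :
    P z := by
  have zero : P 0 := by
    have := gen 0 0 []
    rwa [← Env.tmulₗ_apply, map_zero, zero_smul] at this
  induction z using TensorProduct.induction_on with
  | zero => exact zero
  | add x y hx hy => exact add x y hx hy
  | tmul e p =>
    induction e using Env.induction with
    | add e f he hf =>
      rw [TensorProduct.add_tmul]
      exact add _ _ he hf
    | tmul b c =>
      induction p using PiTensorProduct.induction_on with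
      | add x y hx hy =>
        rw [TensorProduct.tmul_add]
        exact add _ _ hx hy
      | smul_tprod r a =>
        rw [← TensorProduct.smul_tmul, ← Env.tmulₗ_apply, ← LinearMap.smul_apply, ← map_smul]
        have := gen (r • b) c (List.ofFn a)
        rwa [← barElem_eq] at this

theorem bar_hom_ext {n : ℕ} {f g : Bar Λ n →ₗ[Env Λ] N}
    (h : ∀ l, f (barGen Λ n l) = g (barGen Λ n l)) : f = g := by
  ext1 z
  induction z using bar_induction with
  | gen b c l => rw [map_smul, map_smul, h]
  | add x y hx hy => rw [map_add, map_add, hx, hy]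

theorem multilinear_lconv {u : List Λ → Λ} {F : List Λ → M} (hu : Multilinear ℂ u)
    (hF : Multilinear ℂ F) : Multilinear ℂ (lconv u F) :=
  Multilinear.splitSum
    (fun y => hu.comp (((LinearMap.toSpanSingleton (Env Λ) M (F y)).restrictScalars ℂ) ∘ₗ
      Env.tmulₗ.flip (1 : Λ)))
    fun x => hF.comp (Algebra.lsmul ℂ ℂ M (Env.tmul (u x) 1))

theorem multilinear_rmul {F : List Λ → M} (hF : Multilinear ℂ F) : Multilinear ℂ (rmul F) :=
  Multilinear.splitSum
    (fun y => (hF.comp (Algebra.lsmul ℂ ℂ M (Env.tmul 1 (idc y)))).sgn (-1))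
    fun x => (multilinear_idc.comp (((LinearMap.toSpanSingleton (Env Λ) M (F x)).restrictScalars ℂ)
      ∘ₗ Env.tmulₗ (1 : Λ))).zsmul _

theorem multilinear_dM {F : List Λ → M} (hF : Multilinear ℂ F) : Multilinear ℂ (dM F) := by
  have h := ((multilinear_lconv multilinear_idc hF).add ((multilinear_rmul hF).zsmul (-1))).add
    ((hF.ins (multilinear_mulc (k := ℂ)) (-1)).zsmul (-1))
  convert h using 1
  rw [dM]
  module

theorem supported_lconv {p r : ℕ} {u : List Λ → Λ} {F : List Λ → N} (hu : Supported p u)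
    (hF : Supported r F) : Supported (p + r) (lconv u F) := by
  intro l hl
  refine splitSum_eq_zero fun x y e => ?_
  by_cases hx : x.length = p
  · rw [hF y (by rintro rfl; exact hl (by rw [← e, List.length_append, hx])), smul_zero]
  · rw [hu x hx, ← Env.tmulₗ_apply, map_zero, LinearMap.zero_apply, zero_smul]

theorem supported_rmul {r : ℕ} {F : List Λ → N} (hF : Supported r F) :
    Supported (r + 1) (rmul F) := by
  intro l hl
  refine splitSum_eq_zero fun x y e => ?_
  by_cases hy : y.length = 1
  · rw [hF x (by rintro rfl; exact hl (by rw [← e, List.length_append, hy])), smul_zero, smul_zero]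
  · rw [supported_idc y hy, ← Env.tmulₗ_apply, map_zero, zero_smul, smul_zero]

theorem supported_dM {r : ℕ} {F : List Λ → M} (hF : Supported r F) (hF' : Multilinear ℂ F) :
    Supported (r + 1) (dM F) := by
  intro l hl
  rw [dM, Pi.sub_apply, Pi.sub_apply, supported_lconv supported_idc hF l (by omega),
    supported_rmul hF l hl, ins, splitSum_eq_zero, sub_zero, sub_zero]
  intro x w e
  refine splitSum_eq_zero fun y z e' => ?_
  by_cases hy : y.length = 2
  · rw [hF, smul_zero]
    rw [← e, ← e', List.length_append, List.length_append, hy] at hl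
    rw [List.length_append, List.length_cons]
    omega
  · rw [supported_mulc y hy, hF'.map_zero, smul_zero]

/-- The differential of the bar resolution. -/
def bd (Λ : Type*) [Ring Λ] [Algebra ℂ Λ] (n : ℕ) : Bar Λ (n + 1) →ₗ[Env Λ] Bar Λ n :=
  barLift (n + 1) (multilinear_dM (multilinear_barGen n))

theorem bd_barGen (n : ℕ) (l : List Λ) : bd Λ n (barGen Λ (n + 1) l) = dM (barGen Λ n) l :=
  barLift_barGen _ (supported_dM (supported_barGen n) (multilinear_barGen n)) l

/-- The augmentation `b ⊗ c ↦ b c` of the bar resolution. -/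
def aug (Λ : Type*) [Ring Λ] [Algebra ℂ Λ] : Bar Λ 0 →ₗ[Env Λ] Λ :=
  barLift 0 (multilinear_const 1)

theorem aug_barGen (l : List Λ) : aug Λ (barGen Λ 0 l) = const 1 l :=
  barLift_barGen _ (supported_const 1) l

theorem aug_comp_bd : aug Λ ∘ₗ bd Λ 0 = 0 := by
  refine bar_hom_ext fun l => ?_
  rw [LinearMap.comp_apply, bd_barGen, dM_comp]
  simp only [aug_barGen]
  rw [dM_eq_dH, dH_const fun a => by rw [one_mul, mul_one]]
  rfl

theorem barLift_comp_bd {n : ℕ} (φ : Bar Λ n →ₗ[Env Λ] N) (l : List Λ) :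
    φ (bd Λ n (barGen Λ (n + 1) l)) = dM (fun l => φ (barGen Λ n l)) l := by
  rw [bd_barGen, dM_comp]

end Bar

/-! ### The bar differential -/

section BarBoundary

variable {Λ M : Type*} [Ring Λ] [Algebra ℂ Λ] [AddCommGroup M] [Module (Env Λ) M] [Module ℂ M]

theorem lconv_idc_cons (F : List Λ → M) (a : Λ) (l : List Λ) :
    lconv idc F (a :: l) = Env.tmul a 1 • F l := by
  have h0 : ∀ (z : M), Env.tmul (0 : Λ) 1 • z = 0 := fun z => by
    rw [← Env.tmulₗ_apply, map_zero, LinearMap.zero_apply, zero_smul]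
  rw [lconv, splitSum_cons, splitSum_left fun _ _ _ => h0 _]
  exact (congrArg (· + _) (h0 _)).trans (zero_add _)

theorem rmul_append_singleton (F : List Λ → M) (l : List Λ) (b : Λ) :
    rmul F (l ++ [b]) = (-1 : ℤ) ^ l.length • Env.tmul 1 b • F l := by
  have h0 : ∀ (z : M), Env.tmul (1 : Λ) 0 • z = 0 := fun z => by
    rw [← Env.tmulₗ_apply, map_zero, zero_smul]
  rw [rmul, splitSum_append_cons, splitSum_right, splitSum_nil]
  · change _ + _ • Env.tmul (1 : Λ) 0 • _ = _
    rw [h0, smul_zero, add_zero]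
    rfl
  · intro x a y
    rw [idc_append_cons _ _ _ (Or.inl (List.cons_ne_nil _ _)), h0, smul_zero]

theorem rmul_cons_cons (F : List Λ → M) (b a : Λ) (l : List Λ) :
    rmul F (b :: a :: l) = -rmul (fun t => F (b :: t)) (a :: l) := by
  have h0 : ∀ (z : M), Env.tmul (1 : Λ) 0 • z = 0 := fun z => by
    rw [← Env.tmulₗ_apply, map_zero, zero_smul]
  rw [rmul, splitSum_cons, rmul, ← splitSum_neg]
  change _ • Env.tmul (1 : Λ) 0 • _ + _ = _
  rw [h0, smul_zero, zero_add]
  refine splitSum_congr fun x y _ => ?_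
  rw [List.length_cons, pow_succ, mul_neg_one, neg_smul]

theorem mulc_pair (b a : Λ) : mulc [b, a] = b * a := by
  simp [mulc, conv, splitSum, idc]

theorem ins_mulc_cons_cons {F : List Λ → M} (hF : Multilinear ℂ F) (b a : Λ) (l : List Λ) :
    ins (-1) mulc F (b :: a :: l) =
      F ((b * a) :: l) - ins (-1) mulc (fun t => F (b :: t)) (a :: l) := by
  have h0 : ∀ (y z : List Λ), y.length ≠ 2 → F (mulc y :: z) = 0 := fun y z hy => by
    rw [supported_mulc y hy]
    exact hF.map_zero [] z
  have h := ins_append_cons (-1) mulc F [] b (a :: l)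
  simp only [List.nil_append, List.cons_append, splitSum_nil, ins, List.length_nil, pow_zero,
    one_smul, zero_add, pow_one] at h
  rw [ins, h, h0 [] _ (by simp), zero_add, splitSum_cons, splitSum_left, h0 [b] _ (by simp),
    zero_add, mulc_pair, ins]
  · module
  · intro c x y
    exact h0 _ _ (by simp)

theorem ins_mulc_singleton {F : List Λ → M} (hF : Multilinear ℂ F) (b : Λ) :
    ins (-1) mulc F [b] = 0 := by
  refine splitSum_eq_zero fun x w e => splitSum_eq_zero fun y z e' => ?_
  rw [supported_mulc y, hF.map_zero, smul_zero]
  intro hy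
  have := congrArg List.length e
  rw [← e', List.length_append, List.length_append, hy, List.length_singleton] at this
  omega

theorem ins_mulc_ofFn {n : ℕ} {F : List Λ → M} (hF : Multilinear ℂ F) (a : Fin (n + 1) → Λ) :
    ins (-1) mulc F (List.ofFn a) = ∑ j : Fin n, (-1 : ℤ) ^ (j : ℕ) •
      F (List.ofFn (Fin.contractNth j.castSucc (· * ·) a)) := by
  induction n generalizing F with
  | zero => simpa using ins_mulc_singleton hF (a 0)
  | succ n ih =>
    have h1 := ih (hF.cons_append [] (a 0)) (Fin.tail a)
    simp only [List.nil_append] at h1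
    rw [List.ofFn_succ, List.ofFn_succ, ins_mulc_cons_cons hF, Fin.sum_univ_succ,
      sub_eq_add_neg]
    congr 1
    · rw [List.ofFn_succ]
      simp [Fin.contractNth]
    · rw [← List.ofFn_succ (f := fun i => a i.succ)]
      refine (congrArg Neg.neg h1).trans ?_
      rw [← Finset.sum_neg_distrib]
      refine Finset.sum_congr rfl fun j _ => ?_
      rw [Fin.val_succ, pow_succ, mul_neg_one, neg_smul]
      congr 3
      rw [List.ofFn_succ]
      congr 1
      refine congrArg List.ofFn (funext fun i => ?_)
      simp only [Fin.contractNth, Fin.tail, Fin.val_castSucc, Fin.val_succ, add_lt_add_iff_right,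
        add_left_inj]
      rfl

/-- The bar differential is the Hochschild differential of the universal cochain. -/
theorem dM_barGen_ofFn {n : ℕ} (a : Fin (n + 1) → Λ) :
    dM (barGen Λ n) (List.ofFn a) = barBoundary Λ n a := by
  have h1 : lconv idc (barGen Λ n) (List.ofFn a) = barElem (a 0) 1 (Fin.tail a) := by
    rw [List.ofFn_succ, lconv_idc_cons, barElem_eq]
    rfl
  have h2 : rmul (barGen Λ n) (List.ofFn a) =
      (-1 : ℤ) ^ n • barElem 1 (a (Fin.last n)) (Fin.init a) := by
    rw [List.ofFn_succ_last, rmul_append_singleton, barElem_eq, List.length_ofFn]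
    rfl
  rw [dM, Pi.sub_apply, Pi.sub_apply, h1, h2, ins_mulc_ofFn (multilinear_barGen n), barBoundary]
  simp only [barGen_ofFn, pow_succ, mul_neg_one, neg_smul, Finset.sum_neg_distrib]
  abel

end BarBoundary

/-! ### The contracting homotopy of the bar resolution -/

section Homotopy

variable {Λ : Type*} [Ring Λ] [Algebra ℂ Λ]

/-- The contracting homotopy `b ⊗ a₁ ⊗ ⋯ ⊗ aₙ ⊗ c ↦ 1 ⊗ b ⊗ a₁ ⊗ ⋯ ⊗ aₙ ⊗ c`. -/
def barShift (Λ : Type*) [Ring Λ] [Algebra ℂ Λ] (n : ℕ) : Bar Λ n →ₗ[ℂ] Bar Λ (n + 1) :=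
  let K : Λ →ₗ[ℂ] (PiTensorProduct ℂ fun _ : Fin n => Λ) →ₗ[ℂ]
      PiTensorProduct ℂ fun _ : Fin (n + 1) => Λ :=
    PiTensorProduct.lift.toLinearMap ∘ₗ
      (PiTensorProduct.tprod ℂ : MultilinearMap ℂ (fun _ : Fin (n + 1) => Λ) _).curryLeft
  TensorProduct.lift (TensorProduct.lift (LinearMap.mk₂ ℂ
    (fun (b : Λ) (c : Λᵐᵒᵖ) =>
      (TensorProduct.mk ℂ (Env Λ) (PiTensorProduct ℂ fun _ : Fin (n + 1) => Λ)
        (Env.tmul 1 c.unop)) ∘ₗ K b)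
    (fun b b' c => by rw [map_add, LinearMap.comp_add])
    (fun r b c => by rw [map_smul, LinearMap.comp_smul])
    (fun b c c' => by
      rw [MulOpposite.unop_add, ← Env.tmulₗ_apply, map_add, map_add, LinearMap.add_comp]; rfl)
    (fun r b c => by
      rw [MulOpposite.unop_smul, ← Env.tmulₗ_apply, map_smul, map_smul, LinearMap.smul_comp]; rfl)))

theorem barShift_barGen (n : ℕ) (b c : Λ) (l : List Λ) :
    barShift Λ n (Env.tmul b c • barGen Λ n l) = Env.tmul 1 c • barGen Λ (n + 1) (b :: l) := by
  by_cases h : l.length = n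
  · obtain ⟨a, rfl⟩ := exists_ofFn h
    rw [← barElem_eq, ← List.ofFn_cons, ← barElem_eq, barElem]
    change Env.tmul 1 c ⊗ₜ[ℂ] PiTensorProduct.lift _ (PiTensorProduct.tprod ℂ a) = _
    rw [PiTensorProduct.lift.tprod]
    rfl
  · rw [supported_barGen n l h, supported_barGen (n + 1) (b :: l) (by simpa using h), smul_zero,
      smul_zero, map_zero]

/-- `b s + s b = id` for the bar differential `b` and the contracting homotopy `s`. -/
theorem bd_barShift (n : ℕ) (z : Bar Λ (n + 1)) :
    bd Λ (n + 1) (barShift Λ (n + 1) z) + barShift Λ n (bd Λ n z) = z := by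
  induction z using bar_induction with
  | add x y hx hy =>
    simp only [map_add]
    conv_rhs => rw [← hx, ← hy]
    abel
  | gen b c l =>
    match l with
    | [] => rw [supported_barGen (n + 1) [] (by simp), smul_zero]; simp only [map_zero, add_zero]
    | a :: l =>
      have e1 : barShift Λ n (Env.tmul b c • Env.tmul a 1 • barGen Λ n l) =
          Env.tmul 1 c • barGen Λ (n + 1) ((b * a) :: l) := by
        rw [smul_smul, Env.tmul_mul_tmul, one_mul, barShift_barGen]
      have e2 : barShift Λ n (Env.tmul b c • rmul (barGen Λ n) (a :: l)) =
          Env.tmul 1 c • rmul (fun t => barGen Λ (n + 1) (b :: t)) (a :: l) := by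
        refine (map_splitSum ((barShift Λ n).toAddMonoidHom.comp
          (DistribSMul.toAddMonoidHom _ (Env.tmul b c))) _ _).trans
          (Eq.trans (splitSum_congr fun x y _ => ?_)
          (map_splitSum (DistribSMul.toAddMonoidHom _ (Env.tmul 1 c)) _ _).symm)
        simp only [AddMonoidHom.comp_apply, DistribSMul.toAddMonoidHom_apply,
          LinearMap.toAddMonoidHom_coe]
        rw [smul_comm (Env.tmul b c), map_zsmul, smul_smul, Env.tmul_mul_tmul, mul_one,
          barShift_barGen, smul_comm (Env.tmul 1 c), smul_smul, Env.tmul_mul_tmul, mul_one]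
      have e3 : barShift Λ n (Env.tmul b c • ins (-1) mulc (barGen Λ n) (a :: l)) =
          Env.tmul 1 c • ins (-1) mulc (fun t => barGen Λ (n + 1) (b :: t)) (a :: l) := by
        refine (map_ins ((barShift Λ n).toAddMonoidHom.comp
          (DistribSMul.toAddMonoidHom _ (Env.tmul b c))) _ _ _ _).trans
          (Eq.trans ?_
            (map_ins (DistribSMul.toAddMonoidHom (Bar Λ (n + 1)) (Env.tmul 1 c)) (-1) mulc
              (fun t => barGen Λ (n + 1) (b :: t)) (a :: l)).symm)
        refine congrArg (fun F => ins (-1) mulc F (a :: l)) (funext fun t => ?_)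
        exact barShift_barGen n b c t
      rw [barShift_barGen, map_smul, map_smul, bd_barGen, bd_barGen, dM, dM]
      simp only [Pi.sub_apply, lconv_idc_cons, rmul_cons_cons,
        ins_mulc_cons_cons (multilinear_barGen (n + 1)), smul_sub, smul_neg, map_sub, e1, e2, e3]
      rw [smul_smul, Env.tmul_mul_tmul, one_mul, one_mul]
      abel

theorem bd_zero_barShift (z : Bar Λ 0) :
    bd Λ 0 (barShift Λ 0 z) + Env.tmul 1 (aug Λ z) • barGen Λ 0 [] = z := by
  induction z using bar_induction with
  | add x y hx hy =>
    rw [map_add, map_add, map_add, ← Env.tmulₗ_apply, map_add, add_smul, Env.tmulₗ_apply,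
      Env.tmulₗ_apply]
    conv_rhs => rw [← hx, ← hy]
    abel
  | gen b c l =>
    match l with
    | a :: l =>
      rw [supported_barGen 0 (a :: l) (by simp), smul_zero, map_zero, map_zero, map_zero,
        ← Env.tmulₗ_apply, map_zero, zero_smul, add_zero]
    | [] =>
      have h := rmul_append_singleton (barGen Λ 0) [] b
      rw [List.nil_append] at h
      rw [barShift_barGen, map_smul, map_smul, bd_barGen, dM, Pi.sub_apply, Pi.sub_apply,
        ins_mulc_singleton (multilinear_barGen 0), h, lconv_idc_cons, aug_barGen, const,
        Env.tmul_smul, mul_one, List.length_nil, pow_zero, one_smul, sub_zero, smul_sub, smul_smul,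
        smul_smul, Env.tmul_mul_tmul, Env.tmul_mul_tmul, one_mul, one_mul, one_mul,
        sub_add_cancel]

/-- The bar differential squares to zero, because the contracting homotopy reduces `b b` in one
degree to `b b` in the degree below. -/
theorem bd_comp_bd (n : ℕ) : bd Λ n ∘ₗ bd Λ (n + 1) = 0 := by
  have key : ∀ n, (∀ w : Bar Λ (n + 1), bd Λ n (barShift Λ n (bd Λ n w)) = bd Λ n w) →
      bd Λ n ∘ₗ bd Λ (n + 1) = 0 := by
    intro n h
    refine bar_hom_ext fun l => ?_
    match l with
    | [] => rw [supported_barGen (n + 2) [] (by simp), map_zero, map_zero]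
    | b :: l =>
      have e := barShift_barGen (n + 1) b 1 l
      rw [Env.tmul_one_one, one_smul] at e
      rw [← e, LinearMap.comp_apply,
        eq_sub_of_add_eq (bd_barShift n (Env.tmul b 1 • barGen Λ (n + 1) l)), map_sub, h, sub_self]
      rfl
  induction n with
  | zero =>
    refine key 0 fun w => ?_
    have h := bd_zero_barShift (bd Λ 0 w)
    have h' : aug Λ (bd Λ 0 w) = 0 := LinearMap.congr_fun aug_comp_bd w
    rwa [h', ← Env.tmulₗ_apply, map_zero, zero_smul, add_zero] at h
  | succ n ih =>
    refine key (n + 1) fun w => ?_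
    have h := bd_barShift n (bd Λ (n + 1) w)
    have h' : bd Λ n (bd Λ (n + 1) w) = 0 := LinearMap.congr_fun ih w
    rwa [h', map_zero, add_zero] at h

theorem bd_exact (n : ℕ) : Function.Exact (bd Λ (n + 1)) (bd Λ n) := by
  intro z
  constructor
  · intro hz
    have h := bd_barShift n z
    rw [hz, map_zero, add_zero] at h
    exact ⟨_, h⟩
  · rintro ⟨w, rfl⟩
    exact LinearMap.congr_fun (bd_comp_bd n) w

theorem aug_exact : Function.Exact (bd Λ 0) (aug Λ) := by
  intro z
  constructor
  · intro hz
    have h := bd_zero_barShift z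
    rw [hz, ← Env.tmulₗ_apply, map_zero, zero_smul, add_zero] at h
    exact ⟨_, h⟩
  · rintro ⟨w, rfl⟩
    exact LinearMap.congr_fun aug_comp_bd w

theorem aug_surjective : Function.Surjective (aug Λ) := fun a =>
  ⟨Env.tmul a 1 • barGen Λ 0 [], by
    rw [map_smul, aug_barGen, const, Env.tmul_smul, mul_one, mul_one]⟩

theorem span_barBoundary (n : ℕ) :
    Submodule.span (Env Λ) (Set.range (barBoundary Λ n)) = LinearMap.range (bd Λ n) := by
  refine le_antisymm (Submodule.span_le.2 ?_) ?_
  · rintro _ ⟨a, rfl⟩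
    exact ⟨barGen Λ (n + 1) (List.ofFn a), by rw [bd_barGen, dM_barGen_ofFn]⟩
  · rintro _ ⟨z, rfl⟩
    induction z using bar_induction with
    | add x y hx hy => rw [map_add]; exact Submodule.add_mem _ hx hy
    | gen b c l =>
      rw [map_smul]
      refine Submodule.smul_mem _ _ ?_
      by_cases h : l.length = n + 1
      · obtain ⟨a, rfl⟩ := exists_ofFn h
        rw [bd_barGen, dM_barGen_ofFn]
        exact Submodule.subset_span ⟨a, rfl⟩
      · rw [supported_barGen _ _ h, map_zero]
        exact Submodule.zero_mem _

end Homotopy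

/-! ### Units of Hochschild–Tate cohomology act bijectively in positive degrees -/

section Tate

variable {Λ : Type u} [Ring Λ] [Algebra ℂ Λ]

theorem isResolution_bar : IsResolution (bd Λ) (aug Λ) where
  projective := Bar.projective
  exact := bd_exact
  exact_zero := aug_exact
  surjective := aug_surjective

/-- The truncated bar resolution is a projective resolution of the syzygy. -/
theorem isResolution_syzygy : IsResolution (P := fun n => Bar Λ (n + 4)) (fun n => bd Λ (n + 4))
    (Submodule.span (Env Λ) (Set.range (barBoundary Λ 4))).mkQ where
  projective n := Bar.projective (n + 4)
  exact n := bd_exact (n + 4)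
  exact_zero z := by
    rw [Submodule.mkQ_apply, Submodule.Quotient.mk_eq_zero, span_barBoundary]
    rfl
  surjective := Submodule.mkQ_surjective _

/-- The chain map `Bar (n + 4) → Bar n` induced by a cochain `u` of degree `4`. -/
def barMap {u : List Λ → Λ} (hu : Multilinear ℂ u) (n : ℕ) : Bar Λ (n + 4) →ₗ[Env Λ] Bar Λ n :=
  barLift (n + 4) (multilinear_lconv hu (multilinear_barGen n))

theorem barMap_barGen {u : List Λ → Λ} (hu : Multilinear ℂ u) (hu' : Supported 4 u) (n : ℕ)
    (l : List Λ) : barMap hu n (barGen Λ (n + 4) l) = lconv u (barGen Λ n) l :=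
  barLift_barGen _ (by rw [add_comm]; exact supported_lconv hu' (supported_barGen n)) l

theorem bd_comp_barMap {u : List Λ → Λ} (hu : Multilinear ℂ u) (hu' : Supported 4 u)
    (hu'' : dH u = 0) (n : ℕ) : bd Λ n ∘ₗ barMap hu (n + 1) = barMap hu n ∘ₗ bd Λ (n + 4) := by
  refine bar_hom_ext fun l => ?_
  rw [LinearMap.comp_apply, LinearMap.comp_apply, barMap_barGen hu hu', lconv_comp, bd_barGen,
    dM_comp]
  simp only [bd_barGen, barMap_barGen hu hu']
  rw [dM_lconv hu' hu'']

/-- A multilinear function of degree `n` is a homomorphism on `Bar n`; its Hochschild differential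
is the composition with the bar differential. -/
theorem comp_bd_barGen {n : ℕ} (φ : Bar Λ n →ₗ[Env Λ] Λ) (l : List Λ) :
    φ (bd Λ n (barGen Λ (n + 1) l)) = dH (fun l => φ (barGen Λ n l)) l := by
  rw [barLift_comp_bd, dM_eq_dH]

theorem comp_barGen_mem_HC {n : ℕ} (φ : Bar Λ n →ₗ[Env Λ] Λ) :
    (fun l => φ (barGen Λ n l)) ∈ HC ℂ (degZero Λ) n 0 :=
  mem_HC_degZero.2 ⟨(multilinear_barGen n).comp (φ.restrictScalars ℂ), fun l hl => by
    change φ (barGen Λ n l) = 0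
    rw [supported_barGen n l hl, map_zero]⟩

theorem barLift_comp_bd_eq {n : ℕ} {y : List Λ → Λ} (hy : Multilinear ℂ y) (hy' : Supported n y)
    (l : List Λ) : barLift n hy (bd Λ n (barGen Λ (n + 1) l)) = dH y l := by
  rw [comp_bd_barGen]
  simp only [barLift_barGen hy hy']

theorem barLift_comp_barMap_eq {n : ℕ} {u : List Λ → Λ} (hu : Multilinear ℂ u)
    (hu' : Supported 4 u) (φ : Bar Λ n →ₗ[Env Λ] Λ) (l : List Λ) :
    φ (barMap hu n (barGen Λ (n + 4) l)) = (u ⋆ fun l => φ (barGen Λ n l)) l := by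
  rw [barMap_barGen hu hu', lconv_comp, lconv_eq_conv]

/-- The chain map given by `u` lifts the homomorphism `Ω⁴(Λ) → Λ` given by `u`. -/
theorem aug_comp_barMap {u : List Λ → Λ} (hu : Multilinear ℂ u)
    (hu' : Supported 4 u) {φ : Syzygy Λ 4 →ₗ[Env Λ] Λ}
    (hφ : ∀ a : Fin 4 → Λ, φ (Submodule.Quotient.mk (barElem 1 1 a)) = u (List.ofFn a)) :
    aug Λ ∘ₗ barMap hu 0 =
      φ ∘ₗ (Submodule.span (Env Λ) (Set.range (barBoundary Λ 4))).mkQ := by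
  refine bar_hom_ext fun l => ?_
  rw [LinearMap.comp_apply, LinearMap.comp_apply, barMap_barGen hu hu' 0, lconv_comp, lconv_eq_conv]
  simp only [aug_barGen]
  rw [show (fun l : List Λ => const (1 : Λ) l) = const 1 from rfl, conv_const, mulR, mul_one]
  by_cases h : l.length = 4
  · obtain ⟨a, rfl⟩ := exists_ofFn h
    rw [barGen_ofFn, Submodule.mkQ_apply, hφ]
  · rw [hu' l h, supported_barGen 4 l h, map_zero, map_zero]

theorem IsTateUnit.mulInjective {u : List Λ → Λ} (hu : u ∈ HC ℂ (degZero Λ) 4 0) (hu' : dH u = 0)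
    (h : IsTateUnit Λ 4 u) : MulInjective u := by
  intro n y hy hy' huy
  rw [mem_HC_degZero] at hu hy
  obtain ⟨φ, hφ, hφ'⟩ := h
  obtain ⟨w, hw, hwy⟩ := mem_HB_succ.1 huy
  rw [mem_HC_degZero] at hw
  obtain ⟨v, hv⟩ := isResolution_bar.exists_factor_of_comp isResolution_syzygy hφ'
    (bd_comp_barMap hu.1 hu.2 hu') (aug_comp_barMap hu.1 hu.2 hφ) (y := barLift (n + 1) hy.1)
    (z := barLift (n + 4) hw.1)
    (bar_hom_ext fun l => by
      rw [LinearMap.comp_apply, barLift_comp_bd_eq hy.1 hy.2, hy']; rfl)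
    (bar_hom_ext fun l => by
      rw [LinearMap.comp_apply, LinearMap.comp_apply, barLift_comp_bd_eq hw.1 hw.2, hwy,
        barLift_comp_barMap_eq hu.1 hu.2]
      simp only [barLift_barGen hy.1 hy.2])
  refine mem_HB_succ.2 ⟨_, comp_barGen_mem_HC v, funext fun l => ?_⟩
  rw [← comp_bd_barGen, ← barLift_barGen hy.1 hy.2, hv]
  rfl

theorem IsTateUnit.mulSurjective {u : List Λ → Λ} (hu : u ∈ HC ℂ (degZero Λ) 4 0) (hu' : dH u = 0)
    (h : IsTateUnit Λ 4 u) : MulSurjective u := by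
  intro n x hx hx'
  rw [mem_HC_degZero] at hu hx
  obtain ⟨φ, hφ, hφ'⟩ := h
  obtain ⟨v, hv, w, hw⟩ := isResolution_bar.exists_comp_sub isResolution_syzygy hφ'
    (bd_comp_barMap hu.1 hu.2 hu') (aug_comp_barMap hu.1 hu.2 hφ) (n := n)
    (x := barLift (n + 5) hx.1)
    (bar_hom_ext fun l => by
      rw [LinearMap.comp_apply]
      exact (barLift_comp_bd_eq hx.1 hx.2 l).trans (congrFun hx' l))
  refine ⟨_, comp_barGen_mem_HC v, funext fun l => ?_, mem_HB_succ.2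
    ⟨_, comp_barGen_mem_HC w, funext fun l => ?_⟩⟩
  · rw [← comp_bd_barGen]
    exact LinearMap.congr_fun hv _
  · rw [← comp_bd_barGen, Pi.sub_apply, ← barLift_comp_barMap_eq hu.1 hu.2,
      ← barLift_barGen hx.1 hx.2]
    exact (LinearMap.congr_fun hw _).symm

end Tate

end Hoch

end

theorem mainTheorem9 {Λ : Type*} [Ring Λ] [Algebra ℂ Λ] [FiniteDimensional ℂ Λ]
    (hΛ : Hoch.IsFrobenius Λ)
    (u : List Λ → Λ) (hu : u ∈ Hoch.HZ ℂ (Hoch.degZero Λ) 4 0) (hunit : Hoch.IsTateUnit Λ 4 u)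
    (huu : Hoch.bracket 4 4 u u ∈ Hoch.HB ℂ (Hoch.degZero Λ) 7 0)
    (p : ℕ) (hp : 2 ≤ p) (q : ℤ)
    (x y : List Λ → Λ) (hx : x ∈ Hoch.HZ ℂ (Hoch.degZero Λ) p 0)
    (hy : y ∈ Hoch.HZ ℂ (Hoch.degZero Λ) (p - 1) 0)
    (hxy : Hoch.bracket 4 p (Hoch.cup (Hoch.ext u) (Hoch.iota Λ 1)) (Hoch.total x y q) ∈
      Hoch.HB ℂ (Hoch.gr Λ) (p + 3) (-2 * (q + 1))) :
    -- the equation `(x + y δ) ı^q = [u ı, u⁻¹ δ x ı^{q - 1}]` in `HH(Λ[ı^{±1}])[u⁻¹]`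
    Hoch.Frac.SameClass ℂ (Hoch.gr Λ) (Hoch.ext u) p (-2 * q)
      ⟨Hoch.total x y q, 0⟩
      (Hoch.Frac.bracket (Hoch.ext u) 4 (p + 1) (Hoch.cup (Hoch.ext u) (Hoch.iota Λ 1))
        ⟨Hoch.eulerMul x (q - 1), 1⟩) ∧
    -- the bracket determines a unique class in `HH^{p, -2q}(Λ[ı^{±1}])`
    (∀ x' ∈ Hoch.HZ ℂ (Hoch.degZero Λ) p 0, ∀ y' ∈ Hoch.HZ ℂ (Hoch.degZero Λ) (p - 1) 0,
      Hoch.Frac.SameClass ℂ (Hoch.gr Λ) (Hoch.ext u) p (-2 * q)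
        ⟨Hoch.total x' y' q, 0⟩
        (Hoch.Frac.bracket (Hoch.ext u) 4 (p + 1) (Hoch.cup (Hoch.ext u) (Hoch.iota Λ 1))
          ⟨Hoch.eulerMul x (q - 1), 1⟩) →
      Hoch.SameClass ℂ (Hoch.gr Λ) p (-2 * q) (Hoch.total x' y' q) (Hoch.total x y q)) ∧
    -- if `p ≥ 5`, then `u⁻¹ x` is a class in `HH^{p - 4}(Λ, Λ)` and the equation holds with it
    (5 ≤ p → ∃ x' ∈ Hoch.HZ ℂ (Hoch.degZero Λ) (p - 4) 0,
      Hoch.SameClass ℂ (Hoch.degZero Λ) p 0 (Hoch.cup u x') x ∧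
      Hoch.SameClass ℂ (Hoch.gr Λ) p (-2 * q) (Hoch.total x y q)
        (Hoch.bracket 4 (p - 3) (Hoch.cup (Hoch.ext u) (Hoch.iota Λ 1))
          (Hoch.eulerMul x' (q - 1)))) := by
  obtain ⟨n, rfl⟩ := Nat.exists_eq_add_of_le' hp
  obtain ⟨h1, h2⟩ := Hoch.mem_HZ_iff.1 hu
  obtain ⟨c1, c2, c3⟩ := Hoch.solution_of_mul_bijective hu (hunit.mulInjective h1 h2)
    (hunit.mulSurjective h1 h2) huu n q x y hx hy hxy
  refine ⟨c1, c2, fun h5 => ?_⟩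
  obtain ⟨r, rfl⟩ := Nat.exists_eq_add_of_le' (show 3 ≤ n by omega)
  exact c3 r rfl
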